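/- **Setting.** Let $X,Y$ be real or complex Banach spaces, $A,B$ closed densely defined linear operators from $X$ to $Y$ with $D:=D_A\subseteq D_B$ and $\operatorname{range}A$ closed; $D$ carries the norm of $X$, $\mathbb R_+=[0,\infty)$. Let $\lambda A+B$ be a regular pencil of index $\nu$: for all complex $\lambda$ with $|\lambda|$ large $(\lambda A+B)^{-1}\in L(Y,X)$ exists, and $\nu\ge1$ is the least integer with $\|(\lambda A+B)^{-1}\|=O(|\lambda|^{\nu-1})$ as $\lambda\to\infty$ (for real spaces: for the complexified operators); index $0$ means $A^{-1}\in L(Y,X)$. Derivatives and $C^k$-smoothness are taken over $\mathbb R$, and the isomorphisms between finite-dimensional subspaces below may be real-linear. Let $n=\dim\ker A<\infty$ and let $\{\varphi_i^j\}\subset D$, $\{q_i^j\}\subset Y^*$ ($1\le i\le n$, $1\le j\le m_i$, $m_i\ge1$, $\max_i m_i=\nu$ if $n>0$) be a canonical system of eigenvectors and adjoined vectors of $A+\mu B$ at $\mu=0$ with its dual system: $\{\varphi_i^1\}$ is a basis of $\ker A$; $A\varphi_i^j=-B\varphi_i^{j-1}$ for $j\ge2$; for $x\in D$, $\langle Ax,q_i^{m_i}\rangle=0$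 and $\langle Ax,q_i^j\rangle=-\langle Bx,q_i^{j+1}\rangle$ for $j<m_i$; $\langle B\varphi_i^j,q_k^l\rangle=\delta_{ik}\delta_{jl}$. For a set $\sigma$ of pairs $(i,j)$ put $P_\sigma x=\sum_{(i,j)\in\sigma}\langle Bx,q_i^j\rangle\varphi_i^j$ on $D$ and $Q_\sigma y=\sum_{(i,j)\in\sigma}\langle y,q_i^j\rangle B\varphi_i^j$ on $Y$, with ranges $D_\sigma$ and $Y_\sigma=BD_\sigma$. The index $2$ denotes $\sigma=$ all pairs; $20$: $j=1$; $2\Sigma$ (for $P$, $D$): $j\ge2$; $P_{2s}^{(s+1)},Q_{2s}^{(s+1)},D_{2s}^{(s+1)},Y_{2s}^{(s+1)}$: $j=s+1=m_i$; $P_{2\wedge,s},Q_{2\Sigma,s},D_{2\wedge,s},Y_{2\Sigma,s}$: $j=s+1<m_i$. Let $P_1=I-P_2$, $Q_1=I-Q_2$, $D_1=P_1D$, $Y_1=Q_1Y$, and $\widetilde A x=Ax+\sum_{i=1}^n\langle Bx,q_i^1\rangle B\varphi_i^{m_i}$, a bijection $D\to Y$ with bounded inverse and $\widetilde AD_1=Y_1$.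 Components of $x\in D$ are $x_1=P_1x$, $x_{2s}^{(s+1)}=P_{2s}^{(s+1)}x$, etc. Let $f\in C(\mathbb R_+\times D,Y)$ satisfy $$f(t,x)=(Q_1+Q_{20})f(t,x)+\sum_{s=1}^{\nu-2}Q_{2\Sigma,s}f\Big(t,\sum_{j=1}^{\nu-1}x_{2j}^{(j+1)}+\sum_{j=s}^{\nu-2}x_{2\wedge,j}\Big)+\sum_{s=1}^{\nu-1}Q_{2s}^{(s+1)}f\Big(t,\sum_{j=s}^{\nu-1}x_{2j}^{(j+1)}\Big).$$ Consider $\frac{d}{dt}[Ax]+Bx=f(t,x)$ with $P_1x(t_0)=x_{0,1}$. A solution on an interval $J\subseteq\mathbb R_+$ is $x\in C(J,X)$ with $Ax\in C^1(J,Y)$ (one-sided derivatives at end points in $J$), $x(t)\in D$, satisfying the equation on $J$; "in $M$" means that $x(t)\in M$ for $t\in J$. Only extensions to the right are considered for maximal intervals. **Solvability conditions.** Let $\widetilde M_1\subseteq Y_1$, $M_{20}\subseteq D_{20}$, $M_{2s}^{(s+1)}\subseteq D_{2s}^{(s+1)}$ ($1\le s\le\nu-1$), $M_{2\wedge,s}\subseteq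 D_{2\wedge,s}$ ($1\le s\le\nu-2$) be relatively open. Put $M_1=D_1\cap\widetilde A^{-1}\widetilde M_1$, $N_s=\sum_{j=s}^{\nu-1}M_{2j}^{(j+1)}$, $N'_s=\sum_{j=s}^{\nu-2}M_{2\wedge,j}$ (an empty sum is $\{0\}$), $M_{2\Sigma}=N_1+N'_1$, $M=M_1+M_{20}+M_{2\Sigma}$. For $t\ge0$ let $$F_{2s}^{(s+1)}=Q_{2s}^{(s+1)}f(t,x+z)-Bx,\quad F_{2\Sigma,s}=Q_{2\Sigma,s}f(t,z+x+v)-Bx-A(d+e),$$ $$F_{20}=Q_{20}f(t,x_1+x_{20}+x_{2\Sigma})-Bx_{20}-Q_{20}A(d+e),$$ where in $F_{2s}^{(s+1)}$ ($1\le s\le\nu-1$): $x\in D_{2s}^{(s+1)}$, $z\in N_{s+1}$; in $F_{2\Sigma,s}$ ($1\le s\le\nu-2$): $x\in D_{2\wedge,s}$, $z\in N_1$, $v\in N'_{s+1}$, $d\in D_{2(s+1)}^{(s+2)}$, $e\in D_{2\wedge,s+1}$; in $F_{20}$: $x_1\in D_1$, $x_{20}\in D_{20}$, $x_{2\Sigma}\in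 D_{2\Sigma}$, $d\in D_{21}^{(2)}$, $e\in D_{2\wedge,1}$. Assume: * $Q_{2s}^{(s+1)}f\in C^{\nu-2}(\mathbb R_+\times N_s)$ for $1\le s\le\nu-2$, $Q_{2(\nu-1)}^{(\nu)}f\in C^{\nu-1}(\mathbb R_+\times M_{2(\nu-1)}^{(\nu)})$ if $\nu\ge2$, and $Q_{2\Sigma,s}f\in C^s(\mathbb R_+\times(N_1+N'_s))$ for $1\le s\le\nu-2$. * For all values of the remaining variables in the sets just listed (with $x_1\in M_1$, $x_{2\Sigma}\in M_{2\Sigma}$ for $F_{20}$): $F_{2s}^{(s+1)}=0$ has a unique solution $x\in M_{2s}^{(s+1)}$, $F_{2\Sigma,s}=0$ has a unique solution $x\in M_{2\wedge,s}$, and $F_{20}=0$ has a unique solution $x_{20}\in M_{20}$. * At these solutions the partial derivatives $\partial_xF_{2s}^{(s+1)}:D_{2s}^{(s+1)}\to Y_{2s}^{(s+1)}$ and $\partial_xF_{2\Sigma,s}:D_{2\wedge,s}\to Y_{2\Sigma,s}$ are invertible. * Either (Lipschitz version) $Q_1f$ and $Q_{20}f$ are locally Lipschitz with respect to $(x_1,x_{20})$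 on $\mathbb R_+\times M$ (locally uniformly in $t$, $x_{2\Sigma}$), and for each solution of $F_{20}=0$ with $x_1\in M_1,x_{20}\in M_{20},x_{2\Sigma}\in M_{2\Sigma}$ there are neighbourhoods of the values of all its variables $t\in\mathbb R_+$, $x_1\in D_1$, $x_{2\Sigma}\in D_{2\Sigma}$, $d$, $e$ and $x_{20}\in D_{20}$, an invertible $Z:D_{20}\to Y_{20}$ and $k<\|Z^{-1}\|^{-1}$ such that there $\|F_{20}(\dots,x_{20}',\dots)-F_{20}(\dots,x_{20}'',\dots)-Z(x_{20}'-x_{20}'')\|\le k\|x_{20}'-x_{20}''\|$; or (smooth version) $Q_1f$ and $Q_{20}f$ have continuous partial derivatives with respect to $x=(x_1,x_{20},x_{2\Sigma})$ on $\mathbb R_+\times M$, and $\partial_{x_{20}}F_{20}:D_{20}\to Y_{20}$ is invertible at all such solutions. **Blow-up condition on an open set $\widetilde\Omega\subseteq Y_1$.** There are $V=\min_{1\le i\le m}V_i$ ($m\ge1$) with $V_i\in C(Y_1,\mathbb R_+)$ positive and continuously differentiable on $\widetilde\Omega$, $U\in C((0,\infty),(0,\infty))$, and $\psi:\mathbb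 R_+\to\mathbb R_+$ integrable on finite intervals, with $\int^\infty\frac{du}{U(u)}<\infty$, $\int^\infty\psi\,dt=\infty$, and $$\big\langle Q_1f(t,\widetilde A^{-1}w_1+x_{20}+x_{2\Sigma})-Q_1B\widetilde A^{-1}w_1,\ \partial_{w_1}V_j(w_1)\big\rangle\ \ge\ U(V(w_1))\,\psi(t)$$ for all $t\ge0$, $x_{20}\in M_{20}$, $x_{2\Sigma}\in M_{2\Sigma}$, $w_1\in\widetilde\Omega$ and all $j$ with $V_j(w_1)=V(w_1)$. **Theorem.** Let the solvability conditions hold. (A) Let $\widetilde M_1=Y_1$ (so $M_1=D_1$), let $\sup\{\|Q_1f(t,x)\|: t\in[0,a_1],\ x\in M,\ \|x_1\|\le a_2\}<\infty$ for all $a_1,a_2>0$, and let $\widetilde\Omega_1\subseteq Y_1$ be open, $\Omega_1=\widetilde A^{-1}\widetilde\Omega_1$, such that $P_1x(t)$ remains in $\Omega_1$ on the maximal interval of existence for every solution $x$ in $M$ with $t_0\ge0$, $P_1x(t_0)\in\Omega_1$. Let the blow-up condition hold on $\widetilde\Omega_1$. Then for all $t_0\ge0$, $x_{0,1}\in\Omega_1$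 there is a $t_{max}<\infty$ such that the initial value problem has a unique solution $x(t)$ in $M$ on the maximal interval of existence $[t_0,t_{max})$, and $\lim_{t\to t_{max}-0}\|AP_1x(t)\|=\infty$. If moreover $D=X$ or $A$ is bounded, then $\lim_{t\to t_{max}-0}\|x(t)\|=\infty$. (B) Let $\sup\{\|Q_1f(t,x)\|: t\in[0,a],\ x\in M,\ \widetilde Ax_1\in\widetilde S\}<\infty$ for every $a>0$ and every closed bounded $\widetilde S\subset\widetilde M_1$ at a positive distance from $\partial\widetilde M_1$, and let the blow-up condition hold on $\widetilde M_1$. Then for all $t_0\ge0$, $x_{0,1}\in M_1$ there is a $t_{max}<\infty$ such that the initial value problem has a unique solution $x(t)$ in $M$ on the maximal interval of existence $[t_0,t_{max})$ in $M$. If this solution does not approach the boundary of $\widetilde M_1$, i.e. for each $r$ the points $AP_1x(t)$, $t\in[t_0,t_{max})$, of norm at most $r$ stay at a positive distance from $\partial\widetilde M_1$, then $\lim_{t\to t_{max}-0}\|AP_1x(t)\|=\infty$, and $\lim_{t\to t_{max}-0}\|x(t)\|=\infty$ if $D=X$ or $A$ is bounded. -/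

import Mathlib

namespace ADAE

noncomputable section

open Set Filter Topology MeasureTheory
open scoped Pointwise

/-! ### The operators and the characteristic pencil -/

/-- A pair of closed, densely defined linear operators `A`, `B` from `X` to `Y` with
`dom A ⊆ dom B` (hence `D = dom A ∩ dom B = dom A`) and closed range of `A`. -/
structure OperatorPair (𝕜 X Y : Type*) [RCLike 𝕜] [NormedAddCommGroup X] [NormedSpace 𝕜 X]
    [NormedAddCommGroup Y] [NormedSpace 𝕜 Y] where
  A : X →ₗ.[𝕜] Y
  B : X →ₗ.[𝕜] Y
  closed_A : A.IsClosed
  closed_B : B.IsClosed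
  dense_A : Dense (A.domain : Set X)
  dense_B : Dense (B.domain : Set X)
  domain_le : A.domain ≤ B.domain
  closed_range : IsClosed (range A)

variable {𝕜 X Y : Type*} [RCLike 𝕜]
  [NormedAddCommGroup X] [NormedSpace 𝕜 X] [NormedSpace ℝ X] [IsScalarTower ℝ 𝕜 X]
  [NormedAddCommGroup Y] [NormedSpace 𝕜 Y] [NormedSpace ℝ Y] [IsScalarTower ℝ 𝕜 Y]

namespace OperatorPair

/-- The common domain `D`, with the norm of `X`. -/
abbrev D (E : OperatorPair 𝕜 X Y) : Submodule 𝕜 X := E.A.domain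

/-- `A` as a linear map on `D`. -/
def opA (E : OperatorPair 𝕜 X Y) : E.D →ₗ[𝕜] Y := E.A.toFun

/-- `B` restricted to `D`. -/
def opB (E : OperatorPair 𝕜 X Y) : E.D →ₗ[𝕜] Y :=
  E.B.toFun.comp (Submodule.inclusion E.domain_le)

/-- `R = (l A + B)⁻¹`, a bounded operator defined on all of `Y`. -/
def IsResolvent (E : OperatorPair 𝕜 X Y) (l : 𝕜) (R : Y →L[𝕜] X) : Prop :=
  (∀ y, ∃ x : E.D, (x : X) = R y ∧ l • E.opA x + E.opB x = y) ∧
  ∀ x : E.D, R (l • E.opA x + E.opB x) = x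

/-- The pencil of the complexified operators: a pair `(u, v)` stands for `u + i v`, so that
`(l A + B)(u + i v)` has real part `(Re l) A u - (Im l) A v + B u` and imaginary part
`(Im l) A u + (Re l) A v + B v`. -/
def complexPencil (E : OperatorPair 𝕜 X Y) (l : ℂ) (u v : E.D) : Y × Y :=
  (l.re • E.opA u - l.im • E.opA v + E.opB u, l.im • E.opA u + l.re • E.opA v + E.opB v)

/-- `R` is the resolvent at `l` of the complexified pencil. -/
def IsComplexResolvent (E : OperatorPair 𝕜 X Y) (l : ℂ) (R : Y × Y →L[𝕜] X × X) : Prop :=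
  (∀ y, ∃ u v : E.D, ((u : X), (v : X)) = R y ∧ E.complexPencil l u v = y) ∧
  ∀ u v : E.D, R (E.complexPencil l u v) = ((u : X), (v : X))

/-- For some `C, r > 0` every complex `l` with `r ≤ |l|` is a regular point of the pencil
`l A + B`, and the resolvent satisfies `‖R(l)‖ ≤ C |l| ^ (k - 1)`.
Over the complex field (`RCLike.I ≠ 0`) this concerns the pencil itself; over the real field
(`RCLike.I = 0`) it concerns its complexification. -/
def PencilBound (E : OperatorPair 𝕜 X Y) (k : ℕ) : Prop :=
  ∃ C r : ℝ, 0 < C ∧ 0 < r ∧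
    ((RCLike.I : 𝕜) ≠ 0 → ∀ l : 𝕜, r ≤ ‖l‖ →
      ∃ R : Y →L[𝕜] X, E.IsResolvent l R ∧ ‖R‖ ≤ C * ‖l‖ ^ (k - 1)) ∧
    ((RCLike.I : 𝕜) = 0 → ∀ l : ℂ, r ≤ ‖l‖ →
      ∃ R : Y × Y →L[𝕜] X × X, E.IsComplexResolvent l R ∧ ‖R‖ ≤ C * ‖l‖ ^ (k - 1))

/-- `A` has a bounded inverse defined on all of `Y`. -/
def HasBoundedInverse (E : OperatorPair 𝕜 X Y) : Prop :=
  ∃ R : Y →L[𝕜] X, (∀ y, ∃ x : E.D, (x : X) = R y ∧ E.opA x = y) ∧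
    ∀ x : E.D, R (E.opA x) = x

/-- `l A + B` is a regular pencil of index `ν`: for `ν ≥ 1`, `ν` is the least positive integer
for which the resolvent is `O(|l| ^ (ν - 1))` at infinity; for `ν = 0`, `A` is boundedly
invertible. -/
def IsRegularPencilOfIndex (E : OperatorPair 𝕜 X Y) (ν : ℕ) : Prop :=
  (ν = 0 ∧ E.HasBoundedInverse) ∨ IsLeast {k : ℕ | 1 ≤ k ∧ E.PencilBound k} ν

end OperatorPair

/-! ### Root vectors, projectors and subspaces -/

/-- A canonical system of eigenvectors and adjoined vectors `φ i s` (`s < m i` is the order) of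
`A + μ B` at `μ = 0`, with the biorthogonal functionals `q i s`. The values `φ i s`, `q i s` with
`m i ≤ s` play no role. The relations for `q` say that `A* q i (m i - 1) = 0` and
`A* q i s = - B* q i (s + 1)`. -/
structure CanonicalSystem (E : OperatorPair 𝕜 X Y) (ν : ℕ) where
  n : ℕ
  m : Fin n → ℕ
  φ : Fin n → ℕ → E.D
  q : Fin n → ℕ → (Y →L[𝕜] 𝕜)
  one_le_m : ∀ i, 1 ≤ m i
  m_le : ∀ i, m i ≤ ν
  exists_m_eq : 0 < n → ∃ i, m i = ν
  linearIndependent_ker : LinearIndependent 𝕜 fun i => φ i 0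
  span_ker : Submodule.span 𝕜 (range fun i => φ i 0) = LinearMap.ker E.opA
  chain : ∀ i s, s + 1 < m i → E.opA (φ i (s + 1)) = - E.opB (φ i s)
  dual_last : ∀ i (x : E.D), q i (m i - 1) (E.opA x) = 0
  dual_chain : ∀ i s, s + 1 < m i → ∀ x : E.D, q i s (E.opA x) = - q i (s + 1) (E.opB x)
  biorthogonal : ∀ i s, s < m i → ∀ k r, r < m k →
    q k r (E.opB (φ i s)) = if i = k ∧ s = r then 1 else 0

namespace CanonicalSystem

variable {E : OperatorPair 𝕜 X Y} {ν : ℕ} (C : CanonicalSystem E ν)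

/-- All positions `(i, s)`, `s < m i`. -/
def all : Finset (Fin C.n × ℕ) :=
  (Finset.univ ×ˢ Finset.range ν).filter fun p => p.2 < C.m p.1

/-- The positions of the vectors of order `s` ending a chain of length `s + 1`
(upper index `(s+1)`, lower index `2s`). -/
def star (s : ℕ) : Finset (Fin C.n × ℕ) :=
  (Finset.univ.filter fun i => C.m i = s + 1) ×ˢ {s}

/-- The positions of the vectors of order `s` in the chains of length at least `s + 2`
(index `2∧,s` on the side of `X`, index `2Σ,s` on the side of `Y`). -/
def wedge (s : ℕ) : Finset (Fin C.n × ℕ) :=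
  (Finset.univ.filter fun i => s + 2 ≤ C.m i) ×ˢ {s}

/-- The positions of the eigenvectors (index `20`). -/
def zero : Finset (Fin C.n × ℕ) := Finset.univ ×ˢ {0}

/-- The positions of the adjoined vectors, of all orders `s ≥ 1` (index `2Σ` on the side of
`X`). -/
def sigma : Finset (Fin C.n × ℕ) := C.all.filter fun p => 1 ≤ p.2

/-- The projector of `D` onto the span of the root vectors with positions in `S`. -/
def P (S : Finset (Fin C.n × ℕ)) : E.D →ₗ[𝕜] E.D :=
  ∑ p ∈ S, ((C.q p.1 p.2).toLinearMap.comp E.opB).smulRight (C.φ p.1 p.2)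

/-- The projector of `Y` onto the span of the images under `B` of the root vectors with positions
in `S`. -/
def Q (S : Finset (Fin C.n × ℕ)) : Y →L[𝕜] Y :=
  ∑ p ∈ S, (C.q p.1 p.2).smulRight (E.opB (C.φ p.1 p.2))

/-- The span of the root vectors with positions in `S`. -/
def DS (S : Finset (Fin C.n × ℕ)) : Submodule 𝕜 E.D :=
  Submodule.span 𝕜 ((fun p => C.φ p.1 p.2) '' (S : Set (Fin C.n × ℕ)))

/-- The image under `B` of `DS S`. -/
def YS (S : Finset (Fin C.n × ℕ)) : Submodule 𝕜 Y := (C.DS S).map E.opB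

/-- `P₁ = I - P₂` on `D`. -/
def P1 : E.D →ₗ[𝕜] E.D := LinearMap.id - C.P C.all

/-- `Q₁ = I - Q₂`. -/
def Q1 : Y →L[𝕜] Y := ContinuousLinearMap.id 𝕜 Y - C.Q C.all

/-- `D₁ = P₁ D`. -/
def D1 : Submodule 𝕜 E.D := LinearMap.range C.P1

/-- `Y₁ = Q₁ Y`. -/
def Y1 : Submodule 𝕜 Y := LinearMap.range C.Q1.toLinearMap

/-- `Q₁` as a map into `Y₁`. -/
def toY1 (y : Y) : C.Y1 := ⟨C.Q1 y, y, rfl⟩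

/-- `Ã = A + ∑ i, ⟨·, B* q_i^1⟩ B φ_i^{m_i}` on `D`. -/
def Atilde : E.D →ₗ[𝕜] Y :=
  E.opA + ∑ i, ((C.q i 0).toLinearMap.comp E.opB).smulRight (E.opB (C.φ i (C.m i - 1)))

/-- The preimage `Ã⁻¹ Ω̃ ⊆ D₁` of a set `Ω̃ ⊆ Y₁`. -/
def preimageD1 (Ω : Set C.Y1) : Set E.D :=
  {x | x ∈ C.D1 ∧ ∃ w ∈ Ω, C.Atilde x = w}

/-- The right-hand side `f(t, x)`, `t ≥ 0`, `x ∈ D`, has the structure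
`f(t,x) = (Q₁ + Q₂₀) f(t,x) + ∑_{s=1}^{ν-2} Q_{2Σ,s} f(t, ∑_{j=1}^{ν-1} x_{2j}^{(j+1)} +
∑_{j=s}^{ν-2} x_{2∧,j}) + ∑_{s=1}^{ν-1} Q_{2s}^{(s+1)} f(t, ∑_{j=s}^{ν-1} x_{2j}^{(j+1)})`. -/
def HasStructure (f : ℝ → E.D → Y) : Prop :=
  ∀ t, 0 ≤ t → ∀ x : E.D,
    f t x = C.Q1 (f t x) + C.Q C.zero (f t x)
      + ∑ s ∈ Finset.Icc 1 (ν - 2), C.Q (C.wedge s)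
          (f t (∑ j ∈ Finset.Icc 1 (ν - 1), C.P (C.star j) x
            + ∑ j ∈ Finset.Icc s (ν - 2), C.P (C.wedge j) x))
      + ∑ s ∈ Finset.Icc 1 (ν - 1), C.Q (C.star s)
          (f t (∑ j ∈ Finset.Icc s (ν - 1), C.P (C.star j) x))

/-! ### The sets `M` and the algebraic equations -/

/-- The sets `M̃₁ ⊆ Y₁`, `M₂₀`, `M_{2s}^{(s+1)}` and `M_{2∧,s}`. -/
structure Sets where
  M1t : Set C.Y1
  M20 : Set E.D
  Mstar : ℕ → Set E.D
  Mwedge : ℕ → Set E.D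

variable {C}

/-- `M` is a relatively open subset of the subspace `W` of `D`. -/
def RelOpen (W : Submodule 𝕜 E.D) (M : Set E.D) : Prop :=
  M ⊆ W ∧ IsOpen {x : W | (x : E.D) ∈ M}

/-- All the sets are open in their subspaces. -/
def Sets.Open (S : C.Sets) : Prop :=
  IsOpen S.M1t ∧ RelOpen (C.DS C.zero) S.M20 ∧
  (∀ s ∈ Finset.Icc 1 (ν - 1), RelOpen (C.DS (C.star s)) (S.Mstar s)) ∧
  (∀ s ∈ Finset.Icc 1 (ν - 2), RelOpen (C.DS (C.wedge s)) (S.Mwedge s))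

/-- `M₁ = Ã⁻¹ M̃₁`. -/
def Sets.M1 (S : C.Sets) : Set E.D := C.preimageD1 S.M1t

/-- The direct sum of `M_{2j}^{(j+1)}`, `j = s, …, ν-1` (it is `{0}` if there are no such `j`). -/
def Sets.starSum (S : C.Sets) (s : ℕ) : Set E.D := ∑ j ∈ Finset.Icc s (ν - 1), S.Mstar j

/-- The direct sum of `M_{2∧,j}`, `j = s, …, ν-2`. -/
def Sets.wedgeSum (S : C.Sets) (s : ℕ) : Set E.D := ∑ j ∈ Finset.Icc s (ν - 2), S.Mwedge j

/-- `M_{2Σ}`. -/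
def Sets.MSigma (S : C.Sets) : Set E.D := S.starSum 1 + S.wedgeSum 1

/-- `M = M₁ ∔ M₂₀ ∔ M_{2Σ}`. -/
def Sets.M (S : C.Sets) : Set E.D := S.M1 + S.M20 + S.MSigma

variable (C)

/-- `F_{2s}^{(s+1)}` (for `s = ν - 1` it is `F_{2(ν-1)}`); `z` is the sum of the components
`x_{2j}^{(j+1)}`, `j > s`. -/
def Fstar (f : ℝ → E.D → Y) (s : ℕ) (t : ℝ) (x z : E.D) : Y :=
  C.Q (C.star s) (f t (x + z)) - E.opB x

/-- `F_{2Σ,s}`; `z` is the sum of all `x_{2j}^{(j+1)}`, `j ≥ 1`, `v` is the sum of `x_{2∧,i}`,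
`i > s`, and `d` is the sum of `d_{2(s+1)}^{(s+2)}` and `d_{2∧,s+1}`. -/
def Fwedge (f : ℝ → E.D → Y) (s : ℕ) (t : ℝ) (x z v d : E.D) : Y :=
  C.Q (C.wedge s) (f t (z + (x + v))) - E.opB x - E.opA d

/-- `F_{20}`; `d` is the sum of `d_{21}^{(2)}` and `d_{2∧,1}`. -/
def F20 (f : ℝ → E.D → Y) (t : ℝ) (x1 x20 xs d : E.D) : Y :=
  C.Q C.zero (f t (x1 + x20 + xs)) - E.opB x20 - C.Q C.zero (E.opA d)

/-- The map `F` on the subspace `W` of `D` has at `x` a (real) Fréchet derivative which is an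
isomorphism of `W` onto the subspace `Z` of `Y`. -/
def HasInvertibleDeriv (W : Submodule 𝕜 E.D) (Z : Submodule 𝕜 Y) (F : W → Y) (x : W) : Prop :=
  ∃ L : W ≃L[ℝ] Z,
    HasFDerivAt F (((Z.subtypeL).restrictScalars ℝ).comp (L : W →L[ℝ] Z)) x

/-- The smoothness of the components of `f`. -/
def Smoothness (f : ℝ → E.D → Y) (S : C.Sets) : Prop :=
  (∀ s ∈ Finset.Icc 1 (ν - 1),
    ContDiffOn ℝ (if s = ν - 1 then ((ν - 1 : ℕ) : ℕ∞) else ((ν - 2 : ℕ) : ℕ∞))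
      (fun p : ℝ × ↥(⨆ j ∈ Finset.Icc s (ν - 1), C.DS (C.star j)) =>
        C.Q (C.star s) (f p.1 (p.2 : E.D)))
      {p | 0 ≤ p.1 ∧ (p.2 : E.D) ∈ S.starSum s}) ∧
  (∀ s ∈ Finset.Icc 1 (ν - 2),
    ContDiffOn ℝ ((s : ℕ) : ℕ∞)
      (fun p : ℝ × ↥((⨆ j ∈ Finset.Icc 1 (ν - 1), C.DS (C.star j)) ⊔
          (⨆ j ∈ Finset.Icc s (ν - 2), C.DS (C.wedge j))) =>
        C.Q (C.wedge s) (f p.1 (p.2 : E.D)))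
      {p | 0 ≤ p.1 ∧ (p.2 : E.D) ∈ S.starSum 1 + S.wedgeSum s})

/-- Unique solvability of the algebraic equations in the sets `M`. -/
def UniqueSolvability (f : ℝ → E.D → Y) (S : C.Sets) : Prop :=
  (∀ s ∈ Finset.Icc 1 (ν - 1), ∀ t, 0 ≤ t → ∀ z ∈ S.starSum (s + 1),
    ∃! x, x ∈ S.Mstar s ∧ C.Fstar f s t x z = 0) ∧
  (∀ s ∈ Finset.Icc 1 (ν - 2), ∀ t, 0 ≤ t → ∀ z ∈ S.starSum 1, ∀ v ∈ S.wedgeSum (s + 1),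
    ∀ d ∈ C.DS (C.star (s + 1)), ∀ e ∈ C.DS (C.wedge (s + 1)),
    ∃! x, x ∈ S.Mwedge s ∧ C.Fwedge f s t x z v (d + e) = 0) ∧
  (∀ t, 0 ≤ t → ∀ x1 ∈ S.M1, ∀ xs ∈ S.MSigma,
    ∀ d ∈ C.DS (C.star 1), ∀ e ∈ C.DS (C.wedge 1),
    ∃! x20, x20 ∈ S.M20 ∧ C.F20 f t x1 x20 xs (d + e) = 0)

/-- Invertibility of the partial derivatives of `F_{2s}^{(s+1)}`, `s = 1, …, ν-1`, and
`F_{2Σ,s}`, `s = 1, …, ν-2`, at the solutions. -/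
def InvertibleDerivs (f : ℝ → E.D → Y) (S : C.Sets) : Prop :=
  (∀ s ∈ Finset.Icc 1 (ν - 1), ∀ t, 0 ≤ t → ∀ x : C.DS (C.star s), (x : E.D) ∈ S.Mstar s →
    ∀ z ∈ S.starSum (s + 1), C.Fstar f s t x z = 0 →
    HasInvertibleDeriv (C.DS (C.star s)) (C.YS (C.star s)) (fun u => C.Fstar f s t u z) x) ∧
  (∀ s ∈ Finset.Icc 1 (ν - 2), ∀ t, 0 ≤ t → ∀ x : C.DS (C.wedge s), (x : E.D) ∈ S.Mwedge s →
    ∀ z ∈ S.starSum 1, ∀ v ∈ S.wedgeSum (s + 1),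
    ∀ d ∈ C.DS (C.star (s + 1)), ∀ e ∈ C.DS (C.wedge (s + 1)),
    C.Fwedge f s t x z v (d + e) = 0 →
    HasInvertibleDeriv (C.DS (C.wedge s)) (C.YS (C.wedge s))
      (fun u => C.Fwedge f s t u z v (d + e)) x)

/-- Local Lipschitz continuity, with respect to `x₁ + x₂₀`, of the part `T f` of `f` on
`[0,∞) × M`, with `t` and `x_{2Σ}` as parameters. -/
def LocallyLipschitzPart (f : ℝ → E.D → Y) (S : C.Sets) (T : Y →L[𝕜] Y) : Prop :=
  ∀ t₀, 0 ≤ t₀ → ∀ a ∈ S.M1, ∀ b ∈ S.M20, ∀ c ∈ S.MSigma, ∃ ε > 0, ∃ L : ℝ,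
    ∀ t, 0 ≤ t → |t - t₀| < ε → ∀ xs ∈ S.MSigma, ‖xs - c‖ < ε →
    ∀ x1 ∈ S.M1, ‖x1 - a‖ < ε → ∀ x20 ∈ S.M20, ‖x20 - b‖ < ε →
    ∀ y1 ∈ S.M1, ‖y1 - a‖ < ε → ∀ y20 ∈ S.M20, ‖y20 - b‖ < ε →
      ‖T (f t (x1 + x20 + xs)) - T (f t (y1 + y20 + xs))‖ ≤ L * (‖x1 - y1‖ + ‖x20 - y20‖)

/-- The Lipschitz version of the condition on `Q₁ f`, `Q₂₀ f` and `F₂₀`: near every solution of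
`F₂₀ = 0` the map `F₂₀` is, with respect to `x₂₀`, approximated by an invertible operator `Z` with
a Lipschitz constant `k < 1 / ‖Z⁻¹‖`. -/
def LipschitzCondition (f : ℝ → E.D → Y) (S : C.Sets) : Prop :=
  C.LocallyLipschitzPart f S C.Q1 ∧ C.LocallyLipschitzPart f S (C.Q C.zero) ∧
  ∀ t₀, 0 ≤ t₀ → ∀ a ∈ S.M1, ∀ b ∈ S.M20, ∀ c ∈ S.MSigma,
    ∀ d₀ ∈ C.DS (C.star 1), ∀ e₀ ∈ C.DS (C.wedge 1), C.F20 f t₀ a b c (d₀ + e₀) = 0 →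
    ∃ δ > 0, ∃ ε > 0, ∃ Z : C.DS C.zero ≃L[ℝ] C.YS C.zero, ∃ k : ℝ,
      k * ‖(Z.symm : C.YS C.zero →L[ℝ] C.DS C.zero)‖ < 1 ∧
      ∀ t, 0 ≤ t → |t - t₀| < δ → ∀ x1 ∈ C.D1, ‖x1 - a‖ < δ →
      ∀ xs ∈ C.DS C.sigma, ‖xs - c‖ < δ →
      ∀ d ∈ C.DS (C.star 1), ‖d - d₀‖ < δ → ∀ e ∈ C.DS (C.wedge 1), ‖e - e₀‖ < δ →
      ∀ u v : C.DS C.zero, ‖(u : E.D) - b‖ < ε → ‖(v : E.D) - b‖ < ε →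
        ‖C.F20 f t x1 u xs (d + e) - C.F20 f t x1 v xs (d + e) - (Z (u - v) : Y)‖
          ≤ k * ‖u - v‖

/-- The part `T f` of `f` has a continuous partial derivative with respect to
`x = x₁ + x₂₀ + x_{2Σ}` on `[0,∞) × M`. -/
def ContinuousPartialDeriv (f : ℝ → E.D → Y) (S : C.Sets) (T : Y →L[𝕜] Y) : Prop :=
  ∃ G : ℝ × (C.D1 × C.DS C.zero × C.DS C.sigma) →
      ((C.D1 × C.DS C.zero × C.DS C.sigma) →L[ℝ] Y),
    (∀ t, 0 ≤ t → ∀ x : C.D1 × C.DS C.zero × C.DS C.sigma,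
      (x.1 : E.D) ∈ S.M1 → (x.2.1 : E.D) ∈ S.M20 → (x.2.2 : E.D) ∈ S.MSigma →
      HasFDerivAt (fun x : C.D1 × C.DS C.zero × C.DS C.sigma =>
        T (f t ((x.1 : E.D) + x.2.1 + x.2.2))) (G (t, x)) x) ∧
    ContinuousOn G {p | 0 ≤ p.1 ∧ (p.2.1 : E.D) ∈ S.M1 ∧ (p.2.2.1 : E.D) ∈ S.M20 ∧
      (p.2.2.2 : E.D) ∈ S.MSigma}

/-- The differentiable version of the condition on `Q₁ f`, `Q₂₀ f` and `F₂₀`. -/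
def DifferentiableCondition (f : ℝ → E.D → Y) (S : C.Sets) : Prop :=
  C.ContinuousPartialDeriv f S C.Q1 ∧ C.ContinuousPartialDeriv f S (C.Q C.zero) ∧
  ∀ t, 0 ≤ t → ∀ x1 ∈ S.M1, ∀ x20 : C.DS C.zero, (x20 : E.D) ∈ S.M20 → ∀ xs ∈ S.MSigma,
    ∀ d ∈ C.DS (C.star 1), ∀ e ∈ C.DS (C.wedge 1), C.F20 f t x1 x20 xs (d + e) = 0 →
    HasInvertibleDeriv (C.DS C.zero) (C.YS C.zero) (fun u => C.F20 f t x1 u xs (d + e)) x20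

/-- The conditions on `f` and the sets `M` under which the initial value problem is locally
uniquely solvable in `M`. -/
structure SolvabilityConditions (f : ℝ → E.D → Y) (S : C.Sets) : Prop where
  isOpen : S.Open
  smooth : C.Smoothness f S
  uniqueSolvability : C.UniqueSolvability f S
  invertibleDerivs : C.InvertibleDerivs f S
  lipschitz_or_differentiable : C.LipschitzCondition f S ∨ C.DifferentiableCondition f S

end CanonicalSystem

/-! ### Solutions -/

namespace OperatorPair

variable (E : OperatorPair 𝕜 X Y)

/-- `x` is a solution of `(d/dt)(A x) + B x = f(t, x)` on `J` with values in `M ⊆ D`: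
`x` is continuous into `X`, `A x` is continuously differentiable (one-sidedly at an end point
belonging to `J`), and the equation holds on `J`. -/
def IsSolutionOn (f : ℝ → E.D → Y) (M : Set E.D) (J : Set ℝ) (x : ℝ → E.D) : Prop :=
  ContinuousOn (fun t => (x t : X)) J ∧ (∀ t ∈ J, x t ∈ M) ∧
  ∃ y' : ℝ → Y, ContinuousOn y' J ∧ ∀ t ∈ J,
    HasDerivWithinAt (fun τ => E.opA (x τ)) (y' t) J t ∧ y' t + E.opB (x t) = f t (x t)

/-- `J` is a nondegenerate interval with left end point `t₀ ∈ J`. -/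
def IsForwardInterval (t₀ : ℝ) (J : Set ℝ) : Prop :=
  t₀ ∈ J ∧ J ⊆ Ici t₀ ∧ J.OrdConnected ∧ J.Nontrivial

/-- `J` is the (right) maximal interval of existence, starting at `t₀`, of the solution `x` in
`M`. -/
def IsMaximalSolution (f : ℝ → E.D → Y) (M : Set E.D) (t₀ : ℝ) (J : Set ℝ) (x : ℝ → E.D) :
    Prop :=
  IsForwardInterval t₀ J ∧ E.IsSolutionOn f M J x ∧
  ∀ (J' : Set ℝ) (y : ℝ → E.D), IsForwardInterval t₀ J' → J ⊆ J' →
    E.IsSolutionOn f M J' y → EqOn y x J → J' = J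

/-- `x` is the unique solution in `M` with `P₁ x(t₀) = x₁⁰`, and `[t₀, T)` is its maximal interval
of existence: every other solution in `M` with this initial condition is a restriction of `x`. -/
def IsUniqueMaximalSolution {ν : ℕ} (C : CanonicalSystem E ν) (f : ℝ → E.D → Y) (M : Set E.D)
    (t₀ T : ℝ) (x₁₀ : E.D) (x : ℝ → E.D) : Prop :=
  E.IsMaximalSolution f M t₀ (Ico t₀ T) x ∧ C.P1 (x t₀) = x₁₀ ∧
  ∀ (J : Set ℝ) (y : ℝ → E.D), IsForwardInterval t₀ J → E.IsSolutionOn f M J y →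
    C.P1 (y t₀) = x₁₀ → J ⊆ Ico t₀ T ∧ EqOn y x J

/-- `D = X`, or `A` is bounded. -/
def IsBoundedA : Prop :=
  E.D = ⊤ ∨ ∃ K : ℝ, ∀ x : E.D, ‖E.opA x‖ ≤ K * ‖x‖

end OperatorPair

/-! ### The conditions for blow-up -/

namespace CanonicalSystem

variable {E : OperatorPair 𝕜 X Y} {ν : ℕ} (C : CanonicalSystem E ν)

/-- `Q₁ f` is bounded on the part of `[0, a₁] × M` where `‖x₁‖ ≤ a₂`. -/
def BoundedOnBounded (f : ℝ → E.D → Y) (S : C.Sets) : Prop :=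
  ∀ a₁ > 0, ∀ a₂ > 0, ∃ K : ℝ, ∀ t ∈ Icc (0 : ℝ) a₁, ∀ x1 ∈ S.M1, ‖x1‖ ≤ a₂ →
    ∀ x20 ∈ S.M20, ∀ xs ∈ S.MSigma, ‖C.Q1 (f t (x1 + x20 + xs))‖ ≤ K

/-- `Q₁ f` is bounded on the part of `[0, a] × M` where `Ã x₁ ∈ K`, for all closed bounded
`K ⊆ M̃₁` lying at a positive distance from the boundary of `M̃₁`. -/
def BoundedInside (f : ℝ → E.D → Y) (S : C.Sets) : Prop :=
  ∀ a > 0, ∀ K : Set C.Y1, IsClosed K → Bornology.IsBounded K →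
    (∃ δ > 0, ∀ w ∈ K, Metric.ball w δ ⊆ S.M1t) →
    ∃ N : ℝ, ∀ t ∈ Icc (0 : ℝ) a, ∀ x1 ∈ C.preimageD1 K,
      ∀ x20 ∈ S.M20, ∀ xs ∈ S.MSigma, ‖C.Q1 (f t (x1 + x20 + xs))‖ ≤ N

/-- The component `P₁ x(t)` of each maximal solution in `M` that starts in `Ω₁ = Ã⁻¹ Ω̃₁` remains
in `Ω₁`. -/
def IsInvariant (f : ℝ → E.D → Y) (S : C.Sets) (Ω : Set C.Y1) : Prop :=
  ∀ t₀, 0 ≤ t₀ → ∀ (J : Set ℝ) (x : ℝ → E.D), E.IsMaximalSolution f S.M t₀ J x →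
    C.P1 (x t₀) ∈ C.preimageD1 Ω → ∀ t ∈ J, C.P1 (x t) ∈ C.preimageD1 Ω

/-- There are functionals `V = min_i V_i`, `U` and `ψ` with `∫^∞ du / U(u) < ∞`, `∫^∞ ψ = ∞` and
`⟨Q₁ f(t, Ã⁻¹ w + x₂₀ + x_{2Σ}) - Q₁ B Ã⁻¹ w, ∂V_j(w)⟩ ≥ U(V(w)) ψ(t)` for `w ∈ Ω̃₁` and all `j`
with `V_j(w) = V(w)`. Here `x₁ = Ã⁻¹ w ∈ D₁`, and `∂V_j` is the real Fréchet derivative. -/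
def HasBlowUpFunctional (f : ℝ → E.D → Y) (S : C.Sets) (Ω : Set C.Y1) : Prop :=
  ∃ (m : ℕ) (V : Fin (m + 1) → C.Y1 → ℝ) (U ψ : ℝ → ℝ),
    (∀ i, Continuous (V i) ∧ (∀ w, 0 ≤ V i w) ∧ (∀ w ∈ Ω, 0 < V i w) ∧
      ContDiffOn ℝ 1 (V i) Ω) ∧
    ContinuousOn U (Ioi 0) ∧ (∀ u > 0, 0 < U u) ∧
    (∀ t, 0 ≤ t → 0 ≤ ψ t) ∧ (∀ b, IntegrableOn ψ (Icc 0 b)) ∧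
    (∀ u₀ > 0, IntegrableOn (fun u => 1 / U u) (Ioi u₀)) ∧
    (∀ t₀ > 0, ¬ IntegrableOn ψ (Ioi t₀)) ∧
    ∀ t, 0 ≤ t → ∀ x20 ∈ S.M20, ∀ xs ∈ S.MSigma, ∀ w ∈ Ω, ∀ x1 ∈ C.D1,
      C.Atilde x1 = w → ∀ j, V j w = ⨅ i, V i w →
      U (⨅ i, V i w) * ψ t ≤
        fderiv ℝ (V j) w (C.toY1 (f t (x1 + x20 + xs)) - C.toY1 (E.opB x1))

/-- `‖A P₁ x(t)‖ → ∞` as `t → T - 0`, and also `‖x(t)‖ → ∞` if `D = X` or `A` is bounded. -/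
def BlowsUp (T : ℝ) (x : ℝ → E.D) : Prop :=
  Tendsto (fun t => ‖E.opA (C.P1 (x t))‖) (𝓝[<] T) atTop ∧
  (E.IsBoundedA → Tendsto (fun t => ‖(x t : X)‖) (𝓝[<] T) atTop)

/-- On `[t₀, T)` the component `w₁(t) = Ã P₁ x(t)` does not approach the boundary of `M̃₁`: for
each `r`, the points `w₁(t)` with `‖w₁(t)‖ ≤ r` stay at a positive distance from it. -/
def StaysAwayFromBoundary (S : C.Sets) (t₀ T : ℝ) (x : ℝ → E.D) : Prop :=
  ∀ r : ℝ, ∃ δ > 0, ∀ t ∈ Ico t₀ T, ∀ w : C.Y1, C.Atilde (C.P1 (x t)) = w → ‖w‖ ≤ r →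
    Metric.ball w δ ⊆ S.M1t

end CanonicalSystem

end

end ADAE

/-!
The equation `(A x)' + B x = f(t, x)` is split along `D = D₁ ∔ D₂`, `Y = Y₁ ∔ Y₂` into a
differential equation in `Y₁` and algebraic equations, which can be solved one after the other
because of the structure of `f`.

* A functional `q` of a root vector that ends its chain annihilates the range of `A`. In such a
  coordinate of order `s ≥ 1` the equation is the algebraic equation `F_{2s}^{(s+1)} = 0`. By unique
  solvability these equations determine the components `x_{2s}^{(s+1)}(t)`, downwards in `s`.
  In any other coordinate of order `s`, `A x` is up to sign a coordinate of `x` of order `s + 1`.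
  This one is known already as a function of `t`, and if its derivative is inserted for `d`, `e`, the
  equation becomes `F_{2Σ,s} = 0`. Each step costs one derivative, for which the assumed smoothness
  of `f` and the implicit function theorem on the half-line `t ≥ 0` (`contDiffOn_of_implicit`)
  suffice: `exists_isAdjointPart`. Hence `x_{2Σ}` is a `C¹` function of `t` alone, the same for all
  solutions.
* `Ã` has a bounded inverse (`exists_Atilde_inverse`), so that `w = Ã x₁ = A P₁ x` can replace `x₁`.
  The equation of order zero is `F₂₀ = 0`, and its solution `x₂₀ = η(t, w)` is continuous and locally
  Lipschitz in `w` in both versions of the hypothesis: what either of them yields is that `F₂₀` is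
  uniformly close to an isomorphism near its zeros (`exists_approximatesLinearOn`), and that `Q₁ f` and
  `Q₂₀ f` are locally Lipschitz (`exists_lipschitz`).
* What remains is `w' = Q₁ f(t, x) - Q₁ B Ã⁻¹ w`, an ordinary differential equation in the open set
  `M̃₁` with a locally Lipschitz right-hand side (`locallyLipschitzField`). Its solutions correspond to
  the solutions in `M` of the given equation (`isSolutionOn_of_solvesOn`,
  `solvesOn_of_isSolutionOn`). It has a unique maximal solution
  (`LocallyLipschitzField.exists_maximal_solution`).
* The maximal interval is bounded: the right derivative of `∫^{V(w(t))} du / U(u)` is at least `ψ(t)`,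
  which is impossible for all `t` as the former function is bounded and `∫^∞ ψ = ∞`
  (`not_global_of_blowUp`).
* If `‖w‖` did not tend to infinity, the curve would be confined to a ball shortly before the end of the
  interval, where the right-hand side is bounded; so it would have a limit, in `M̃₁` since it stays away
  from the boundary, and could be continued (`tendsto_norm_atTop_of_no_limit`). Finally
  `w = Q₁ A x`, so `‖x‖` tends to infinity as well if `A` is bounded.
-/

namespace ADAE

noncomputable section

open Set Filter Topology MeasureTheory
open scoped Pointwise NNReal

/-! ### Ordinary differential equations on an open set -/

section ODE

variable {F : Type*} [NormedAddCommGroup F] [NormedSpace ℝ F]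

/-- The field `g(t, w)`, `t ≥ 0`, is continuous on the open set `U` and locally Lipschitz with
respect to `w`, locally uniformly in `t`. -/
structure LocallyLipschitzField (g : ℝ → F → F) (U : Set F) : Prop where
  isOpen : IsOpen U
  continuousOn : ContinuousOn (fun p : ℝ × F => g p.1 p.2) (Ici 0 ×ˢ U)
  lipschitz : ∀ t₀, 0 ≤ t₀ → ∀ w₀ ∈ U, ∃ δ > 0, ∃ K : ℝ≥0, ∀ t, 0 ≤ t → |t - t₀| < δ →
    LipschitzOnWith K (g t) (Metric.ball w₀ δ ∩ U)

/-- `w` solves `w' = g(t, w)` on `J` with values in `U`. -/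
def SolvesOn (g : ℝ → F → F) (U : Set F) (J : Set ℝ) (w : ℝ → F) : Prop :=
  ∀ t ∈ J, w t ∈ U ∧ HasDerivWithinAt w (g t (w t)) J t

variable {g : ℝ → F → F} {U : Set F}

lemma SolvesOn.mono {J J' : Set ℝ} {w : ℝ → F} (h : SolvesOn g U J w) (hJ : J' ⊆ J) :
    SolvesOn g U J' w := fun t ht => ⟨(h t (hJ ht)).1, (h t (hJ ht)).2.mono hJ⟩

lemma SolvesOn.continuousOn {J : Set ℝ} {w : ℝ → F} (h : SolvesOn g U J w) :
    ContinuousOn w J := fun t ht => (h t ht).2.continuousWithinAt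

/-- Local existence to the right of `t₁`, by the Picard–Lindelöf theorem. Nothing is assumed about the
field for negative times, so at `t₁ = 0` there is no solution to the left. -/
lemma LocallyLipschitzField.exists_local_solution [CompleteSpace F]
    (hg : LocallyLipschitzField g U) {t₁ : ℝ} (ht₁ : 0 ≤ t₁) {w₁ : F} (hw₁ : w₁ ∈ U) :
    ∃ b > t₁, ∃ α : ℝ → F, α t₁ = w₁ ∧ SolvesOn g U (Icc t₁ b) α := by
  obtain ⟨δ, hδ, K, hK⟩ := hg.lipschitz t₁ ht₁ w₁ hw₁
  have hc := hg.continuousOn (t₁, w₁) ⟨ht₁, hw₁⟩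
  obtain ⟨ρ, hρ, hρ'⟩ := Metric.continuousWithinAt_iff.1 hc 1 one_pos
  obtain ⟨r, hr, hrU⟩ := Metric.isOpen_iff.1 hg.isOpen w₁ hw₁
  set a : ℝ := min δ (min ρ r) / 2 with ha
  have ha0 : 0 < a := by positivity
  have haδ : a < δ := by have := min_le_left δ (min ρ r); linarith
  have haρ : a < ρ := by
    have := (min_le_right δ (min ρ r)).trans (min_le_left _ _); linarith
  have har : a < r := by
    have := (min_le_right δ (min ρ r)).trans (min_le_right _ _); linarith
  -- `L` bounds the field on the ball of radius `a`, so the curve needs the time `a / L` to leave it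
  set L : ℝ := ‖g t₁ w₁‖ + 1 with hL
  have hL1 : 1 ≤ L := by simp [hL]
  set ε : ℝ := a / L with hε
  have hε0 : 0 < ε := by positivity
  have hεa : ε ≤ a := div_le_self ha0.le hL1
  have hball : ∀ w ∈ Metric.closedBall w₁ a, w ∈ U := fun w hw =>
    hrU (Metric.closedBall_subset_ball har hw)
  have hpl : IsPicardLindelof g (tmin := t₁) (tmax := t₁ + ε) ⟨t₁, le_rfl, by linarith⟩ w₁
      ⟨a, ha0.le⟩ 0 ⟨L, by linarith⟩ K := by
    refine ⟨fun t ht => ?_, fun x hx => ?_, fun t ht x hx => ?_, ?_⟩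
    · refine (hK t (ht₁.trans ht.1) ?_).mono fun w hw =>
        ⟨Metric.closedBall_subset_ball haδ hw, hball w hw⟩
      rw [abs_of_nonneg (by linarith [ht.1])]; linarith [ht.2]
    · have hp : ContinuousOn (fun t : ℝ => (t, x)) (Icc t₁ (t₁ + ε)) := by fun_prop
      exact hg.continuousOn.comp hp fun t ht => ⟨ht₁.trans ht.1, hball x hx⟩
    · have hd : dist (t, x) (t₁, w₁) < ρ := by
        rw [Prod.dist_eq, max_lt_iff]
        refine ⟨?_, lt_of_le_of_lt hx haρ⟩
        rw [Real.dist_eq, abs_of_nonneg (by simpa using ht.1)]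
        simp only; linarith [ht.2]
      have h1 := hρ' (show (t, x) ∈ Ici (0 : ℝ) ×ˢ U from ⟨ht₁.trans ht.1, hball x hx⟩) hd
      rw [dist_eq_norm] at h1
      have h2 := norm_le_norm_add_norm_sub' (g t x) (g t₁ w₁)
      change ‖g t x‖ ≤ L
      simp only at h1
      linarith
    · simp only [add_sub_cancel_left, sub_self, NNReal.coe_zero, sub_zero]
      rw [max_eq_left hε0.le, hε]
      exact (mul_div_cancel₀ _ (by positivity)).le
  obtain ⟨α, hα0, hα⟩ := hpl.exists_eq_forall_mem_Icc_hasDerivWithinAt₀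
  simp only at hα0
  -- the curve stays in `U` for a short time
  have hev : ∀ᶠ t in 𝓝[Icc t₁ (t₁ + ε)] t₁, α t ∈ U :=
    (hα t₁ ⟨le_rfl, by linarith⟩).continuousWithinAt.eventually_mem
      (by rw [hα0]; exact hg.isOpen.mem_nhds hw₁)
  obtain ⟨η, hη, hηU⟩ := Metric.mem_nhdsWithin_iff.1 hev
  refine ⟨t₁ + min ε (η / 2), lt_add_of_pos_right _ (by positivity), α, hα0, fun t ht => ⟨hηU ⟨?_, ht.1, ?_⟩, ?_⟩⟩
  · rw [Metric.mem_ball, Real.dist_eq, abs_of_nonneg (by linarith [ht.1])]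
    linarith [ht.2, min_le_right ε (η / 2)]
  · linarith [ht.2, min_le_left ε (η / 2)]
  · have hs : Icc t₁ (t₁ + min ε (η / 2)) ⊆ Icc t₁ (t₁ + ε) :=
      Icc_subset_Icc_right (by linarith [min_le_left ε (η / 2)])
    exact (hα t (hs ht)).mono hs

/-- Uniqueness on intervals: within `[t₀, b]` the solutions agree on a closed set, which contains with
each point other than `b` points to the right of it. -/
lemma LocallyLipschitzField.eqOn (hg : LocallyLipschitzField g U) {t₀ : ℝ} (ht₀ : 0 ≤ t₀)
    {J : Set ℝ} (h0 : t₀ ∈ J) (hJ0 : J ⊆ Ici t₀) (hJ : J.OrdConnected) {α β : ℝ → F}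
    (hα : SolvesOn g U J α) (hβ : SolvesOn g U J β) (h : α t₀ = β t₀) : EqOn α β J := by
  intro b hb
  have hsub : Icc t₀ b ⊆ J := hJ.out h0 hb
  have hα' := hα.mono hsub
  have hβ' := hβ.mono hsub
  have hcl : IsClosed ({t | α t = β t} ∩ Icc t₀ b) := by
    have := (hα'.continuousOn.sub hβ'.continuousOn).preimage_isClosed_of_isClosed isClosed_Icc
      (isClosed_singleton (x := (0 : F)))
    convert this using 1
    ext t; simp [sub_eq_zero, and_comm]
  refine hcl.Icc_subset_of_forall_exists_gt h ?_ ⟨hJ0 hb, le_rfl⟩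
  rintro t ⟨hte, ht⟩ y hy
  have hte : α t = β t := hte
  have htI : t ∈ Icc t₀ b := ⟨ht.1, ht.2.le⟩
  obtain ⟨δ, hδ, K, hK⟩ := hg.lipschitz t (ht₀.trans ht.1) (α t) (hα' t htI).1
  have e1 : ∀ᶠ τ in 𝓝[Icc t₀ b] t, α τ ∈ Metric.ball (α t) δ :=
    (hα'.continuousOn t htI).eventually_mem (Metric.ball_mem_nhds _ hδ)
  have e2 : ∀ᶠ τ in 𝓝[Icc t₀ b] t, β τ ∈ Metric.ball (α t) δ := by
    rw [hte]
    exact (hβ'.continuousOn t htI).eventually_mem (Metric.ball_mem_nhds _ hδ)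
  obtain ⟨η, hη, hηs⟩ := Metric.mem_nhdsWithin_iff.1 (e1.and e2)
  have hy' : t < y := hy
  set c : ℝ := min (min y b) (t + min δ η / 2) with hc
  have htc : t < c := by
    have : 0 < min δ η / 2 := by positivity
    simp only [hc, lt_min_iff]; exact ⟨⟨hy', ht.2⟩, by linarith⟩
  have hcb : c ≤ b := (min_le_left _ _).trans (min_le_right _ _)
  have hcy : c ≤ y := (min_le_left _ _).trans (min_le_left _ _)
  have hcd : c ≤ t + min δ η / 2 := min_le_right _ _
  have hmin : 0 < min δ η := by positivity
  have hmem : ∀ τ ∈ Ico t c, τ ∈ Icc t₀ b := fun τ hτ => ⟨ht.1.trans hτ.1, hτ.2.le.trans hcb⟩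
  have habs : ∀ τ ∈ Ico t c, |τ - t| < min δ η := fun τ hτ => by
    rw [abs_of_nonneg (by linarith [hτ.1])]; linarith [hτ.2]
  have hin : ∀ τ ∈ Ico t c, α τ ∈ Metric.ball (α t) δ ∧ β τ ∈ Metric.ball (α t) δ := fun τ hτ =>
    hηs ⟨(habs τ hτ).trans_le (min_le_right _ _), hmem τ hτ⟩
  have hder : ∀ {γ : ℝ → F}, SolvesOn g U (Icc t₀ b) γ → ∀ τ ∈ Ico t c,
      HasDerivWithinAt γ (g τ (γ τ)) (Ici τ) τ := fun {γ} hγ τ hτ =>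
    (hγ τ (hmem τ hτ)).2.mono_of_mem_nhdsWithin <| mem_of_superset
      (Icc_mem_nhdsGE (hτ.2.trans_le hcb)) (Icc_subset_Icc_left (hmem τ hτ).1)
  have hs : Icc t c ⊆ Icc t₀ b := Icc_subset_Icc ht.1 hcb
  have := ODE_solution_unique_of_mem_Icc_right (v := g) (K := K)
    (s := fun _ => Metric.ball (α t) δ ∩ U) (a := t) (b := c)
    (fun τ hτ => hK τ (ht₀.trans (hmem τ hτ).1) ((habs τ hτ).trans_le (min_le_left _ _)))
    (hα'.continuousOn.mono hs) (hder hα') (fun τ hτ => ⟨(hin τ hτ).1, (hα' τ (hmem τ hτ)).1⟩)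
    (hβ'.continuousOn.mono hs) (hder hβ') (fun τ hτ => ⟨(hin τ hτ).2, (hβ' τ (hmem τ hτ)).1⟩) hte
  exact ⟨c, this ⟨htc.le, le_rfl⟩, htc, hcy⟩

/-- A solution with a limit in `U` at `T` can be continued by the solution that starts from the
limit. -/
lemma LocallyLipschitzField.exists_extension [CompleteSpace F]
    (hg : LocallyLipschitzField g U) {t₀ T : ℝ} (ht₀ : 0 ≤ t₀) (hT : t₀ < T) {w : ℝ → F}
    (hw : SolvesOn g U (Ico t₀ T) w) {wT : F} (hwT : wT ∈ U)
    (hlim : Tendsto w (𝓝[<] T) (𝓝 wT)) :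
    ∃ b > T, ∃ z : ℝ → F, SolvesOn g U (Ico t₀ b) z ∧ EqOn z w (Ico t₀ T) := by
  obtain ⟨b, hb, α, hα0, hα⟩ := hg.exists_local_solution (ht₀.trans hT.le) hwT
  have hb : T < b := hb
  classical
  set z : ℝ → F := fun t => if t < T then w t else α t with hz
  have hzw : EqOn z w (Iio T) := fun t ht => if_pos ht
  have hzα : EqOn z α (Ici T) := fun t ht => if_neg (not_lt.2 ht)
  refine ⟨b, hb, z, fun t ht => ?_, fun t ht => hzw ht.2⟩
  rcases lt_trichotomy t T with h | h | h
  · have hm : t ∈ Ico t₀ T := ⟨ht.1, h⟩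
    rw [hzw h]
    refine ⟨(hw t hm).1, ?_⟩
    have h1 : HasDerivWithinAt w (g t (w t)) (Ico t₀ b) t :=
      (hw t hm).2.mono_of_mem_nhdsWithin <| by
        rw [← Ici_inter_Iio]
        exact inter_mem (mem_of_superset self_mem_nhdsWithin fun x hx => hx.1)
          (mem_nhdsWithin_of_mem_nhds (Iio_mem_nhds h))
    refine h1.congr_of_eventuallyEq ?_ (hzw h)
    exact mem_nhdsWithin_of_mem_nhds (mem_of_superset (Iio_mem_nhds h) hzw)
  · subst h
    have hzt : z t = wT := by rw [hzα self_mem_Ici, hα0]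
    rw [hzt]
    refine ⟨hwT, ?_⟩
    have hright : HasDerivWithinAt z (g t wT) (Ici t) t := by
      have h1 := (hα t ⟨le_rfl, hb.le⟩).2.mono_of_mem_nhdsWithin (Icc_mem_nhdsGE hb)
      rw [hα0] at h1
      exact h1.congr hzα (hzα self_mem_Ici)
    have hderiv : ∀ τ ∈ Ioo t₀ t, HasDerivAt z (g τ (w τ)) τ := fun τ hτ => by
      have h1 := ((hw τ ⟨hτ.1.le, hτ.2⟩).2).hasDerivAt (Ico_mem_nhds hτ.1 hτ.2)
      exact h1.congr_of_eventuallyEq (mem_of_superset (Iio_mem_nhds hτ.2) hzw)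
    have hlimz : Tendsto z (𝓝[<] t) (𝓝 (z t)) := by
      rw [hzt]
      exact hlim.congr' (eventually_of_mem self_mem_nhdsWithin fun x hx => (hzw hx).symm)
    have hIoo : Ioo t₀ t ∈ 𝓝[<] t := Ioo_mem_nhdsLT hT
    -- the derivative extends continuously to `T` from the left
    have hleft : HasDerivWithinAt z (g t wT) (Iic t) t := by
      refine hasDerivWithinAt_Iic_of_tendsto_deriv (s := Ioo t₀ t)
        (fun τ hτ => (hderiv τ hτ).differentiableAt.differentiableWithinAt)
        (hlimz.mono_left (nhdsWithin_mono _ fun x hx => hx.2)) hIoo ?_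
      have hgc := hg.continuousOn (t, wT) ⟨ht₀.trans hT.le, hwT⟩
      have : Tendsto (fun τ => (τ, w τ)) (𝓝[<] t) (𝓝[Ici 0 ×ˢ U] (t, wT)) := by
        refine tendsto_nhdsWithin_iff.2 ⟨(tendsto_nhdsWithin_of_tendsto_nhds tendsto_id).prodMk_nhds
          hlim, ?_⟩
        filter_upwards [hIoo] with τ hτ
        exact ⟨ht₀.trans hτ.1.le, (hw τ ⟨hτ.1.le, hτ.2⟩).1⟩
      refine (hgc.tendsto.comp this).congr' ?_
      filter_upwards [hIoo] with τ hτ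
      exact (hderiv τ hτ).deriv.symm
    have := hleft.union hright
    rw [Iic_union_Ici] at this
    exact this.mono (subset_univ _)
  · have hm : t ∈ Icc T b := ⟨h.le, ht.2.le⟩
    rw [hzα h.le]
    refine ⟨(hα t hm).1, ?_⟩
    have h1 := (hα t hm).2.hasDerivAt (Icc_mem_nhds h ht.2)
    exact (h1.congr_of_eventuallyEq
      (mem_of_superset (Ioi_mem_nhds h) fun x hx => hzα (mem_Ici.2 (le_of_lt hx)))).hasDerivWithinAt

/-- The unique maximal solution of a locally Lipschitz equation. If its interval of existence
`[t₀, T)` is bounded, then the solution has no limit in `U` as `t → T - 0`. -/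
theorem LocallyLipschitzField.exists_maximal_solution [CompleteSpace F]
    (hg : LocallyLipschitzField g U) {t₀ : ℝ} (ht₀ : 0 ≤ t₀) {w₀ : F} (hw₀ : w₀ ∈ U) :
    ∃ (J : Set ℝ) (w : ℝ → F), (J = Ici t₀ ∨ ∃ T > t₀, J = Ico t₀ T ∧
        ∀ wT ∈ U, ¬ Tendsto w (𝓝[<] T) (𝓝 wT)) ∧
      w t₀ = w₀ ∧ SolvesOn g U J w ∧
      ∀ (J' : Set ℝ) (z : ℝ → F), t₀ ∈ J' → J' ⊆ Ici t₀ → J'.OrdConnected → SolvesOn g U J' z →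
        z t₀ = w₀ → J' ⊆ J ∧ EqOn z w J' := by
  classical
  -- the right end points of the intervals on which a solution exists; any two of these solutions
  -- agree where both are defined
  set B : Set ℝ := {b | t₀ < b ∧ ∃ w : ℝ → F, w t₀ = w₀ ∧ SolvesOn g U (Ico t₀ b) w} with hB
  obtain ⟨b₀, hb₀, α, hα0, hα⟩ := hg.exists_local_solution ht₀ hw₀
  have hb₀B : b₀ ∈ B := ⟨hb₀, α, hα0, hα.mono Ico_subset_Icc_self⟩
  choose! W hW0 hW using fun b (hb : b ∈ B) => hb.2
  have hagree : ∀ b ∈ B, ∀ b' ∈ B, ∀ t ∈ Ico t₀ (min b b'), W b t = W b' t := by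
    intro b hb b' hb'
    refine hg.eqOn (J := Ico t₀ (min b b')) ht₀ ⟨le_rfl, lt_min hb.1 hb'.1⟩ (fun t ht => ht.1)
      ordConnected_Ico
      ((hW b hb).mono (Ico_subset_Ico_right (min_le_left _ _)))
      ((hW b' hb').mono (Ico_subset_Ico_right (min_le_right _ _))) ?_
    rw [hW0 b hb, hW0 b' hb']
  set J : Set ℝ := {t | t₀ ≤ t ∧ ∃ b ∈ B, t < b} with hJ
  set w : ℝ → F := fun t => if h : ∃ b ∈ B, t < b then W h.choose t else 0 with hw
  have hwW : ∀ b ∈ B, EqOn w (W b) (Ico t₀ b) := by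
    intro b hb t ht
    have h : ∃ b ∈ B, t < b := ⟨b, hb, ht.2⟩
    have h2 : w t = W h.choose t := dif_pos h
    rw [h2]
    exact hagree _ h.choose_spec.1 b hb t ⟨ht.1, lt_min h.choose_spec.2 ht.2⟩
  have hwt₀ : w t₀ = w₀ := by
    rw [hwW b₀ hb₀B ⟨le_rfl, hb₀⟩, hW0 b₀ hb₀B]
  have hsol : SolvesOn g U J w := by
    rintro t ⟨h0, b, hb, htb⟩
    rw [hwW b hb ⟨h0, htb⟩]
    obtain ⟨h1, h2⟩ := hW b hb t ⟨h0, htb⟩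
    have hmem : Ico t₀ b ∈ 𝓝[J] t := by
      rw [← Ici_inter_Iio]
      exact inter_mem (mem_of_superset self_mem_nhdsWithin fun x hx => hx.1)
        (mem_nhdsWithin_of_mem_nhds (Iio_mem_nhds htb))
    exact ⟨h1, (h2.mono_of_mem_nhdsWithin hmem).congr_of_eventuallyEq
      (mem_of_superset hmem (hwW b hb)) (hwW b hb ⟨h0, htb⟩)⟩
  have hcases : J = Ici t₀ ∨ ∃ T > t₀, J = Ico t₀ T ∧
      ∀ wT ∈ U, ¬ Tendsto w (𝓝[<] T) (𝓝 wT) := by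
    by_cases hbd : BddAbove B
    · right
      have hJT : J = Ico t₀ (sSup B) := by
        ext t
        refine ⟨fun ⟨h0, b, hb, htb⟩ => ⟨h0, htb.trans_le (le_csSup hbd hb)⟩, fun ht => ⟨ht.1, ?_⟩⟩
        exact exists_lt_of_lt_csSup ⟨b₀, hb₀B⟩ ht.2
      have hT : t₀ < sSup B := hb₀.trans_le (le_csSup hbd hb₀B)
      refine ⟨sSup B, hT, hJT, fun wT hwT hlim => ?_⟩
      obtain ⟨b, hb, z, hz, hzw⟩ := hg.exists_extension ht₀ hT (hJT ▸ hsol) hwT hlim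
      have hbB : b ∈ B := ⟨hT.trans hb, z, by rw [hzw ⟨le_rfl, hT⟩, hwt₀], hz⟩
      exact absurd (le_csSup hbd hbB) (not_le.2 hb)
    · left
      ext t
      refine ⟨fun h => h.1, fun ht => ⟨ht, ?_⟩⟩
      obtain ⟨b, hb, htb⟩ := not_bddAbove_iff.1 hbd t
      exact ⟨b, hb, htb⟩
  refine ⟨J, w, hcases, hwt₀, hsol, fun J' z h0 hJ0 hoc hz hz0 => ?_⟩
  have hJoc : J.OrdConnected := by
    rcases hcases with h | ⟨T, -, h, -⟩
    · rw [h]; exact ordConnected_Ici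
    · rw [h]; exact ordConnected_Ico
  have h0J : t₀ ∈ J := ⟨le_rfl, b₀, hb₀B, hb₀⟩
  have heq : EqOn z w (J' ∩ J) := hg.eqOn (J := J' ∩ J) ht₀ ⟨h0, h0J⟩
    (fun t ht => hJ0 ht.1) (hoc.inter hJoc) (hz.mono inter_subset_left) (hsol.mono inter_subset_right) (by rw [hz0, hwt₀])
  have hsub : J' ⊆ J := by
    rcases hcases with h | ⟨T, hT, h, hno⟩
    · rw [h]; exact hJ0
    · intro b hb
      by_contra hbJ
      have hTb : T ≤ b := by
        by_contra hlt
        exact hbJ (h ▸ ⟨hJ0 hb, not_le.1 hlt⟩)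
      have hIcc : Icc t₀ T ⊆ J' := fun t ht => hoc.out h0 hb ⟨ht.1, ht.2.trans hTb⟩
      have hTJ : T ∈ J' := hIcc ⟨hT.le, le_rfl⟩
      refine hno (z T) (hz T hTJ).1 ?_
      have h1 : Tendsto z (𝓝[<] T) (𝓝 (z T)) := by
        have := (hz.continuousOn.mono hIcc) T ⟨hT.le, le_rfl⟩
        refine (this.mono_left ?_)
        rw [← nhdsWithin_Ico_eq_nhdsLT hT]
        exact nhdsWithin_mono _ Ico_subset_Icc_self
      refine h1.congr' ?_
      filter_upwards [Ico_mem_nhdsLT hT] with t ht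
      exact heq ⟨hIcc ⟨ht.1, ht.2.le⟩, h ▸ ht⟩
  exact ⟨hsub, fun t ht => heq ⟨ht, hsub ht⟩⟩

/-- A solution on a bounded interval without a limit in `U` leaves every ball, if the field is
bounded along the parts of the curve lying in balls and these parts stay at a positive distance
from the complement of `U`. -/
theorem tendsto_norm_atTop_of_no_limit [CompleteSpace F] {t₀ T : ℝ} (hT : t₀ < T) {w : ℝ → F}
    (hw : SolvesOn g U (Ico t₀ T) w) (hno : ∀ wT ∈ U, ¬ Tendsto w (𝓝[<] T) (𝓝 wT))
    (hbd : ∀ r : ℝ, ∃ N : ℝ, ∀ t ∈ Ico t₀ T, ‖w t‖ ≤ r → ‖g t (w t)‖ ≤ N)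
    (haway : ∀ r : ℝ, ∃ δ > 0, ∀ t ∈ Ico t₀ T, ‖w t‖ ≤ r → Metric.ball (w t) δ ⊆ U) :
    Tendsto (fun t => ‖w t‖) (𝓝[<] T) atTop := by
  rw [tendsto_atTop]
  by_contra! hcon
  obtain ⟨R, hR⟩ := hcon
  obtain ⟨N', hN'⟩ := hbd (R + 1)
  set N := max N' 1 with hNdef
  have hN1 : 1 ≤ N := le_max_right _ _
  have hN : ∀ t ∈ Ico t₀ T, ‖w t‖ ≤ R + 1 → ‖g t (w t)‖ ≤ N := fun t ht h =>
    (hN' t ht h).trans (le_max_left _ _)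
  -- a curve with a speed below `2 N` cannot cover the distance `1` in the time `1 / (2 N)`
  have hnear : Ico (max t₀ (T - 1 / (2 * N))) T ∈ 𝓝[<] T :=
    Ico_mem_nhdsLT (max_lt hT (by have : 0 < 1 / (2 * N) := by positivity
                                  linarith))
  obtain ⟨s, hsR, hs⟩ := (hR.and_eventually hnear).exists
  have hs0 : t₀ ≤ s := (le_max_left _ _).trans hs.1
  have hsT : T - s ≤ 1 / (2 * N) := by linarith [(le_max_right _ _).trans hs.1]
  have hder : ∀ b ∈ Ico s T, ∀ t ∈ Ico s b, HasDerivWithinAt w (g t (w t)) (Ici t) t :=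
    fun b hb t ht => (hw t ⟨hs0.trans ht.1, ht.2.trans hb.2⟩).2.mono_of_mem_nhdsWithin <|
      mem_of_superset (Ico_mem_nhdsGE (ht.2.trans hb.2)) (Ico_subset_Ico_left (hs0.trans ht.1))
  have hcont : ∀ b ∈ Ico s T, ContinuousOn w (Icc s b) := fun b hb =>
    hw.continuousOn.mono fun t ht => ⟨hs0.trans ht.1, ht.2.trans_lt hb.2⟩
  -- from time `s` on the curve cannot leave the ball of radius `R + 1` before `T`
  have hstay : ∀ b ∈ Ico s T, ‖w b‖ ≤ R + 1 := by
    intro b hb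
    have hB : ∀ t, t ≤ T → R + 2 * N * (t - s) ≤ R + 1 := fun t ht => by
      have : 2 * N * (t - s) ≤ 2 * N * (1 / (2 * N)) :=
        mul_le_mul_of_nonneg_left (by linarith) (by positivity)
      rw [mul_one_div_cancel (by positivity)] at this
      linarith
    refine (image_norm_le_of_norm_deriv_right_lt_deriv_boundary (B := fun t => R + 2 * N * (t - s))
      (B' := fun _ => 2 * N) (hcont b hb) (hder b hb) (by simpa using hsR.le) (fun t => ?_)
      (fun t ht hte => ?_) ⟨hb.1, le_rfl⟩).trans (hB b hb.2.le)
    · simpa using (((hasDerivAt_id t).sub_const s).const_mul (2 * N)).const_add R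
    · have hT' : t ∈ Ico t₀ T := ⟨hs0.trans ht.1, ht.2.trans hb.2⟩
      linarith [hN t hT' (hte.trans_le (hB t hT'.2.le))]
  -- so the curve is Lipschitz on `[s, T)` and has a limit at `T`
  have hlip : ∀ a ∈ Ico s T, ∀ b ∈ Ico s T, a ≤ b → ‖w b - w a‖ ≤ N * (b - a) := by
    intro a ha b hb hab
    exact norm_image_sub_le_of_norm_deriv_right_le_segment (C := N)
      ((hcont b hb).mono (Icc_subset_Icc_left ha.1))
      (fun t ht => hder b hb t ⟨ha.1.trans ht.1, ht.2⟩)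
      (fun t ht => hN t ⟨hs0.trans (ha.1.trans ht.1), ht.2.trans hb.2⟩
        (hstay t ⟨ha.1.trans ht.1, ht.2.trans hb.2⟩)) b ⟨hab, le_rfl⟩
  have hlipOn : LipschitzOnWith ⟨N, by linarith⟩ w (Ico s T) := by
    refine LipschitzOnWith.of_dist_le_mul fun a ha b hb => ?_
    rcases le_total a b with h | h
    · rw [dist_comm, dist_eq_norm, dist_comm, Real.dist_eq, abs_of_nonneg (sub_nonneg.2 h)]
      exact hlip a ha b hb h
    · rw [dist_eq_norm, Real.dist_eq, abs_of_nonneg (sub_nonneg.2 h)]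
      exact hlip b hb a ha h
  have hcau : Cauchy (map w (𝓝[<] T)) := by
    have h1 : Cauchy (𝓝[<] T) := cauchy_nhds.mono nhdsWithin_le_nhds
    exact h1.map_of_le hlipOn.uniformContinuousOn
      (le_principal_iff.2 (Ico_mem_nhdsLT hs.2))
  obtain ⟨wT, hwT⟩ := CompleteSpace.complete hcau
  obtain ⟨δ, hδ, hδU⟩ := haway (R + 1)
  have hwT : Tendsto w (𝓝[<] T) (𝓝 wT) := hwT
  obtain ⟨t, ht1, ht2⟩ := ((hwT.eventually (Metric.ball_mem_nhds wT hδ)).and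
    (Ico_mem_nhdsLT hs.2)).exists
  refine hno wT (hδU t ⟨hs0.trans ht2.1, ht2.2⟩ (hstay t ht2) ?_) hwT
  rw [Metric.mem_ball, dist_comm]; exact ht1

end ODE

/-! ### Blow-up by a comparison functional -/

section BlowUp

/-- The minimum of two functions with right derivatives has a right derivative, equal to that of one
of them at which the minimum is attained. -/
lemma hasDerivWithinAt_Ioi_min {u v : ℝ → ℝ} {u' v' t : ℝ} (hu : HasDerivWithinAt u u' (Ioi t) t)
    (hv : HasDerivWithinAt v v' (Ioi t) t) :
    (u t ≤ v t ∧ HasDerivWithinAt (fun τ => min (u τ) (v τ)) u' (Ioi t) t) ∨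
    (v t ≤ u t ∧ HasDerivWithinAt (fun τ => min (u τ) (v τ)) v' (Ioi t) t) := by
  have hd := hv.sub hu
  rcases lt_trichotomy (u t) (v t) with h | h | h
  · left
    refine ⟨h.le, hu.congr_of_eventuallyEq ?_ (min_eq_left h.le)⟩
    filter_upwards [hd.continuousWithinAt.eventually_const_lt (sub_pos.2 h)] with τ hτ
    exact min_eq_left (sub_nonneg.1 (le_of_lt hτ))
  · have hdt : v t - u t = 0 := by rw [h]; ring
    rw [hasDerivWithinAt_iff_tendsto_slope' (by simp)] at hd
    -- the slope of `v - u` decides which function is smaller to the right of `t`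
    rcases lt_trichotomy u' v' with h' | h' | h'
    · left
      refine ⟨h.le, hu.congr_of_eventuallyEq ?_ (min_eq_left h.le)⟩
      filter_upwards [hd.eventually_const_lt (sub_pos.2 h'), self_mem_nhdsWithin] with τ hτ hτt
      refine min_eq_left (sub_nonneg.1 ?_)
      rw [slope_def_field] at hτ
      simp only [Pi.sub_apply, hdt, sub_zero] at hτ
      exact ((div_pos_iff_of_pos_right (sub_pos.2 hτt)).1 hτ).le
    · left
      refine ⟨h.le, ?_⟩
      -- equal values and slopes: the remainder of the minimum is one of the two remainders
      have hu2 := hu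
      have hv2 := hv
      rw [hasDerivWithinAt_iff_isLittleO] at hu2 hv2 ⊢
      rw [min_eq_left h.le]
      refine Asymptotics.IsBigO.trans_isLittleO ?_ (hu2.prod_left (h' ▸ hv2))
      refine Asymptotics.IsBigO.of_bound 1 (Eventually.of_forall fun τ => ?_)
      rw [one_mul, Prod.norm_def, le_max_iff]
      rcases min_choice (u τ) (v τ) with hm | hm
      · left; rw [hm]
      · right; rw [hm, h]
    · right
      refine ⟨h.ge, hv.congr_of_eventuallyEq ?_ (min_eq_right h.ge)⟩
      filter_upwards [hd.eventually_lt_const (sub_neg.2 h'), self_mem_nhdsWithin] with τ hτ hτt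
      refine min_eq_right (sub_nonpos.1 ?_)
      rw [slope_def_field] at hτ
      simp only [Pi.sub_apply, hdt, sub_zero] at hτ
      exact (neg_of_div_neg_left hτ (sub_pos.2 hτt).le).le
  · right
    refine ⟨h.le, hv.congr_of_eventuallyEq ?_ (min_eq_right h.le)⟩
    filter_upwards [hd.continuousWithinAt.eventually_lt_const (sub_neg.2 h)] with τ hτ
    exact min_eq_right (sub_nonpos.1 (le_of_lt hτ))

/-- The minimum of finitely many functions with right derivatives has a right derivative, equal to
that of one of the functions at which the minimum is attained. -/
lemma exists_hasDerivWithinAt_Ioi_inf' {ι : Type*} (s : Finset ι) (hs : s.Nonempty)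
    {v : ι → ℝ → ℝ} {v' : ι → ℝ} {t : ℝ}
    (hv : ∀ i ∈ s, HasDerivWithinAt (v i) (v' i) (Ioi t) t) :
    ∃ j ∈ s, v j t = s.inf' hs (fun i => v i t) ∧
      HasDerivWithinAt (fun τ => s.inf' hs fun i => v i τ) (v' j) (Ioi t) t := by
  induction hs using Finset.Nonempty.cons_induction with
  | singleton a => exact ⟨a, by simp, by simp, by simpa using hv a (by simp)⟩
  | cons a s ha hs ih =>
    obtain ⟨j, hj, hje, hjd⟩ := ih fun i hi => hv i (Finset.mem_cons.2 (Or.inr hi))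
    simp only [Finset.inf'_cons hs]
    rcases hasDerivWithinAt_Ioi_min (hv a (by simp)) hjd with ⟨h, hd⟩ | ⟨h, hd⟩
    · exact ⟨a, by simp, (min_eq_left h).symm, hd⟩
    · exact ⟨j, by simp [hj], by rw [hje]; exact (min_eq_right h).symm, hd⟩

/-- A curve `w` cannot exist for all times if, for the minimum `V` of the `V i`, the derivative of
every active `V i` along `w` is at least `U(V) ψ(t)`, with `∫^∞ du / U(u) < ∞` and `∫^∞ ψ = ∞`:
by separation of variables `∫_{t₀}^t ψ` would stay below `∫_{V(w(t₀))}^∞ du / U(u)`. -/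
theorem not_global_of_blowUp {F : Type*} [NormedAddCommGroup F] [NormedSpace ℝ F] {Ω : Set F}
    (hΩ : IsOpen Ω) {t₀ : ℝ} (ht₀ : 0 ≤ t₀) {w w' : ℝ → F}
    (hw : ∀ t, t₀ ≤ t → w t ∈ Ω ∧ HasDerivWithinAt w (w' t) (Ici t₀) t)
    {m : ℕ} {V : Fin (m + 1) → F → ℝ} {U ψ : ℝ → ℝ}
    (hVpos : ∀ i, ∀ w ∈ Ω, 0 < V i w) (hVd : ∀ i, DifferentiableOn ℝ (V i) Ω)
    (hUc : ContinuousOn U (Ioi 0)) (hU : ∀ u > 0, 0 < U u)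
    (hψ0 : ∀ t, 0 ≤ t → 0 ≤ ψ t) (hψ : ∀ b, IntegrableOn ψ (Icc 0 b))
    (hUint : ∀ u₀ > 0, IntegrableOn (fun u => 1 / U u) (Ioi u₀))
    (hψint : ∀ t₁ > 0, ¬ IntegrableOn ψ (Ioi t₁))
    (hineq : ∀ t, t₀ ≤ t → ∀ j, V j (w t) = ⨅ i, V i (w t) →
      U (⨅ i, V i (w t)) * ψ t ≤ fderiv ℝ (V j) (w t) (w' t)) : False := by
  set v : ℝ → ℝ := fun t => ⨅ i, V i (w t) with hv
  have hvinf : v = fun t => Finset.univ.inf' Finset.univ_nonempty fun i => V i (w t) := by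
    ext t; exact (Finset.inf'_univ_eq_ciInf _).symm
  have hvpos : ∀ t, t₀ ≤ t → 0 < v t := fun t ht => by
    rw [hvinf, Finset.lt_inf'_iff]
    exact fun i _ => hVpos i _ (hw t ht).1
  have hVat : ∀ i t, t₀ ≤ t → HasFDerivAt (V i) (fderiv ℝ (V i) (w t)) (w t) := fun i t ht =>
    ((hVd i).differentiableAt (hΩ.mem_nhds (hw t ht).1)).hasFDerivAt
  have hVw : ∀ i t, t₀ ≤ t → HasDerivWithinAt (fun τ => V i (w τ)) (fderiv ℝ (V i) (w t) (w' t))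
      (Ici t₀) t := fun i t ht => (hVat i t ht).comp_hasDerivWithinAt t (hw t ht).2
  have hvc : ContinuousOn v (Ici t₀) := by
    rw [hvinf]
    exact ContinuousOn.finset_inf'_apply _ fun i _ t ht => (hVw i t ht).continuousWithinAt
  -- `H(v(t))` has a right derivative not less than `ψ(t)`, and `H` is bounded above
  set H : ℝ → ℝ := fun u => ∫ x in (v t₀)..u, 1 / U x with hH
  have hv0 := hvpos t₀ le_rfl
  have hUic : ContinuousOn (fun u => 1 / U u) (Ioi 0) :=
    continuousOn_const.div hUc fun u hu => (hU u hu).ne'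
  have hHd : ∀ u > 0, HasDerivAt H (1 / U u) u := fun u hu => by
    refine intervalIntegral.integral_hasDerivAt_right ?_
      (hUic.stronglyMeasurableAtFilter isOpen_Ioi u hu) (hUic.continuousAt (Ioi_mem_nhds hu))
    exact (hUic.mono fun x hx => lt_of_lt_of_le (lt_min hv0 hu) hx.1).intervalIntegrable
  have hHc : ContinuousOn (fun t => H (v t)) (Ici t₀) := fun t ht =>
    (hHd _ (hvpos t ht)).continuousAt.comp_continuousWithinAt (hvc t ht)
  have hder : ∀ t, t₀ ≤ t → ∃ d, HasDerivWithinAt (fun τ => H (v τ)) d (Ioi t) t ∧ ψ t ≤ d := by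
    intro t ht
    obtain ⟨j, -, hj, hjd⟩ := exists_hasDerivWithinAt_Ioi_inf' Finset.univ Finset.univ_nonempty
      (v := fun i τ => V i (w τ)) (t := t)
      fun i _ => (hVw i t ht).mono (Ioi_subset_Ici ht)
    have hje : V j (w t) = v t := by rw [hvinf]; exact hj
    have hjd' : HasDerivWithinAt v (fderiv ℝ (V j) (w t) (w' t)) (Ioi t) t := by
      rw [hvinf]; exact hjd
    refine ⟨_, (hHd _ (hvpos t ht)).comp_hasDerivWithinAt t hjd', ?_⟩
    have := hineq t ht j hje
    rw [one_div, inv_mul_eq_div, le_div_iff₀ (hU _ (hvpos t ht)), mul_comm]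
    exact this
  choose! d hd hψd using hder
  have hHle : ∀ u > 0, H u ≤ ∫ x in Ioi (v t₀), 1 / U x := fun u hu => by
    have hnn : ∀ x ∈ Ioi (0 : ℝ), 0 ≤ 1 / U x := fun x hx => (one_div_pos.2 (hU x hx)).le
    have hI : 0 ≤ ∫ x in Ioi (v t₀), 1 / U x :=
      setIntegral_nonneg measurableSet_Ioi fun x hx => hnn x (hv0.trans hx)
    rcases le_total (v t₀) u with h | h
    · simp only [hH, intervalIntegral.integral_of_le h]
      refine setIntegral_mono_set (hUint _ hv0) ?_ Ioc_subset_Ioi_self.eventuallyLE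
      exact (ae_restrict_iff' measurableSet_Ioi).2 <| ae_of_all _ fun x hx => hnn x (hv0.trans hx)
    · refine le_trans ?_ hI
      simp only [hH]
      rw [intervalIntegral.integral_symm, neg_nonpos]
      exact intervalIntegral.integral_nonneg h fun x hx => hnn x (lt_of_lt_of_le hu hx.1)
  have hψle : ∀ b, t₀ ≤ b → ∫ t in t₀..b, ψ t ≤ ∫ x in Ioi (v t₀), 1 / U x := fun b hb => by
    have h1 := intervalIntegral.integral_le_sub_of_hasDeriv_right_of_le hb
      (hHc.mono fun t ht => ht.1) (fun t ht => hd t ht.1.le)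
      ((hψ b).mono_set (Icc_subset_Icc_left ht₀)) (fun t ht => hψd t ht.1.le)
    have h2 : H (v t₀) = 0 := intervalIntegral.integral_same
    rw [h2, sub_zero] at h1
    exact h1.trans (hHle _ (hvpos b hb))
  have hψi : IntegrableOn ψ (Ioi t₀) := by
    refine integrableOn_Ioi_of_intervalIntegral_norm_bounded (∫ x in Ioi (v t₀), 1 / U x) t₀
      (l := atTop) (b := id)
      (fun b => (hψ b).mono_set fun x hx => ⟨ht₀.trans hx.1.le, hx.2⟩) tendsto_id ?_
    filter_upwards [eventually_ge_atTop t₀] with b hb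
    refine le_trans (le_of_eq ?_) (hψle b hb)
    refine intervalIntegral.integral_congr fun x hx => ?_
    rw [id, uIcc_of_le hb] at hx
    exact abs_of_nonneg (hψ0 x (ht₀.trans hx.1))
  exact hψint (max t₀ 1) (by positivity) (hψi.mono_set (Ioi_subset_Ioi (le_max_left _ _)))

end BlowUp

/-! ### Implicit functions on sets with boundary -/

section Implicit

variable {W Z : Type*} [NormedAddCommGroup W] [NormedSpace ℝ W] [NormedAddCommGroup Z]
  [NormedSpace ℝ Z]

/-- If near `l₀` the maps `Φ l` are uniformly close to an invertible operator, then the unique zero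
`η l` of `Φ l` in an open set depends continuously on `l`: a zero near `η l₀` exists by the inverse
function theorem, and by uniqueness it is `η l`. -/
lemma continuousWithinAt_of_unique_zero [CompleteSpace W] {Λ : Type*} [TopologicalSpace Λ]
    {s : Set Λ} {l₀ : Λ} (hl₀ : l₀ ∈ s) {M : Set W} (hM : IsOpen M) {Φ : Λ → W → Z} {η : Λ → W}
    (hη : ∀ l ∈ s, η l ∈ M ∧ Φ l (η l) = 0) (huniq : ∀ l ∈ s, ∀ u ∈ M, Φ l u = 0 → u = η l)
    (hcont : ContinuousWithinAt (fun l => Φ l (η l₀)) s l₀) (L : W ≃L[ℝ] Z) {c : ℝ≥0}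
    (hc : c * ‖(L.symm : Z →L[ℝ] W)‖ < 1) {r : ℝ} (hr : 0 < r)
    (happ : ∀ᶠ l in 𝓝[s] l₀,
      ApproximatesLinearOn (Φ l) (L : W →L[ℝ] Z) (Metric.ball (η l₀) r) c) :
    ContinuousWithinAt η s l₀ := by
  rcases subsingleton_or_nontrivial W with hW | hW
  · have : η = fun _ => η l₀ := funext fun l => Subsingleton.elim _ _
    rw [this]; exact continuousWithinAt_const
  -- here `W` has to be nontrivial
  have hN : 0 < ‖(L.symm : Z →L[ℝ] W)‖ := L.norm_symm_pos
  have hgap : 0 < ‖(L.symm : Z →L[ℝ] W)‖⁻¹ - c := by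
    rw [sub_pos, ← one_div, lt_div_iff₀ hN]; exact hc
  rw [ContinuousWithinAt, Metric.tendsto_nhds]
  intro ε hε
  obtain ⟨r', hr', hr'M⟩ := Metric.isOpen_iff.1 hM _ (hη l₀ hl₀).1
  set ρ := min (ε / 2) (min (r / 2) (r' / 2)) with hρ
  have hρ0 : 0 < ρ := by positivity
  have hρε : ρ < ε := (min_le_left _ _).trans_lt (by linarith)
  have hρr : ρ < r := ((min_le_right _ _).trans (min_le_left _ _)).trans_lt (by linarith)
  have hρr' : ρ < r' := ((min_le_right _ _).trans (min_le_right _ _)).trans_lt (by linarith)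
  have hsmall : ∀ᶠ l in 𝓝[s] l₀, dist (Φ l (η l₀)) 0 < (‖(L.symm : Z →L[ℝ] W)‖⁻¹ - c) * ρ := by
    have h0 := hcont.tendsto
    rw [(hη l₀ hl₀).2] at h0
    exact (Metric.tendsto_nhds.1 h0) _ (by positivity)
  filter_upwards [happ, hsmall, self_mem_nhdsWithin] with l h1 h2 hl
  obtain ⟨u, hu, hu0⟩ := h1.surjOn_closedBall_of_nonlinearRightInverse
    L.toNonlinearRightInverse hρ0.le (Metric.closedBall_subset_ball hρr)
    (show (0 : Z) ∈ _ from by rw [Metric.mem_closedBall, dist_comm]; exact h2.le)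
  rw [← huniq l hl u (hr'M (Metric.closedBall_subset_ball hρr' hu)) hu0]
  exact lt_of_le_of_lt hu hρε

lemma exists_small_bound (L : W ≃L[ℝ] Z) :
    ∃ c : ℝ≥0, 0 < c ∧ c * ‖(L.symm : Z →L[ℝ] W)‖ < 1 := by
  refine ⟨⟨1 / (‖(L.symm : Z →L[ℝ] W)‖ + 1), by positivity⟩, ?_, ?_⟩
  · exact NNReal.coe_pos.1 (show (0 : ℝ) < 1 / (‖(L.symm : Z →L[ℝ] W)‖ + 1) by positivity)
  · change 1 / (‖(L.symm : Z →L[ℝ] W)‖ + 1) * ‖(L.symm : Z →L[ℝ] W)‖ < 1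
    rw [one_div_mul_eq_div, div_lt_one (by positivity)]; linarith

/-- A family with a continuous partial derivative is locally uniformly close to it. -/
lemma eventually_approximatesLinearOn {Λ : Type*} [PseudoMetricSpace Λ] {s : Set Λ} {l₀ : Λ}
    {M : Set W} (hM : IsOpen M) {Φ : Λ → W → Z} {D : Λ × W → W →L[ℝ] Z}
    (hD : ∀ l ∈ s, ∀ u ∈ M, HasFDerivAt (Φ l) (D (l, u)) u) {b : W} (hb : b ∈ M)
    (hDc : ContinuousWithinAt D (s ×ˢ M) (l₀, b)) {c : ℝ≥0} (hc : 0 < c) :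
    ∃ r > 0, ∀ l ∈ s, dist l l₀ < r →
      ApproximatesLinearOn (Φ l) (D (l₀, b)) (Metric.ball b r) c := by
  obtain ⟨ρ, hρ, hρD⟩ := Metric.continuousWithinAt_iff.1 hDc c hc
  obtain ⟨r', hr', hr'M⟩ := Metric.isOpen_iff.1 hM b hb
  refine ⟨min ρ r', by positivity, fun l hls hl => ?_⟩
  have hball : ∀ u ∈ Metric.ball b (min ρ r'), u ∈ M := fun u hu =>
    hr'M (Metric.ball_subset_ball (min_le_right _ _) hu)
  intro x hx y hy
  refine Convex.norm_image_sub_le_of_norm_hasFDerivWithin_le' (f' := fun u => D (l, u))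
    (fun u hu => (hD l hls u (hball u hu)).hasFDerivWithinAt) (fun u hu => ?_)
    (convex_ball b (min ρ r')) hy hx
  have := hρD (show (l, u) ∈ s ×ˢ M from ⟨hls, hball u hu⟩) (by
    rw [Prod.dist_eq, max_lt_iff]
    exact ⟨hl.trans_le (min_le_left _ _), lt_of_lt_of_le hu (min_le_left _ _)⟩)
  rw [dist_eq_norm] at this
  exact this.le

/-- The derivative of an implicitly defined function, on a half-line. -/
lemma hasDerivWithinAt_of_implicit {s : Set ℝ} {M : Set W} {F : ℝ × W → Z}
    {F' : ℝ × W →L[ℝ] Z} {ξ : ℝ → W} {t₀ : ℝ} (ht₀ : t₀ ∈ s)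
    (hξ : ∀ t ∈ s, ξ t ∈ M ∧ F (t, ξ t) = 0)
    (hξc : ContinuousWithinAt ξ s t₀) (hF : HasFDerivWithinAt F F' (s ×ˢ M) (t₀, ξ t₀))
    (L : W ≃L[ℝ] Z) (hL : ∀ u, F' (0, u) = L u) :
    HasDerivWithinAt ξ (-(L.symm (F' (1, 0)))) s t₀ := by
  set v := L.symm (F' (1, 0)) with hv
  -- the remainder `R` is `o(|t - t₀| + ‖R‖)`, hence `o(t - t₀)`
  set R : ℝ → W := fun t => ξ t - ξ t₀ + (t - t₀) • v with hR
  have htend : Tendsto (fun t => (t, ξ t)) (𝓝[s] t₀) (𝓝[s ×ˢ M] (t₀, ξ t₀)) :=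
    tendsto_nhdsWithin_iff.2 ⟨(tendsto_nhdsWithin_of_tendsto_nhds tendsto_id).prodMk_nhds hξc,
      eventually_of_mem self_mem_nhdsWithin fun t ht => ⟨ht, (hξ t ht).1⟩⟩
  have h1 := hF.isLittleO.comp_tendsto htend
  have h2 : (fun t => F' ((t, ξ t) - (t₀, ξ t₀))) =o[𝓝[s] t₀]
      fun t => ((t, ξ t) - (t₀, ξ t₀) : ℝ × W) := by
    refine (h1.congr' ?_ EventuallyEq.rfl).neg_left.congr_left fun t => neg_neg _
    filter_upwards [self_mem_nhdsWithin] with t ht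
    simp only [Function.comp_apply, (hξ t ht).2, (hξ t₀ ht₀).2, sub_zero, zero_sub]
  have h3 : R =o[𝓝[s] t₀] fun t => ((t, ξ t) - (t₀, ξ t₀) : ℝ × W) := by
    refine (((L.symm : Z →L[ℝ] W).isBigO_comp _ _).trans_isLittleO h2).congr_left fun t => ?_
    have : ((t, ξ t) - (t₀, ξ t₀) : ℝ × W) = (t - t₀) • ((1, 0) : ℝ × W) + (0, ξ t - ξ t₀) := by
      simp
    rw [this, map_add, map_smul, hL]
    simp [hR, hv, add_comm]
  have h4 : (fun t => ((t, ξ t) - (t₀, ξ t₀) : ℝ × W)) =O[𝓝[s] t₀]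
      fun t => ‖t - t₀‖ + ‖R t‖ := by
    refine Asymptotics.IsBigO.of_bound (1 + ‖v‖) (Eventually.of_forall fun t => ?_)
    have hx : ξ t - ξ t₀ = R t - (t - t₀) • v := by simp [hR]
    rw [Prod.mk_sub_mk, Prod.norm_def, hx]
    have hb := norm_sub_le (R t) ((t - t₀) • v)
    rw [norm_smul] at hb
    have n1 := norm_nonneg (t - t₀)
    have n2 := norm_nonneg (R t)
    have n3 := norm_nonneg v
    rw [Real.norm_of_nonneg (add_nonneg n1 n2)]
    refine max_le ?_ ?_
    · simp only; nlinarith [mul_nonneg n3 n1, mul_nonneg n3 n2]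
    · simp only; nlinarith [mul_nonneg n3 n1, mul_nonneg n3 n2]
  have h5 := h3.trans_isBigO h4
  have h6 : R =O[𝓝[s] t₀] fun t => t - t₀ := by
    refine Asymptotics.IsBigO.of_bound 1 ?_
    filter_upwards [h5.def (c := 1 / 2) (by norm_num)] with t ht
    rw [Real.norm_of_nonneg (add_nonneg (norm_nonneg _) (norm_nonneg _))] at ht
    linarith
  have h7 : (fun t => ‖t - t₀‖ + ‖R t‖) =O[𝓝[s] t₀] fun t => t - t₀ :=
    (Asymptotics.isBigO_refl _ _).norm_left.add h6.norm_left
  rw [hasDerivWithinAt_iff_isLittleO]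
  refine (h5.trans_isBigO h7).congr_left fun t => ?_
  simp [hR]

/-- The unique zero `ξ t` of `F(t, ·)` in an open set is as smooth on `[0, ∞)` as `F`, if the
partial derivative of `F` is invertible at the zeros. No extension of `F` to `t < 0` is needed. -/
theorem contDiffOn_of_implicit [CompleteSpace W] {M : Set W} (hM : IsOpen M) {F : ℝ × W → Z}
    {ξ : ℝ → W} {k : ℕ} (hk : 1 ≤ k) (hF : ContDiffOn ℝ k F (Ici 0 ×ˢ M))
    (hξ : ∀ t, 0 ≤ t → ξ t ∈ M ∧ F (t, ξ t) = 0)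
    (huniq : ∀ t, 0 ≤ t → ∀ u ∈ M, F (t, u) = 0 → u = ξ t)
    (hL : ∀ t, 0 ≤ t → ∃ L : W ≃L[ℝ] Z,
      HasFDerivAt (fun u => F (t, u)) (L : W →L[ℝ] Z) (ξ t)) :
    ContDiffOn ℝ k ξ (Ici 0) := by
  have hS : UniqueDiffOn ℝ (Ici (0 : ℝ) ×ˢ M) := (uniqueDiffOn_Ici 0).prod hM.uniqueDiffOn
  set F' := fderivWithin ℝ F (Ici 0 ×ˢ M) with hF'
  have hFd : ∀ t, 0 ≤ t → ∀ u ∈ M, HasFDerivWithinAt F (F' (t, u)) (Ici 0 ×ˢ M) (t, u) :=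
    fun t ht u hu => ((hF.differentiableOn (by exact_mod_cast (by omega : k ≠ 0))) (t, u)
      ⟨ht, hu⟩).hasFDerivWithinAt
  set D : ℝ × W → W →L[ℝ] Z := fun p => (F' p).comp (ContinuousLinearMap.inr ℝ ℝ W) with hD
  have hDd : ∀ t, 0 ≤ t → ∀ u ∈ M, HasFDerivAt (fun u => F (t, u)) (D (t, u)) u := by
    intro t ht u hu
    have h1 : HasFDerivWithinAt (fun u : W => (t, u)) (ContinuousLinearMap.inr ℝ ℝ W) M u :=
      (hasFDerivAt_prodMk_right t u).hasFDerivWithinAt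
    exact ((hFd t ht u hu).comp u h1 fun x hx => ⟨ht, hx⟩).hasFDerivAt (hM.mem_nhds hu)
  have hF'c : ∀ j : ℕ, j + 1 ≤ k → ContDiffOn ℝ j F' (Ici 0 ×ˢ M) := fun j hj =>
    hF.fderivWithin hS (by exact_mod_cast hj)
  have hDc : ∀ j : ℕ, j + 1 ≤ k → ContDiffOn ℝ j D (Ici 0 ×ˢ M) := fun j hj =>
    (hF'c j hj).clm_comp contDiffOn_const
  have : Nonempty (W ≃L[ℝ] Z) := ⟨(hL 0 le_rfl).choose⟩
  choose! L hLd using hL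
  have hDL : ∀ t, 0 ≤ t → D (t, ξ t) = L t := fun t ht =>
    (hDd t ht _ (hξ t ht).1).unique (hLd t ht)
  have hξc : ContinuousOn ξ (Ici 0) := by
    intro t ht
    obtain ⟨c, hc0, hc⟩ := exists_small_bound (L t)
    obtain ⟨r, hr, happ⟩ := eventually_approximatesLinearOn (s := Ici 0) (l₀ := t)
      (Φ := fun t u => F (t, u)) hM hDd (hξ t ht).1
      ((hDc 0 (by omega)).continuousOn (t, ξ t) ⟨ht, (hξ t ht).1⟩) hc0
    refine continuousWithinAt_of_unique_zero (Φ := fun t u => F (t, u)) ht hM hξ huniq ?_ (L t)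
      hc hr ?_
    · have hp : ContinuousOn (fun τ : ℝ => (τ, ξ t)) (Ici 0) := by fun_prop
      exact (hF.continuousOn.comp hp fun τ hτ => ⟨hτ, (hξ t ht).1⟩) t ht
    · rw [← hDL t ht]
      exact Metric.mem_nhdsWithin_iff.2 ⟨r, hr, fun l hl => happ l hl.2 hl.1⟩
  have hξd : ∀ t, 0 ≤ t → HasDerivWithinAt ξ (-((L t).symm (F' (t, ξ t) (1, 0)))) (Ici 0) t :=
    fun t ht => hasDerivWithinAt_of_implicit (s := Ici 0) ht hξ (hξc t ht)
      (hFd t ht _ (hξ t ht).1) (L t) fun u => by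
        rw [← ContinuousLinearEquiv.coe_coe, ← hDL t ht]; rfl
  have hξ' : EqOn (derivWithin ξ (Ici 0))
      (fun t => -((D (t, ξ t)).inverse (F' (t, ξ t) (1, 0)))) (Ici 0) := fun t ht => by
    rw [(hξd t ht).derivWithin (uniqueDiffOn_Ici 0 t ht)]
    simp only [hDL t ht, ContinuousLinearMap.inverse_equiv]; rfl
  -- the formula for `ξ'` shows that `ξ'` is as smooth as `ξ`, up to the smoothness of `F'`
  have key : ∀ j : ℕ, j ≤ k → ContDiffOn ℝ j ξ (Ici 0) := by
    intro j
    induction j with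
    | zero => exact fun _ => contDiffOn_zero.2 hξc
    | succ j ih =>
      intro hj
      have hp : ContDiffOn ℝ j (fun t => (t, ξ t)) (Ici 0) :=
        contDiffOn_id.prodMk (ih (by omega))
      have hmaps : MapsTo (fun t => (t, ξ t)) (Ici 0) (Ici 0 ×ˢ M) := fun t ht =>
        ⟨ht, (hξ t ht).1⟩
      have hcoe : ((j + 1 : ℕ) : WithTop ℕ∞) = (j : WithTop ℕ∞) + 1 := by push_cast; rfl
      rw [hcoe, contDiffOn_succ_iff_derivWithin (uniqueDiffOn_Ici 0)]
      refine ⟨fun t ht => (hξd t ht).differentiableWithinAt, fun h => by simp at h, ?_⟩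
      refine ContDiffOn.congr ?_ hξ'
      have hinv : ContDiffOn ℝ j (fun t => (D (t, ξ t)).inverse) (Ici 0) := fun t ht => by
        have h1 : ContDiffAt ℝ j ContinuousLinearMap.inverse (D (t, ξ t)) := by
          rw [hDL t ht]; exact contDiffAt_map_inverse (L t)
        exact h1.comp_contDiffWithinAt t (((hDc j hj).comp hp hmaps) t ht)
      exact (hinv.clm_apply (((hF'c j hj).comp hp hmaps).clm_apply contDiffOn_const)).neg
  exact key k le_rfl

/-- Lipschitz dependence of the unique zero on a parameter `w`. As `Φ(t, w, ·)` is close to `L`, the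
distance of its zero from another point `u` is at most a multiple of `‖Φ(t, w, u)‖`, and for `u` the
zero of `Φ(t, w', ·)` this is at most `K ‖w - w'‖`. -/
lemma exists_lipschitz_of_unique_zero {F : Type*} [NormedAddCommGroup F] {U : Set F} {M : Set W}
    {Φ : ℝ → F → W → Z} {η : ℝ → F → W}
    (hη : ∀ t, 0 ≤ t → ∀ w ∈ U, η t w ∈ M ∧ Φ t w (η t w) = 0) {t₀ : ℝ} {w₀ : F}
    (hηc : ContinuousWithinAt (fun p : ℝ × F => η p.1 p.2) (Ici 0 ×ˢ U) (t₀, w₀))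
    (L : W ≃L[ℝ] Z) {c : ℝ≥0} (hc : c * ‖(L.symm : Z →L[ℝ] W)‖ < 1) {r : ℝ} (hr : 0 < r)
    (happ : ∀ t, 0 ≤ t → |t - t₀| < r → ∀ w ∈ U, ‖w - w₀‖ < r →
      ApproximatesLinearOn (Φ t w) (L : W →L[ℝ] Z) (Metric.ball (η t₀ w₀) r) c) {K : ℝ}
    (hlip : ∀ t, 0 ≤ t → |t - t₀| < r → ∀ w ∈ U, ‖w - w₀‖ < r → ∀ w' ∈ U, ‖w' - w₀‖ < r →
      ∀ u ∈ M, ‖u - η t₀ w₀‖ < r → ‖Φ t w u - Φ t w' u‖ ≤ K * ‖w - w'‖) :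
    ∃ δ > 0, ∃ K' : ℝ, ∀ t, 0 ≤ t → |t - t₀| < δ → ∀ w ∈ U, ‖w - w₀‖ < δ →
      ‖η t w - η t₀ w₀‖ < r ∧
      ∀ w' ∈ U, ‖w' - w₀‖ < δ → ‖η t w - η t w'‖ ≤ K' * ‖w - w'‖ := by
  obtain ⟨ρ, hρ, hρη⟩ := Metric.continuousWithinAt_iff.1 hηc r hr
  set N := ‖(L.symm : Z →L[ℝ] W)‖ with hN
  have hnear : ∀ t, 0 ≤ t → |t - t₀| < ρ → ∀ w ∈ U, ‖w - w₀‖ < ρ → ‖η t w - η t₀ w₀‖ < r := by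
    intro t ht htρ w hw hwρ
    have := hρη (show (t, w) ∈ Ici 0 ×ˢ U from ⟨ht, hw⟩) (by
      rw [Prod.dist_eq, max_lt_iff, Real.dist_eq, dist_eq_norm]; exact ⟨htρ, hwρ⟩)
    rwa [dist_eq_norm] at this
  refine ⟨min ρ r, by positivity, N * K / (1 - c * N), fun t ht htδ w hw hwδ =>
    ⟨hnear t ht (htδ.trans_le (min_le_left _ _)) w hw (hwδ.trans_le (min_le_left _ _)),
      fun w' hw' hwδ' => ?_⟩⟩
  have htρ := htδ.trans_le (min_le_left ρ r)
  have htr := htδ.trans_le (min_le_right ρ r)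
  have hu := hnear t ht htρ w hw (hwδ.trans_le (min_le_left _ _))
  have hu' := hnear t ht htρ w' hw' (hwδ'.trans_le (min_le_left _ _))
  have h1 := happ t ht htr w hw (hwδ.trans_le (min_le_right _ _)) (x := η t w) (by
    rw [Metric.mem_ball, dist_eq_norm]; exact hu) (y := η t w') (by
    rw [Metric.mem_ball, dist_eq_norm]; exact hu')
  have h2 := hlip t ht htr w hw (hwδ.trans_le (min_le_right _ _)) w' hw'
    (hwδ'.trans_le (min_le_right _ _)) (η t w') (hη t ht w' hw').1 hu'
  rw [(hη t ht w' hw').2, sub_zero] at h2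
  rw [(hη t ht w hw).2, zero_sub] at h1
  have h3 : ‖L (η t w - η t w')‖ ≤ c * ‖η t w - η t w'‖ + K * ‖w - w'‖ := by
    have h4 : L (η t w - η t w') = -(-Φ t w (η t w') - L (η t w - η t w')) - Φ t w (η t w') := by
      abel
    rw [h4]
    refine (norm_sub_le _ _).trans ?_
    rw [norm_neg]
    exact add_le_add h1 h2
  have h5 : ‖η t w - η t w'‖ ≤ N * ‖L (η t w - η t w')‖ := by
    have := (L.symm : Z →L[ℝ] W).le_opNorm (L (η t w - η t w'))
    simpa using this
  have hN0 : 0 ≤ N := norm_nonneg _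
  rw [div_mul_eq_mul_div, le_div_iff₀ (by linarith)]
  nlinarith [mul_le_mul_of_nonneg_left h3 hN0]

end Implicit

/-! ### Algebra of the root vectors -/

section

variable {𝕜 X Y : Type*} [RCLike 𝕜]
  [NormedAddCommGroup X] [NormedSpace 𝕜 X] [NormedAddCommGroup Y] [NormedSpace 𝕜 Y]

namespace CanonicalSystem

variable {E : OperatorPair 𝕜 X Y} {ν : ℕ} (C : CanonicalSystem E ν)

/-- The coordinate `⟨B x, q_p⟩` of `x ∈ D` along the root vector with position `p`. -/
def coeff (p : Fin C.n × ℕ) : E.D →ₗ[𝕜] 𝕜 := (C.q p.1 p.2).toLinearMap.comp E.opB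

lemma coeff_apply (p : Fin C.n × ℕ) (x : E.D) : C.coeff p x = C.q p.1 p.2 (E.opB x) := rfl

variable {C} in
lemma mem_all {p : Fin C.n × ℕ} : p ∈ C.all ↔ p.2 < C.m p.1 := by
  simp only [all, Finset.mem_filter, Finset.mem_product, Finset.mem_univ, Finset.mem_range,
    true_and, and_iff_right_iff_imp]
  exact fun h => h.trans_le (C.m_le _)

variable {C} in
lemma mem_star {s : ℕ} {p : Fin C.n × ℕ} : p ∈ C.star s ↔ C.m p.1 = s + 1 ∧ p.2 = s := by
  rw [star, Finset.mem_product]; simp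

variable {C} in
lemma mem_wedge {s : ℕ} {p : Fin C.n × ℕ} : p ∈ C.wedge s ↔ s + 2 ≤ C.m p.1 ∧ p.2 = s := by
  rw [wedge, Finset.mem_product]; simp

variable {C} in
lemma mem_zero {p : Fin C.n × ℕ} : p ∈ C.zero ↔ p.2 = 0 := by
  rw [zero, Finset.mem_product]; simp

lemma star_subset_all (s : ℕ) : C.star s ⊆ C.all := fun p hp => by
  rw [mem_star] at hp; rw [mem_all]; omega

lemma wedge_subset_all (s : ℕ) : C.wedge s ⊆ C.all := fun p hp => by
  rw [mem_wedge] at hp; rw [mem_all]; omega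

lemma zero_subset_all : C.zero ⊆ C.all := fun p hp => by
  rw [mem_zero] at hp; rw [mem_all, hp]; exact C.one_le_m _

lemma coeff_root {p r : Fin C.n × ℕ} (hp : p ∈ C.all) (hr : r ∈ C.all) :
    C.coeff p (C.φ r.1 r.2) = if p = r then 1 else 0 := by
  rw [coeff_apply, C.biorthogonal r.1 r.2 (mem_all.1 hr) p.1 p.2 (mem_all.1 hp)]
  congr 1
  rw [Prod.ext_iff, eq_iff_iff]
  constructor <;> rintro ⟨h1, h2⟩ <;> exact ⟨h1.symm, h2.symm⟩

lemma P_apply (S : Finset (Fin C.n × ℕ)) (x : E.D) :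
    C.P S x = ∑ p ∈ S, C.coeff p x • C.φ p.1 p.2 := by
  simp only [P, LinearMap.sum_apply]; rfl

lemma Q_apply (S : Finset (Fin C.n × ℕ)) (y : Y) :
    C.Q S y = ∑ p ∈ S, C.q p.1 p.2 y • E.opB (C.φ p.1 p.2) := by
  simp only [Q, _root_.sum_apply]; rfl

lemma opB_P (S : Finset (Fin C.n × ℕ)) (x : E.D) : E.opB (C.P S x) = C.Q S (E.opB x) := by
  simp only [P_apply, Q_apply, map_sum, map_smul]; rfl

open Classical in
lemma coeff_P {S : Finset (Fin C.n × ℕ)} (hS : S ⊆ C.all) {p : Fin C.n × ℕ} (hp : p ∈ C.all)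
    (x : E.D) : C.coeff p (C.P S x) = if p ∈ S then C.coeff p x else 0 := by
  rw [P_apply, map_sum, ← Finset.sum_ite_eq S p fun r => C.coeff r x]
  refine Finset.sum_congr rfl fun r hr => ?_
  rw [map_smul, C.coeff_root hp (hS hr), smul_eq_mul, mul_ite, mul_one, mul_zero]

open Classical in
lemma q_Q {S : Finset (Fin C.n × ℕ)} (hS : S ⊆ C.all) {p : Fin C.n × ℕ} (hp : p ∈ C.all)
    (y : Y) : C.q p.1 p.2 (C.Q S y) = if p ∈ S then C.q p.1 p.2 y else 0 := by
  rw [Q_apply, map_sum, ← Finset.sum_ite_eq S p fun r => C.q r.1 r.2 y]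
  refine Finset.sum_congr rfl fun r hr => ?_
  rw [map_smul, ← coeff_apply, C.coeff_root hp (hS hr), smul_eq_mul, mul_ite, mul_one, mul_zero]

lemma P_root {S : Finset (Fin C.n × ℕ)} (hS : S ⊆ C.all) {p : Fin C.n × ℕ} (hp : p ∈ S) :
    C.P S (C.φ p.1 p.2) = C.φ p.1 p.2 := by
  rw [P_apply, Finset.sum_eq_single p]
  · rw [C.coeff_root (hS hp) (hS hp), if_pos rfl, one_smul]
  · intro r hr hrp
    rw [C.coeff_root (hS hr) (hS hp), if_neg hrp, zero_smul]
  · exact fun h => absurd hp h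

lemma P_mem (S : Finset (Fin C.n × ℕ)) (x : E.D) : C.P S x ∈ C.DS S := by
  rw [P_apply]
  exact Submodule.sum_mem _ fun p hp =>
    Submodule.smul_mem _ _ (Submodule.subset_span ⟨p, hp, rfl⟩)

lemma P_eq_self {S : Finset (Fin C.n × ℕ)} (hS : S ⊆ C.all) {x : E.D} (hx : x ∈ C.DS S) :
    C.P S x = x := by
  induction hx using Submodule.span_induction with
  | mem x h => obtain ⟨p, hp, rfl⟩ := h; exact C.P_root hS hp
  | zero => exact map_zero _
  | add x y _ _ hx hy => rw [map_add, hx, hy]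
  | smul a x _ hx => rw [map_smul, hx]

lemma DS_mono {S T : Finset (Fin C.n × ℕ)} (h : S ⊆ T) : C.DS S ≤ C.DS T :=
  Submodule.span_mono (image_mono (Finset.coe_subset.2 h))

lemma coeff_eq_zero {S : Finset (Fin C.n × ℕ)} (hS : S ⊆ C.all) {p : Fin C.n × ℕ}
    (hp : p ∈ C.all) (hpS : p ∉ S) {x : E.D} (hx : x ∈ C.DS S) : C.coeff p x = 0 := by
  classical
  rw [← C.P_eq_self hS hx, C.coeff_P hS hp, if_neg hpS]

lemma Q_mem (S : Finset (Fin C.n × ℕ)) (y : Y) : C.Q S y ∈ C.YS S := by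
  rw [Q_apply]
  exact Submodule.sum_mem _ fun p hp =>
    Submodule.smul_mem _ _ ⟨_, Submodule.subset_span ⟨p, hp, rfl⟩, rfl⟩

lemma Q_eq_self {S : Finset (Fin C.n × ℕ)} (hS : S ⊆ C.all) {y : Y} (hy : y ∈ C.YS S) :
    C.Q S y = y := by
  obtain ⟨x, hx, rfl⟩ := hy
  rw [← C.opB_P, C.P_eq_self hS hx]

lemma Q_eq_zero_iff {S : Finset (Fin C.n × ℕ)} (hS : S ⊆ C.all) {y : Y} :
    C.Q S y = 0 ↔ ∀ p ∈ S, C.q p.1 p.2 y = 0 := by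
  classical
  constructor
  · intro h p hp
    have := C.q_Q hS (hS hp) y
    rwa [h, map_zero, if_pos hp, eq_comm] at this
  · intro h
    rw [Q_apply]
    exact Finset.sum_eq_zero fun p hp => by rw [h p hp, zero_smul]

lemma Q1_apply (y : Y) : C.Q1 y = y - C.Q C.all y := rfl

lemma P1_apply (x : E.D) : C.P1 x = x - C.P C.all x := rfl

lemma q_Q1 {p : Fin C.n × ℕ} (hp : p ∈ C.all) (y : Y) : C.q p.1 p.2 (C.Q1 y) = 0 := by
  classical
  rw [Q1_apply, map_sub, C.q_Q subset_rfl hp, if_pos hp, sub_self]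

lemma coeff_P1 {p : Fin C.n × ℕ} (hp : p ∈ C.all) (x : E.D) : C.coeff p (C.P1 x) = 0 := by
  classical
  rw [P1_apply, map_sub, C.coeff_P subset_rfl hp, if_pos hp, sub_self]

lemma opB_P1 (x : E.D) : E.opB (C.P1 x) = C.Q1 (E.opB x) := by
  rw [P1_apply, map_sub, opB_P, Q1_apply]

lemma P1_eq_self_iff {x : E.D} : C.P1 x = x ↔ ∀ p ∈ C.all, C.coeff p x = 0 := by
  constructor
  · intro h p hp; rw [← h, C.coeff_P1 hp]
  · intro h
    rw [P1_apply, P_apply, Finset.sum_eq_zero, sub_zero]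
    intro p hp; rw [h p hp, zero_smul]

lemma Q1_eq_self_iff {y : Y} : C.Q1 y = y ↔ ∀ p ∈ C.all, C.q p.1 p.2 y = 0 := by
  rw [Q1_apply, sub_eq_self, C.Q_eq_zero_iff subset_rfl]

lemma mem_D1_iff {x : E.D} : x ∈ C.D1 ↔ C.P1 x = x := by
  constructor
  · rintro ⟨z, rfl⟩
    rw [P1_eq_self_iff]
    exact fun p hp => C.coeff_P1 hp z
  · exact fun h => ⟨x, h⟩

lemma mem_Y1_iff {y : Y} : y ∈ C.Y1 ↔ C.Q1 y = y := by
  constructor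
  · rintro ⟨z, rfl⟩
    rw [Q1_eq_self_iff]
    exact fun p hp => C.q_Q1 hp z
  · exact fun h => ⟨y, h⟩

lemma P1_of_mem_DS {S : Finset (Fin C.n × ℕ)} (hS : S ⊆ C.all) {x : E.D} (hx : x ∈ C.DS S) :
    C.P1 x = 0 := by
  rw [P1_apply, C.P_eq_self subset_rfl (C.DS_mono hS hx), sub_self]

/-- `y ∈ Y` is determined by `Q₁ y` and the values `⟨y, q_p⟩`. -/
lemma ext_Y {y z : Y} (h1 : C.Q1 y = C.Q1 z) (h : ∀ p ∈ C.all, C.q p.1 p.2 y = C.q p.1 p.2 z) :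
    y = z := by
  have h2 : C.Q C.all y = C.Q C.all z := by
    rw [Q_apply, Q_apply]
    exact Finset.sum_congr rfl fun p hp => by rw [h p hp]
  rw [Q1_apply, Q1_apply, h2] at h1
  exact sub_left_injective h1

lemma ext_D {x z : E.D} (h1 : C.P1 x = C.P1 z) (h : ∀ p ∈ C.all, C.coeff p x = C.coeff p z) :
    x = z := by
  have h2 : C.P C.all x = C.P C.all z := by
    rw [P_apply, P_apply]
    exact Finset.sum_congr rfl fun p hp => by rw [h p hp]
  rw [P1_apply, P1_apply, h2] at h1
  exact sub_left_injective h1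

lemma P_congr {S : Finset (Fin C.n × ℕ)} {x z : E.D}
    (h : ∀ p ∈ S, C.coeff p x = C.coeff p z) : C.P S x = C.P S z := by
  rw [P_apply, P_apply]
  exact Finset.sum_congr rfl fun p hp => by rw [h p hp]

lemma q_opA_of_lt {p : Fin C.n × ℕ} (hp : p.2 + 1 < C.m p.1) (x : E.D) :
    C.q p.1 p.2 (E.opA x) = -C.coeff (p.1, p.2 + 1) x := C.dual_chain p.1 p.2 hp x

lemma q_opA_of_eq {p : Fin C.n × ℕ} (hp : p.2 + 1 = C.m p.1) (x : E.D) :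
    C.q p.1 p.2 (E.opA x) = 0 := by
  have := C.dual_last p.1 x
  rwa [← hp, Nat.add_sub_cancel] at this

lemma opA_root_zero (i : Fin C.n) : E.opA (C.φ i 0) = 0 := by
  rw [← LinearMap.mem_ker, ← C.span_ker]
  exact Submodule.subset_span ⟨i, rfl⟩

lemma Q1_opB_root {p : Fin C.n × ℕ} (hp : p ∈ C.all) : C.Q1 (E.opB (C.φ p.1 p.2)) = 0 := by
  rw [Q1_apply, C.Q_eq_self subset_rfl, sub_self]
  exact ⟨_, Submodule.subset_span ⟨p, hp, rfl⟩, rfl⟩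

lemma Q1_opA_of_mem {x : E.D} (hx : x ∈ C.DS C.all) : C.Q1 (E.opA x) = 0 := by
  induction hx using Submodule.span_induction with
  | mem x h =>
    obtain ⟨⟨i, s⟩, hp, rfl⟩ := h
    rcases s with _ | s
    · simp only [opA_root_zero, map_zero]
    · have hs : s + 1 < C.m i := mem_all.1 hp
      simp only
      rw [C.chain i s hs, map_neg, C.Q1_opB_root (p := (i, s)) (mem_all.2 (by simp only; omega)),
        neg_zero]
  | zero => simp
  | add x y _ _ hx hy => rw [map_add, map_add, hx, hy, add_zero]
  | smul a x _ hx => rw [map_smul, map_smul, hx, smul_zero]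

/-- `A` intertwines the projectors. -/
lemma Q1_opA (x : E.D) : C.Q1 (E.opA x) = E.opA (C.P1 x) := by
  have h1 : C.Q1 (E.opA (C.P1 x)) = C.Q1 (E.opA x) := by
    rw [P1_apply, map_sub, map_sub, C.Q1_opA_of_mem (C.P_mem _ x), sub_zero]
  rw [← h1, Q1_eq_self_iff]
  intro p hp
  rcases (Nat.succ_le_of_lt (mem_all.1 hp)).lt_or_eq with h | h
  · rw [C.q_opA_of_lt h, C.coeff_P1 (mem_all.2 h), neg_zero]
  · exact C.q_opA_of_eq h _

lemma opA_of_mem_zero {x : E.D} (hx : x ∈ C.DS C.zero) : E.opA x = 0 := by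
  induction hx using Submodule.span_induction with
  | mem x h =>
    obtain ⟨⟨i, s⟩, hp, rfl⟩ := h
    have hs : s = 0 := mem_zero.1 hp
    subst hs
    exact C.opA_root_zero i
  | zero => simp
  | add x y _ _ hx hy => rw [map_add, hx, hy, add_zero]
  | smul a x _ hx => rw [map_smul, hx, smul_zero]

/-! ### The operator `Ã` -/

lemma Atilde_apply (x : E.D) :
    C.Atilde x = E.opA x + ∑ i, C.coeff (i, 0) x • E.opB (C.φ i (C.m i - 1)) := by
  simp only [Atilde, LinearMap.add_apply, LinearMap.sum_apply]; rfl

lemma first_mem_all (i : Fin C.n) : (i, 0) ∈ C.all := mem_all.2 (C.one_le_m i)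

lemma last_mem_all (i : Fin C.n) : (i, C.m i - 1) ∈ C.all :=
  mem_all.2 (by have := C.one_le_m i; simp only; omega)

lemma Atilde_of_coeff {x : E.D} (h : ∀ i, C.coeff (i, 0) x = 0) : C.Atilde x = E.opA x := by
  rw [Atilde_apply, Finset.sum_eq_zero, add_zero]
  intro i _; rw [h, zero_smul]

lemma Atilde_P1 (x : E.D) : C.Atilde (C.P1 x) = E.opA (C.P1 x) :=
  C.Atilde_of_coeff fun i => C.coeff_P1 (C.first_mem_all i) x

lemma Q1_Atilde (x : E.D) : C.Q1 (C.Atilde x) = C.Atilde (C.P1 x) := by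
  rw [Atilde_P1, Atilde_apply, map_add, map_sum, Q1_opA, Finset.sum_eq_zero, add_zero]
  intro i _
  rw [map_smul, C.Q1_opB_root (p := (i, C.m i - 1)) (C.last_mem_all i), smul_zero]

/-- If `Ã x = 0`, then applying `q_i^{m_i}`, which annihilates the range of `A`, shows that
`⟨B x, q_i^1⟩ = 0` for all `i`. So `A x = 0`, and the coordinates of `x` along the eigenvectors vanish.
-/
lemma Atilde_injective : Function.Injective C.Atilde := by
  rw [← LinearMap.ker_eq_bot, LinearMap.ker_eq_bot']
  intro x hx
  have hc : ∀ k, C.coeff (k, 0) x = 0 := by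
    intro k
    have h1 : C.q k (C.m k - 1) (C.Atilde x) = 0 := by rw [hx, map_zero]
    rw [Atilde_apply, map_add, C.dual_last, zero_add, map_sum, Finset.sum_eq_single k] at h1
    · have h2 := C.coeff_root (C.last_mem_all k) (C.last_mem_all k)
      rw [if_pos rfl, coeff_apply] at h2
      rwa [map_smul, h2, smul_eq_mul, mul_one] at h1
    · intro i _ hik
      have h2 := C.coeff_root (C.last_mem_all k) (C.last_mem_all i)
      rw [if_neg (fun h => hik (congrArg Prod.fst h).symm), coeff_apply] at h2
      rw [map_smul, h2, smul_zero]
    · exact fun h => absurd (Finset.mem_univ k) h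
  rw [C.Atilde_of_coeff hc, ← LinearMap.mem_ker, ← C.span_ker,
    Submodule.mem_span_range_iff_exists_fun] at hx
  obtain ⟨c, rfl⟩ := hx
  refine Finset.sum_eq_zero fun k _ => ?_
  have h1 := hc k
  rw [map_sum, Finset.sum_eq_single k] at h1
  · have h2 := C.coeff_root (C.first_mem_all k) (C.first_mem_all k)
    rw [if_pos rfl] at h2
    rw [map_smul, h2, smul_eq_mul, mul_one] at h1
    rw [h1, zero_smul]
  · intro i _ hik
    have h2 := C.coeff_root (C.first_mem_all k) (C.first_mem_all i)
    rw [if_neg (fun h => hik (congrArg Prod.fst h).symm)] at h2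
    rw [map_smul, h2, smul_zero]
  · exact fun h => absurd (Finset.mem_univ k) h

end CanonicalSystem

end

/-! ### The bounded inverse of `Ã` -/

section

variable {𝕜 X Y : Type*} [RCLike 𝕜]
  [NormedAddCommGroup X] [NormedSpace 𝕜 X] [NormedAddCommGroup Y] [NormedSpace 𝕜 Y]

/-- An injective sum of a bijective operator and an operator of finite rank is surjective. -/
lemma surjective_add_of_finite_rank {V : Type*} [AddCommGroup V] [Module 𝕜 V] (e G : V →ₗ[𝕜] V)
    (he : Function.Bijective e) [FiniteDimensional 𝕜 (LinearMap.range G)]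
    (hinj : Function.Injective (e + G)) : Function.Surjective (e + G) := by
  set e' := LinearEquiv.ofBijective e he with he'
  have hee : ∀ x, e (e'.symm x) = x := e'.apply_symm_apply
  have hee' : ∀ x, e'.symm (e x) = x := e'.symm_apply_apply
  intro y
  -- `1 + e⁻¹ G` leaves the finite-dimensional space `N` invariant
  set N : Submodule 𝕜 V := Submodule.span 𝕜 {e'.symm y} ⊔ (LinearMap.range G).map
    (e'.symm : V →ₗ[𝕜] V) with hN
  set h : V →ₗ[𝕜] V := LinearMap.id + (e'.symm : V →ₗ[𝕜] V).comp G with hh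
  have hmaps : ∀ x ∈ N, h x ∈ N := fun x hx =>
    N.add_mem hx (Submodule.mem_sup_right ⟨G x, ⟨x, rfl⟩, rfl⟩)
  have heh : ∀ x, e (h x) = (e + G) x := fun x => by
    simp [hh, hee]
  have hhinj : Function.Injective (h.restrict hmaps) := by
    intro a b hab
    have h1 : h a = h b := congrArg Subtype.val hab
    exact Subtype.ext (hinj (by rw [← heh, ← heh, h1]))
  obtain ⟨x, hx⟩ := LinearMap.injective_iff_surjective.1 hhinj
    ⟨e'.symm y, Submodule.mem_sup_left (Submodule.mem_span_singleton_self _)⟩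
  refine ⟨x, ?_⟩
  have h1 : h x = e'.symm y := congrArg Subtype.val hx
  rw [← heh, h1, hee]

namespace OperatorPair

variable (E : OperatorPair 𝕜 X Y)

/-- If `T : Y → X` is bounded with values in `D`, then `A T` is bounded. -/
lemma continuous_opA_comp [CompleteSpace Y] (T : Y →L[𝕜] E.D) :
    Continuous fun y => E.opA (T y) := by
  let K : Y →ₗ[𝕜] Y := E.opA.comp T.toLinearMap
  refine K.continuous_of_isClosed_graph ?_
  have h : (K.graph : Set (Y × Y)) =
      (fun p : Y × Y => (((T p.1 : E.D) : X), p.2)) ⁻¹' (E.A.graph : Set (X × Y)) := by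
    ext ⟨y, z⟩
    simp only [SetLike.mem_coe, LinearMap.mem_graph_iff, mem_preimage, LinearPMap.mem_graph_iff]
    constructor
    · rintro rfl; exact ⟨T y, rfl, rfl⟩
    · rintro ⟨x, hx, rfl⟩
      rw [Subtype.ext hx]; rfl
  rw [h]
  exact E.closed_A.preimage (by fun_prop)

/-- If `T : Y → X` is bounded with values in `D`, then `B T` is bounded. -/
lemma continuous_opB_comp [CompleteSpace Y] (T : Y →L[𝕜] E.D) :
    Continuous fun y => E.opB (T y) := by
  let K : Y →ₗ[𝕜] Y := E.opB.comp T.toLinearMap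
  refine K.continuous_of_isClosed_graph ?_
  have h : (K.graph : Set (Y × Y)) =
      (fun p : Y × Y => (((T p.1 : E.D) : X), p.2)) ⁻¹' (E.B.graph : Set (X × Y)) := by
    ext ⟨y, z⟩
    simp only [SetLike.mem_coe, LinearMap.mem_graph_iff, mem_preimage, LinearPMap.mem_graph_iff]
    constructor
    · rintro rfl
      exact ⟨⟨(T y : X), E.domain_le (T y).2⟩, rfl, rfl⟩
    · rintro ⟨x, hx, rfl⟩
      have : x = ⟨(T y : X), E.domain_le (T y).2⟩ := Subtype.ext hx
      rw [this]; rfl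
  rw [h]
  exact E.closed_B.preimage (by fun_prop)

/-- For large real `l` the operator `l A + B` is boundedly invertible; over the real field its
inverse is the real part of the resolvent of the complexified pencil. -/
lemma exists_real_resolvent [NormedSpace ℝ Y] [IsScalarTower ℝ 𝕜 Y] {k : ℕ} (h : E.PencilBound k) :
    ∃ r : ℝ, 0 < r ∧ ∀ l : ℝ, r ≤ l → ∃ T : Y →L[𝕜] E.D,
      (∀ y, (l : 𝕜) • E.opA (T y) + E.opB (T y) = y) ∧
      ∀ x : E.D, T ((l : 𝕜) • E.opA x + E.opB x) = x := by
  obtain ⟨c, r, -, hr, h1, h2⟩ := h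
  refine ⟨r, hr, fun l hl => ?_⟩
  have hl0 : 0 ≤ l := hr.le.trans hl
  have key : ∃ R : Y →L[𝕜] X, E.IsResolvent (l : 𝕜) R := by
    by_cases hI : (RCLike.I : 𝕜) = 0
    · obtain ⟨R, ⟨hR1, hR2⟩, -⟩ := h2 hI (l : ℂ) (by
        rw [Complex.norm_real, Real.norm_of_nonneg hl0]; exact hl)
      have hsm : ∀ y : Y, (l : 𝕜) • y = l • y := fun y => algebraMap_smul 𝕜 l y
      refine ⟨(ContinuousLinearMap.fst 𝕜 X X).comp (R.comp (ContinuousLinearMap.inl 𝕜 Y Y)),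
        fun y => ?_, fun x => ?_⟩
      · obtain ⟨u, v, huv, hp⟩ := hR1 (y, 0)
        refine ⟨u, congrArg Prod.fst huv, ?_⟩
        have := congrArg Prod.fst hp
        simpa [complexPencil, hsm] using this
      · have := congrArg Prod.fst (hR2 x 0)
        simpa [complexPencil, hsm] using this
    · obtain ⟨R, hR, -⟩ := h1 hI (l : 𝕜) (by
        rw [RCLike.norm_ofReal, abs_of_nonneg hl0]; exact hl)
      exact ⟨R, hR⟩
  obtain ⟨R, hR1, hR2⟩ := key
  have hmem : ∀ y, R y ∈ E.D := fun y => by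
    obtain ⟨x, hx, -⟩ := hR1 y
    rw [← hx]; exact x.2
  refine ⟨R.codRestrict E.D hmem, fun y => ?_, fun x => Subtype.ext (hR2 x)⟩
  obtain ⟨x, hx, hxy⟩ := hR1 y
  have : R.codRestrict E.D hmem y = x := Subtype.ext hx.symm
  rw [this, hxy]

end OperatorPair

namespace CanonicalSystem

variable {E : OperatorPair 𝕜 X Y} {ν : ℕ} (C : CanonicalSystem E ν)

/-- The range of `Ã`; it is closed, being the sum of the closed range of `A` and a finite-dimensional
space. -/
lemma range_Atilde : LinearMap.range C.Atilde =
    LinearMap.range E.opA ⊔ Submodule.span 𝕜 (range fun i => E.opB (C.φ i (C.m i - 1))) := by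
  apply le_antisymm
  · rintro _ ⟨x, rfl⟩
    rw [Atilde_apply]
    refine Submodule.add_mem_sup ⟨x, rfl⟩ (Submodule.sum_mem _ fun i _ =>
      Submodule.smul_mem _ _ (Submodule.subset_span ⟨i, rfl⟩))
  · have hroot : ∀ i, C.Atilde (C.φ i 0) = E.opB (C.φ i (C.m i - 1)) := fun i => by
      rw [Atilde_apply, C.opA_root_zero, zero_add, Finset.sum_eq_single i]
      · have h2 := C.coeff_root (C.first_mem_all i) (C.first_mem_all i)
        rw [if_pos rfl] at h2
        rw [h2, one_smul]
      · intro k _ hik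
        have h2 := C.coeff_root (C.first_mem_all k) (C.first_mem_all i)
        rw [if_neg (fun h => hik (congrArg Prod.fst h))] at h2
        rw [h2, zero_smul]
      · exact fun h => absurd (Finset.mem_univ i) h
    have h2 : Submodule.span 𝕜 (range fun i => E.opB (C.φ i (C.m i - 1))) ≤
        LinearMap.range C.Atilde := by
      rw [Submodule.span_le]
      rintro _ ⟨i, rfl⟩
      exact ⟨_, hroot i⟩
    refine sup_le ?_ h2
    rintro _ ⟨x, rfl⟩
    have h3 : E.opA x = C.Atilde x - ∑ i, C.coeff (i, 0) x • E.opB (C.φ i (C.m i - 1)) := by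
      rw [Atilde_apply, add_sub_cancel_right]
    rw [h3]
    exact Submodule.sub_mem _ ⟨x, rfl⟩ (h2 (Submodule.sum_mem _ fun i _ =>
      Submodule.smul_mem _ _ (Submodule.subset_span ⟨i, rfl⟩)))

/-- `Ã` has a bounded inverse. If `T = (l₀ A + B)⁻¹`, then `A T + s` is invertible for `s > 0`,
hence `Ã T + s`, a perturbation of finite rank, has index zero. As `Ã T` is injective with closed
range, it is bounded below; so `Ã T + s` is bijective with an inverse bounded uniformly in `s`, and
passing to the limit `s → 0` shows that the range of `Ã T` is dense. -/
theorem exists_Atilde_inverse [CompleteSpace Y] [NormedSpace ℝ Y] [IsScalarTower ℝ 𝕜 Y]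
    (hν : E.IsRegularPencilOfIndex ν) :
    ∃ R : Y →L[𝕜] E.D, (∀ y, C.Atilde (R y) = y) ∧ ∀ x, R (C.Atilde x) = x := by
  rcases hν with ⟨rfl, R, hR1, hR2⟩ | ⟨⟨-, hb⟩, -⟩
  -- in index zero there are no root vectors, and `Ã = A`
  · have hA : ∀ x, C.Atilde x = E.opA x := fun x => C.Atilde_of_coeff fun i =>
      absurd (C.m_le i) (by have := C.one_le_m i; omega)
    have hmem : ∀ y, R y ∈ E.D := fun y => by
      obtain ⟨x, hx, -⟩ := hR1 y
      rw [← hx]; exact x.2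
    refine ⟨R.codRestrict E.D hmem, fun y => ?_, fun x => ?_⟩
    · obtain ⟨x, hx, hxy⟩ := hR1 y
      have : R.codRestrict E.D hmem y = x := Subtype.ext hx.symm
      rw [this, hA, hxy]
    · rw [hA]; exact Subtype.ext (hR2 x)
  obtain ⟨r, hr, hres⟩ := E.exists_real_resolvent hb
  obtain ⟨T, hT1, hT2⟩ := hres r le_rfl
  have hTinj : Function.Injective T := fun a b h => by rw [← hT1 a, h, hT1 b]
  have hTsurj : Function.Surjective T := fun x => ⟨_, hT2 x⟩
  let K : Y →L[𝕜] Y := ⟨E.opA.comp T.toLinearMap, E.continuous_opA_comp T⟩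
  let L : Y →L[𝕜] Y := ⟨E.opB.comp T.toLinearMap, E.continuous_opB_comp T⟩
  let G : Y →L[𝕜] Y := ∑ i, ((C.q i 0).comp L).smulRight (E.opB (C.φ i (C.m i - 1)))
  have hKG : ∀ y, (K + G) y = C.Atilde (T y) := fun y => by
    rw [Atilde_apply]
    simp only [K, G, L, _root_.add_apply, _root_.sum_apply]; rfl
  have hinj : Function.Injective (K + G) := fun a b h => by
    rw [hKG, hKG] at h
    exact hTinj (C.Atilde_injective h)
  have hrange : IsClosed (range (K + G)) := by
    have h1 : range (K + G) = (LinearMap.range C.Atilde : Set Y) := by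
      have : ⇑(K + G) = C.Atilde ∘ T := funext hKG
      rw [this, hTsurj.range_comp]; rfl
    rw [h1, range_Atilde]
    have : IsClosed (LinearMap.range E.opA : Set Y) := E.closed_range
    have := FiniteDimensional.span_of_finite 𝕜 (finite_range fun i => E.opB (C.φ i (C.m i - 1)))
    exact Submodule.isClosed_sup_finiteDimensional _ _ ‹_›
  obtain ⟨c, hc⟩ := (K + G).antilipschitz_of_injective_of_isClosed_range hinj hrange
  have hc' : ∀ y, ‖y‖ ≤ c * ‖(K + G) y‖ := fun y => by
    simpa using hc.le_mul_dist y 0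
  have hGfin : FiniteDimensional 𝕜 (LinearMap.range G.toLinearMap) := by
    have := FiniteDimensional.span_of_finite 𝕜 (finite_range fun i => E.opB (C.φ i (C.m i - 1)))
    refine Submodule.finiteDimensional_of_le (S₂ := Submodule.span 𝕜
      (range fun i => E.opB (C.φ i (C.m i - 1)))) ?_
    rintro _ ⟨y, rfl⟩
    have : G y = ∑ i, C.q i 0 (L y) • E.opB (C.φ i (C.m i - 1)) := by
      simp only [G, _root_.sum_apply]; rfl
    change G y ∈ _
    rw [this]
    exact Submodule.sum_mem _ fun i _ =>
      Submodule.smul_mem _ _ (Submodule.subset_span ⟨i, rfl⟩)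
  -- `A T + s = s ((r + s⁻¹) A + B) T`, and `r + s⁻¹` is a regular point of the pencil
  have hKs : ∀ s : ℝ, 0 < s → Function.Bijective (K + (s : 𝕜) • ContinuousLinearMap.id 𝕜 Y) := by
    intro s hs
    obtain ⟨T', hT1', hT2'⟩ := hres (r + s⁻¹) (by have := inv_pos.2 hs; linarith)
    have hs' : (s : 𝕜) ≠ 0 := by exact_mod_cast hs.ne'
    have hfac : ∀ y, (K + (s : 𝕜) • ContinuousLinearMap.id 𝕜 Y) y =
        (s : 𝕜) • (((r + s⁻¹ : ℝ) : 𝕜) • E.opA (T y) + E.opB (T y)) := fun y => by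
      have h1 : (K + (s : 𝕜) • ContinuousLinearMap.id 𝕜 Y) y = E.opA (T y) + (s : 𝕜) • y := rfl
      rw [h1]
      nth_rw 2 [← hT1 y]
      push_cast
      rw [add_smul, add_right_comm, smul_add (s : 𝕜) (_ + _) ((s : 𝕜)⁻¹ • _),
        smul_smul (s : 𝕜) (s : 𝕜)⁻¹, mul_inv_cancel₀ hs', one_smul, add_comm]
    constructor
    · intro a b h
      rw [hfac, hfac] at h
      have h2 := smul_right_injective Y hs' h
      apply hTinj
      rw [← hT2' (T a), h2, hT2']
    · intro y
      obtain ⟨z, hz⟩ := hTsurj (T' ((s : 𝕜)⁻¹ • y))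
      refine ⟨z, ?_⟩
      rw [hfac, hz, hT1', smul_smul, mul_inv_cancel₀ hs', one_smul]
  have hsurj : Function.Surjective (K + G) := by
    rw [← range_eq_univ, ← hrange.closure_eq, eq_univ_iff_forall]
    intro y
    rw [Metric.mem_closure_range_iff]
    intro ε hε
    obtain ⟨s, hs0, hs⟩ : ∃ s : ℝ, 0 < s ∧ s * (2 * c * ‖y‖ + 1) < ε ∧ c * s ≤ 1 / 2 := by
      refine ⟨min (ε / (2 * (2 * c * ‖y‖ + 1))) (1 / (2 * (c + 1))), by positivity, ?_, ?_⟩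
      · calc _ ≤ ε / (2 * (2 * c * ‖y‖ + 1)) * (2 * c * ‖y‖ + 1) :=
              mul_le_mul_of_nonneg_right (min_le_left _ _) (by positivity)
          _ = ε / 2 := by field_simp
          _ < ε := by linarith
      · calc (c : ℝ) * _ ≤ c * (1 / (2 * (c + 1))) :=
              mul_le_mul_of_nonneg_left (min_le_right _ _) (by positivity)
          _ = 1 / 2 * (c / (c + 1)) := by field_simp
          _ ≤ 1 / 2 * 1 := by
              gcongr
              rw [div_le_one (by positivity)]; linarith
          _ = 1 / 2 := by norm_num
    -- `c s ≤ 1 / 2` keeps `Ã T + s` bounded below, with the constant `2 c` instead of `c`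
    have hbd : ∀ x, ‖x‖ ≤ 2 * c * ‖(K + G) x + (s : 𝕜) • x‖ := fun x => by
      have h1 := hc' x
      have h2 : ‖(K + G) x‖ ≤ ‖(K + G) x + (s : 𝕜) • x‖ + s * ‖x‖ := by
        have := norm_sub_le ((K + G) x + (s : 𝕜) • x) ((s : 𝕜) • x)
        rwa [add_sub_cancel_right, norm_smul, RCLike.norm_ofReal, abs_of_pos hs0] at this
      have h3 : (c : ℝ) * ‖(K + G) x‖ ≤ c * (‖(K + G) x + (s : 𝕜) • x‖ + s * ‖x‖) :=
        mul_le_mul_of_nonneg_left h2 c.2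
      nlinarith [mul_le_mul_of_nonneg_right hs.2 (norm_nonneg x)]
    have hform : ∀ x, ((K + (s : 𝕜) • ContinuousLinearMap.id 𝕜 Y).toLinearMap + G.toLinearMap) x =
        (K + G) x + (s : 𝕜) • x := fun x => by
      change K x + (s : 𝕜) • x + G x = K x + G x + (s : 𝕜) • x
      abel
    -- with `(Ã T + s) x = y` the distance of `Ã T x` from `y` is `s ‖x‖ ≤ 2 c s ‖y‖ < ε`
    obtain ⟨x, hx⟩ := surjective_add_of_finite_rank
      (K + (s : 𝕜) • ContinuousLinearMap.id 𝕜 Y).toLinearMap G.toLinearMap (hKs s hs0) (by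
        rw [← LinearMap.ker_eq_bot, LinearMap.ker_eq_bot']
        intro x hx
        rw [hform] at hx
        have := hbd x
        rw [hx, norm_zero, mul_zero] at this
        exact norm_le_zero_iff.1 this) y
    rw [hform] at hx
    refine ⟨x, ?_⟩
    have h1 := hbd x
    rw [hx] at h1
    rw [dist_eq_norm, ← hx, add_sub_cancel_left, norm_smul, RCLike.norm_ofReal, abs_of_pos hs0]
    calc s * ‖x‖ ≤ s * (2 * c * ‖y‖ + 1) := by gcongr; linarith
      _ < ε := hs.1
  let e := ContinuousLinearEquiv.ofBijective (K + G) (LinearMap.ker_eq_bot.2 hinj)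
    (LinearMap.range_eq_top.2 hsurj)
  have he : ∀ y, C.Atilde (T (e.symm y)) = y := fun y => by
    rw [← hKG]; exact e.apply_symm_apply y
  exact ⟨T.comp (e.symm : Y →L[𝕜] Y), he, fun x => C.Atilde_injective (he _)⟩

end CanonicalSystem

end

/-! ### The components of the adjoined vectors -/

section

lemma sum_Icc_eq_add {M : Type*} [AddCommMonoid M] {s N : ℕ} (h : s ≤ N) (g : ℕ → M) :
    ∑ j ∈ Finset.Icc s N, g j = g s + ∑ j ∈ Finset.Icc (s + 1) N, g j := by
  have : Finset.Icc s N = insert s (Finset.Icc (s + 1) N) := by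
    ext j; simp only [Finset.mem_insert, Finset.mem_Icc]; omega
  rw [this, Finset.sum_insert (by simp)]

/-- A family `g 1, …, g N` can be constructed downwards from `g N`, if the requirement `R s` on
`g s` involves only the members `g j` with `s ≤ j ≤ N`. -/
lemma exists_of_downward_recursion {α : Type*} [Inhabited α] (N : ℕ) (R : ℕ → (ℕ → α) → Prop)
    (hR : ∀ s ≤ N, ∀ g g', (∀ j, s ≤ j → j ≤ N → g j = g' j) → R s g → R s g')
    (hstep : ∀ s ∈ Finset.Icc 1 N, ∀ g, (∀ j ∈ Finset.Icc (s + 1) N, R j g) →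
      ∃ a, R s (Function.update g s a)) :
    ∃ g, ∀ s ∈ Finset.Icc 1 N, R s g := by
  have key : ∀ k ≤ N, ∃ g, ∀ s ∈ Finset.Icc (N + 1 - k) N, R s g := by
    intro k
    induction k with
    | zero => exact fun _ => ⟨default, fun s hs => by simp at hs⟩
    | succ k ih =>
      intro hk
      obtain ⟨g, hg⟩ := ih (by omega)
      have he : N + 1 - (k + 1) + 1 = N + 1 - k := by omega
      obtain ⟨a, ha⟩ := hstep (N + 1 - (k + 1)) (Finset.mem_Icc.2 ⟨by omega, by omega⟩) g
        (by rwa [he])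
      refine ⟨Function.update g (N + 1 - (k + 1)) a, fun s hs => ?_⟩
      rw [Finset.mem_Icc] at hs
      rcases hs.1.eq_or_lt with h | h
      · rw [← h]; exact ha
      · refine hR s hs.2 g _ (fun j hj _ => ?_) (hg s (Finset.mem_Icc.2 ⟨by omega, hs.2⟩))
        rw [Function.update_of_ne (by omega)]
  obtain ⟨g, hg⟩ := key N le_rfl
  exact ⟨g, fun s hs => hg s (by rw [Finset.mem_Icc] at hs ⊢; omega)⟩

variable {𝕜 X Y : Type*} [RCLike 𝕜]
  [NormedAddCommGroup X] [NormedSpace 𝕜 X] [NormedAddCommGroup Y] [NormedSpace 𝕜 Y]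

namespace CanonicalSystem

variable {E : OperatorPair 𝕜 X Y} {ν : ℕ} (C : CanonicalSystem E ν)

instance finiteDimensional_DS (S : Finset (Fin C.n × ℕ)) : FiniteDimensional 𝕜 (C.DS S) :=
  FiniteDimensional.span_of_finite 𝕜 (S.finite_toSet.image _)

instance completeSpace_DS (S : Finset (Fin C.n × ℕ)) : CompleteSpace (C.DS S) :=
  FiniteDimensional.complete 𝕜 _

/-! ### The algebraic equations in coordinates -/

lemma opB_mem_YS {S : Finset (Fin C.n × ℕ)} {x : E.D} (hx : x ∈ C.DS S) : E.opB x ∈ C.YS S :=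
  ⟨x, hx, rfl⟩

/-- `A` maps a root vector of order `s + 1` to the negative image under `B` of its predecessor. -/
lemma opA_mem_YS_wedge {s : ℕ} {S : Finset (Fin C.n × ℕ)}
    (hS : ∀ p ∈ S, s + 1 < C.m p.1 ∧ p.2 = s + 1) {d : E.D} (hd : d ∈ C.DS S) :
    E.opA d ∈ C.YS (C.wedge s) := by
  induction hd using Submodule.span_induction with
  | mem x h =>
    obtain ⟨⟨i, r⟩, hp, rfl⟩ := h
    obtain ⟨h1, h2⟩ := hS _ hp
    simp only at h1 h2 ⊢
    subst h2
    rw [C.chain i s h1]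
    exact Submodule.neg_mem _ (C.opB_mem_YS (Submodule.subset_span
      ⟨(i, s), by rw [Finset.mem_coe, mem_wedge]; exact ⟨by simp only; omega, rfl⟩, rfl⟩))
  | zero => simp
  | add x y _ _ hx hy => rw [map_add]; exact Submodule.add_mem _ hx hy
  | smul a x _ hx => rw [map_smul]; exact Submodule.smul_mem _ _ hx

lemma opA_add_mem_YS_wedge {s : ℕ} {d e : E.D} (hd : d ∈ C.DS (C.star (s + 1)))
    (he : e ∈ C.DS (C.wedge (s + 1))) : E.opA (d + e) ∈ C.YS (C.wedge s) := by
  rw [map_add]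
  exact Submodule.add_mem _
    (C.opA_mem_YS_wedge (fun p hp => by rw [mem_star] at hp; omega) hd)
    (C.opA_mem_YS_wedge (fun p hp => by rw [mem_wedge] at hp; omega) he)

lemma Fstar_mem (f : ℝ → E.D → Y) (s : ℕ) (t : ℝ) {x : E.D} (hx : x ∈ C.DS (C.star s))
    (z : E.D) : C.Fstar f s t x z ∈ C.YS (C.star s) :=
  Submodule.sub_mem _ (C.Q_mem _ _) (C.opB_mem_YS hx)

lemma Fwedge_mem (f : ℝ → E.D → Y) (s : ℕ) (t : ℝ) {x : E.D} (hx : x ∈ C.DS (C.wedge s))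
    (z v : E.D) {d e : E.D} (hd : d ∈ C.DS (C.star (s + 1)))
    (he : e ∈ C.DS (C.wedge (s + 1))) : C.Fwedge f s t x z v (d + e) ∈ C.YS (C.wedge s) :=
  Submodule.sub_mem _ (Submodule.sub_mem _ (C.Q_mem _ _) (C.opB_mem_YS hx))
    (C.opA_add_mem_YS_wedge hd he)

lemma F20_mem (f : ℝ → E.D → Y) (t : ℝ) {x : E.D} (hx : x ∈ C.DS C.zero) (x1 xs d : E.D) :
    C.F20 f t x1 x xs d ∈ C.YS C.zero :=
  Submodule.sub_mem _ (Submodule.sub_mem _ (C.Q_mem _ _) (C.opB_mem_YS hx)) (C.Q_mem _ _)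

lemma Fstar_eq_zero_iff (f : ℝ → E.D → Y) (s : ℕ) (t : ℝ) {x : E.D}
    (hx : x ∈ C.DS (C.star s)) (z : E.D) :
    C.Fstar f s t x z = 0 ↔ ∀ p ∈ C.star s, C.q p.1 p.2 (f t (x + z)) = C.coeff p x := by
  have h : C.Fstar f s t x z = C.Q (C.star s) (f t (x + z) - E.opB x) := by
    rw [Fstar, map_sub, C.Q_eq_self (C.star_subset_all s) (C.opB_mem_YS hx)]
  rw [h, C.Q_eq_zero_iff (C.star_subset_all s)]
  simp only [map_sub, sub_eq_zero, coeff_apply]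

lemma Fwedge_eq_zero_iff (f : ℝ → E.D → Y) (s : ℕ) (t : ℝ) {x : E.D}
    (hx : x ∈ C.DS (C.wedge s)) (z v : E.D) {d e : E.D} (hd : d ∈ C.DS (C.star (s + 1)))
    (he : e ∈ C.DS (C.wedge (s + 1))) :
    C.Fwedge f s t x z v (d + e) = 0 ↔ ∀ p ∈ C.wedge s,
      C.q p.1 p.2 (f t (z + (x + v))) + C.coeff (p.1, p.2 + 1) (d + e) = C.coeff p x := by
  have h : C.Fwedge f s t x z v (d + e) =
      C.Q (C.wedge s) (f t (z + (x + v)) - E.opB x - E.opA (d + e)) := by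
    rw [Fwedge, map_sub, map_sub, C.Q_eq_self (C.wedge_subset_all s) (C.opB_mem_YS hx),
      C.Q_eq_self (C.wedge_subset_all s) (C.opA_add_mem_YS_wedge hd he)]
  rw [h, C.Q_eq_zero_iff (C.wedge_subset_all s)]
  refine forall₂_congr fun p hp => ?_
  rw [mem_wedge] at hp
  rw [map_sub, map_sub, C.q_opA_of_lt (by omega), ← coeff_apply, sub_neg_eq_add,
    sub_add_eq_add_sub, sub_eq_zero]

lemma F20_eq_zero_iff (f : ℝ → E.D → Y) (t : ℝ) (x1 xs d : E.D) {x : E.D}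
    (hx : x ∈ C.DS C.zero) :
    C.F20 f t x1 x xs d = 0 ↔ ∀ p ∈ C.zero,
      C.q p.1 p.2 (f t (x1 + x + xs)) - C.q p.1 p.2 (E.opA d) = C.coeff p x := by
  have h : C.F20 f t x1 x xs d = C.Q C.zero (f t (x1 + x + xs) - E.opB x - E.opA d) := by
    rw [F20, map_sub, map_sub, C.Q_eq_self C.zero_subset_all (C.opB_mem_YS hx)]
  rw [h, C.Q_eq_zero_iff C.zero_subset_all]
  refine forall₂_congr fun p hp => ?_
  rw [map_sub, map_sub, ← coeff_apply, sub_right_comm, sub_eq_zero]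

/-! ### Smooth solutions of the algebraic equations -/

variable [NormedSpace ℝ X] [IsScalarTower ℝ 𝕜 X]

/-- A linear map on `D`, restricted to a finite-dimensional space of root vectors. -/
def restrictDS (S : Finset (Fin C.n × ℕ)) {F : Type*} [NormedAddCommGroup F] [NormedSpace 𝕜 F]
    [NormedSpace ℝ F] [IsScalarTower ℝ 𝕜 F] (T : E.D →ₗ[𝕜] F) : C.DS S →L[ℝ] F :=
  (LinearMap.toContinuousLinearMap (T.comp (C.DS S).subtype)).restrictScalars ℝ

/-- The inclusion of a space of root vectors into the space of all root vectors. -/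
def inclDS {S : Finset (Fin C.n × ℕ)} (hS : S ⊆ C.all) : C.DS S →L[ℝ] C.DS C.all :=
  (LinearMap.toContinuousLinearMap (Submodule.inclusion (C.DS_mono hS))).restrictScalars ℝ

@[simp]
lemma coe_inclDS {S : Finset (Fin C.n × ℕ)} (hS : S ⊆ C.all) (x : C.DS S) :
    (C.inclDS hS x : E.D) = x := rfl

/-- A real-linear retraction onto a space of root vectors; it turns curves in `D₂` with values in `V` into
curves in `V`. -/
lemma exists_projection {V : Submodule 𝕜 E.D} (hV : V ≤ C.DS C.all) :
    ∃ π : C.DS C.all →L[ℝ] V, ∀ (y : C.DS C.all) (h : (y : E.D) ∈ V), π y = ⟨y, h⟩ := by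
  obtain ⟨g, hg⟩ := (Submodule.inclusion hV).exists_leftInverse_of_injective
    (LinearMap.ker_eq_bot.2 (Submodule.inclusion_injective hV))
  refine ⟨(LinearMap.toContinuousLinearMap g).restrictScalars ℝ, fun y h => ?_⟩
  have := LinearMap.congr_fun hg ⟨y, h⟩
  exact this

variable [NormedSpace ℝ Y]

lemma contDiffOn_comp_subspace {V : Submodule 𝕜 E.D} (hV : V ≤ C.DS C.all) {N : Set E.D}
    (hN : N ⊆ V) {Φ : ℝ → E.D → Y} {k : WithTop ℕ∞}
    (hΦ : ContDiffOn ℝ k (fun p : ℝ × V => Φ p.1 p.2) {p | 0 ≤ p.1 ∧ (p.2 : E.D) ∈ N})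
    {W : Type*} [NormedAddCommGroup W] [NormedSpace ℝ W] {s : Set (ℝ × W)}
    {h : ℝ × W → C.DS C.all} (hh : ContDiffOn ℝ k h s)
    (hs : ∀ p ∈ s, 0 ≤ p.1 ∧ (h p : E.D) ∈ N) :
    ContDiffOn ℝ k (fun p => Φ p.1 (h p)) s := by
  obtain ⟨π, hπ⟩ := C.exists_projection hV
  have h1 : ContDiffOn ℝ k (fun p : ℝ × W => (p.1, π (h p))) s :=
    contDiff_fst.contDiffOn.prodMk (π.contDiff.comp_contDiffOn hh)
  have hπN : ∀ p ∈ s, (π (h p) : E.D) = h p := fun p hp => by rw [hπ _ (hN (hs p hp).2)]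
  refine (hΦ.comp h1 fun p hp => ⟨(hs p hp).1, ?_⟩).congr fun p hp => ?_
  · simp only [hπN p hp]; exact (hs p hp).2
  · simp only [Function.comp_apply, hπN p hp]

variable [IsScalarTower ℝ 𝕜 Y]

open Classical in
/-- Smoothness of the solution of an algebraic equation `F(t, x) = 0`, `x ∈ M`. -/
lemma exists_smooth_zero {S : Finset (Fin C.n × ℕ)} (hS : S ⊆ C.all) {M : Set E.D}
    (hM : RelOpen (C.DS S) M) {F : ℝ → E.D → Y} {k : ℕ} (hk : 1 ≤ k)
    (hF : ContDiffOn ℝ k (fun p : ℝ × C.DS S => F p.1 p.2) {p | 0 ≤ p.1 ∧ (p.2 : E.D) ∈ M})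
    (hFY : ∀ t, 0 ≤ t → ∀ x ∈ C.DS S, F t x ∈ C.YS S)
    (hex : ∀ t, 0 ≤ t → ∃! x, x ∈ M ∧ F t x = 0)
    (hinv : ∀ t, 0 ≤ t → ∀ x : C.DS S, (x : E.D) ∈ M → F t x = 0 →
      HasInvertibleDeriv (C.DS S) (C.YS S) (fun u => F t u) x) :
    ∃ ξ : ℝ → C.DS C.all, ContDiffOn ℝ k ξ (Ici 0) ∧
      ∀ t, 0 ≤ t → (ξ t : E.D) ∈ M ∧ F t (ξ t) = 0 := by
  let Qh : Y →L[ℝ] C.YS S := ((C.Q S).codRestrict (C.YS S) (C.Q_mem S)).restrictScalars ℝ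
  have hQh : ∀ y (hy : y ∈ C.YS S), Qh y = ⟨y, hy⟩ := fun y hy =>
    Subtype.ext (C.Q_eq_self hS hy)
  choose! ξ₀ hξ₀ hξu using hex
  let ξ : ℝ → C.DS S := fun t => if h : ξ₀ t ∈ C.DS S then ⟨ξ₀ t, h⟩ else 0
  have hξ : ∀ t, 0 ≤ t → (ξ t : E.D) = ξ₀ t := fun t ht => by
    have h : ξ₀ t ∈ C.DS S := hM.1 (hξ₀ t ht).1
    simp only [ξ]
    rw [dif_pos h]
  have hset : (Ici (0 : ℝ) ×ˢ {x : C.DS S | (x : E.D) ∈ M}) =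
      {p : ℝ × C.DS S | 0 ≤ p.1 ∧ (p.2 : E.D) ∈ M} := rfl
  have hzero : ∀ t, 0 ≤ t → ∀ x : C.DS S, Qh (F t x) = 0 ↔ F t x = 0 := fun t ht x => by
    rw [hQh _ (hFY t ht x x.2), Submodule.mk_eq_zero]
  have hsm : ContDiffOn ℝ k ξ (Ici 0) := by
    refine contDiffOn_of_implicit (F := fun p : ℝ × C.DS S => Qh (F p.1 p.2)) hM.2 hk
      (Qh.contDiff.comp_contDiffOn (hset ▸ hF)) (fun t ht => ⟨?_, ?_⟩) (fun t ht u hu hu0 => ?_)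
      fun t ht => ?_
    · change (ξ t : E.D) ∈ M
      rw [hξ t ht]; exact (hξ₀ t ht).1
    · rw [hzero t ht, hξ t ht]; exact (hξ₀ t ht).2
    · rw [hzero t ht] at hu0
      exact Subtype.ext ((hξu t ht u ⟨hu, hu0⟩).trans (hξ t ht).symm)
    · obtain ⟨L, hL⟩ := hinv t ht (ξ t) (by rw [hξ t ht]; exact (hξ₀ t ht).1)
        (by rw [hξ t ht]; exact (hξ₀ t ht).2)
      refine ⟨L, ?_⟩
      have h1 := Qh.hasFDerivAt.comp (ξ t) hL
      refine h1.congr_fderiv ?_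
      ext u
      exact congrArg Subtype.val (hQh _ (L u).2)
  exact ⟨fun t => C.inclDS hS (ξ t), (C.inclDS hS).contDiff.comp_contDiffOn hsm, fun t ht => by
    rw [coe_inclDS, hξ t ht]; exact hξ₀ t ht⟩

end CanonicalSystem

end

/-! ### The components of order at least one -/

section

variable {𝕜 X Y : Type*} [RCLike 𝕜]
  [NormedAddCommGroup X] [NormedSpace 𝕜 X] [NormedAddCommGroup Y] [NormedSpace 𝕜 Y]

namespace CanonicalSystem

variable {E : OperatorPair 𝕜 X Y} {ν : ℕ} (C : CanonicalSystem E ν)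

/-- `∑_{j=s}^{ν-1} x_{2j}^{(j+1)}(t)` for `σ j t = x_{2j}^{(j+1)}(t)`. -/
def starPart (σ : ℕ → ℝ → C.DS C.all) (s : ℕ) (t : ℝ) : C.DS C.all :=
  ∑ j ∈ Finset.Icc s (ν - 1), σ j t

/-- `∑_{j=s}^{ν-2} x_{2∧,j}(t)` for `τ j t = x_{2∧,j}(t)`. -/
def wedgePart (τ : ℕ → ℝ → C.DS C.all) (s : ℕ) (t : ℝ) : C.DS C.all :=
  ∑ j ∈ Finset.Icc s (ν - 2), τ j t

variable {C}

lemma starPart_mem_starSum {S : C.Sets} {σ : ℕ → ℝ → C.DS C.all} {s : ℕ} {t : ℝ}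
    (h : ∀ j ∈ Finset.Icc s (ν - 1), (σ j t : E.D) ∈ S.Mstar j) :
    (C.starPart σ s t : E.D) ∈ S.starSum s := by
  rw [starPart, Submodule.coe_sum]
  exact Set.finsetSum_mem_finsetSum _ _ _ h

lemma wedgePart_mem_wedgeSum {S : C.Sets} {τ : ℕ → ℝ → C.DS C.all} {s : ℕ} {t : ℝ}
    (h : ∀ j ∈ Finset.Icc s (ν - 2), (τ j t : E.D) ∈ S.Mwedge j) :
    (C.wedgePart τ s t : E.D) ∈ S.wedgeSum s := by
  rw [wedgePart, Submodule.coe_sum]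
  exact Set.finsetSum_mem_finsetSum _ _ _ h

lemma starSum_eq_add (S : C.Sets) {s : ℕ} (hs : s ≤ ν - 1) :
    S.starSum s = S.Mstar s + S.starSum (s + 1) := sum_Icc_eq_add hs _

lemma wedgeSum_eq_add (S : C.Sets) {s : ℕ} (hs : s ≤ ν - 2) :
    S.wedgeSum s = S.Mwedge s + S.wedgeSum (s + 1) := sum_Icc_eq_add hs _

lemma starSum_subset {S : C.Sets} (hS : S.Open) {s : ℕ} (hs : 1 ≤ s) :
    S.starSum s ⊆ (⨆ j ∈ Finset.Icc s (ν - 1), C.DS (C.star j) : Submodule 𝕜 E.D) := by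
  intro x hx
  obtain ⟨g, hg, rfl⟩ := (Set.mem_finsetSum _ _ _).1 hx
  refine Submodule.sum_mem _ fun j hj => ?_
  have hj' : j ∈ Finset.Icc 1 (ν - 1) := by rw [Finset.mem_Icc] at hj ⊢; omega
  exact Submodule.mem_iSup_of_mem j (Submodule.mem_iSup_of_mem hj ((hS.2.2.1 j hj').1 (hg hj)))

lemma wedgeSum_subset {S : C.Sets} (hS : S.Open) {s : ℕ} (hs : 1 ≤ s) :
    S.wedgeSum s ⊆ (⨆ j ∈ Finset.Icc s (ν - 2), C.DS (C.wedge j) : Submodule 𝕜 E.D) := by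
  intro x hx
  obtain ⟨g, hg, rfl⟩ := (Set.mem_finsetSum _ _ _).1 hx
  refine Submodule.sum_mem _ fun j hj => ?_
  have hj' : j ∈ Finset.Icc 1 (ν - 2) := by rw [Finset.mem_Icc] at hj ⊢; omega
  exact Submodule.mem_iSup_of_mem j (Submodule.mem_iSup_of_mem hj ((hS.2.2.2 j hj').1 (hg hj)))

lemma starPart_congr {σ σ' : ℕ → ℝ → C.DS C.all} {s : ℕ}
    (h : ∀ j, s ≤ j → j ≤ ν - 1 → σ j = σ' j) : C.starPart σ s = C.starPart σ' s := by
  ext1 t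
  exact Finset.sum_congr rfl fun j hj => by
    rw [Finset.mem_Icc] at hj; rw [h j hj.1 hj.2]

lemma wedgePart_congr {τ τ' : ℕ → ℝ → C.DS C.all} {s : ℕ}
    (h : ∀ j, s ≤ j → j ≤ ν - 2 → τ j = τ' j) : C.wedgePart τ s = C.wedgePart τ' s := by
  ext1 t
  exact Finset.sum_congr rfl fun j hj => by
    rw [Finset.mem_Icc] at hj; rw [h j hj.1 hj.2]

variable (C) [NormedSpace ℝ X] [IsScalarTower ℝ 𝕜 X]

/-- The derivative on `[0, ∞)` of the part of `x_{2Σ}(t)` that consists of the components of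
order at least `s`. -/
def tailDeriv (σ τ : ℕ → ℝ → C.DS C.all) (s : ℕ) (t : ℝ) : C.DS C.all :=
  derivWithin (fun t => C.starPart σ s t + C.wedgePart τ s t) (Ici 0) t

variable {C} in
lemma tailDeriv_contDiffOn {σ τ : ℕ → ℝ → C.DS C.all} {s : ℕ} (hs : s ≤ ν - 2)
    (hσ : ∀ j ∈ Finset.Icc (s + 1) (ν - 1),
      ContDiffOn ℝ (if j = ν - 1 then ν - 1 else ν - 2 : ℕ) (σ j) (Ici 0))
    (hτ : ∀ j ∈ Finset.Icc (s + 1) (ν - 2), ContDiffOn ℝ j (τ j) (Ici 0)) :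
    ContDiffOn ℝ (s + 1 : ℕ) (fun t => C.starPart σ (s + 1) t + C.wedgePart τ (s + 1) t) (Ici 0) ∧
    ContDiffOn ℝ s (C.tailDeriv σ τ (s + 1)) (Ici 0) := by
  have h : ContDiffOn ℝ (s + 1 : ℕ)
      (fun t => C.starPart σ (s + 1) t + C.wedgePart τ (s + 1) t) (Ici 0) := by
    refine ContDiffOn.add (ContDiffOn.sum fun j hj => (hσ j hj).of_le ?_)
      (ContDiffOn.sum fun j hj => (hτ j hj).of_le ?_)
    · rw [Finset.mem_Icc] at hj
      norm_cast
      split_ifs <;> omega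
    · rw [Finset.mem_Icc] at hj
      exact_mod_cast hj.1
  exact ⟨h, h.derivWithin (uniqueDiffOn_Ici 0) (by norm_cast)⟩

variable [NormedSpace ℝ Y]

/-- The components `x_{2s}^{(s+1)}(t) = σ s t` and `x_{2∧,s}(t) = τ s t` of a solution in `M`: they
solve the algebraic equations, and the variables `d`, `e` in the equation for `x_{2∧,s}` are the
derivatives of the components of order `s + 1`. -/
structure IsAdjointPart (f : ℝ → E.D → Y) (S : C.Sets) (σ τ : ℕ → ℝ → C.DS C.all) : Prop where
  star_contDiffOn : ∀ s ∈ Finset.Icc 1 (ν - 1),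
    ContDiffOn ℝ (if s = ν - 1 then ν - 1 else ν - 2 : ℕ) (σ s) (Ici 0)
  star_mem : ∀ s ∈ Finset.Icc 1 (ν - 1), ∀ t, 0 ≤ t → (σ s t : E.D) ∈ S.Mstar s
  star_eq : ∀ s ∈ Finset.Icc 1 (ν - 1), ∀ t, 0 ≤ t →
    C.Fstar f s t (σ s t) (C.starPart σ (s + 1) t) = 0
  wedge_contDiffOn : ∀ s ∈ Finset.Icc 1 (ν - 2), ContDiffOn ℝ s (τ s) (Ici 0)
  wedge_mem : ∀ s ∈ Finset.Icc 1 (ν - 2), ∀ t, 0 ≤ t → (τ s t : E.D) ∈ S.Mwedge s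
  wedge_eq : ∀ s ∈ Finset.Icc 1 (ν - 2), ∀ t, 0 ≤ t →
    C.Fwedge f s t (τ s t) (C.starPart σ 1 t) (C.wedgePart τ (s + 1) t)
      (C.P (C.star (s + 1)) (C.tailDeriv σ τ (s + 1) t) +
        C.P (C.wedge (s + 1)) (C.tailDeriv σ τ (s + 1) t)) = 0

variable [IsScalarTower ℝ 𝕜 Y] {C}

lemma exists_star_components {f : ℝ → E.D → Y} {S : C.Sets} (hS : C.SolvabilityConditions f S) :
    ∃ σ : ℕ → ℝ → C.DS C.all, ∀ s ∈ Finset.Icc 1 (ν - 1),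
      ContDiffOn ℝ (if s = ν - 1 then ν - 1 else ν - 2 : ℕ) (σ s) (Ici 0) ∧
      ∀ t, 0 ≤ t → (σ s t : E.D) ∈ S.Mstar s ∧
        C.Fstar f s t (σ s t) (C.starPart σ (s + 1) t) = 0 := by
  refine exists_of_downward_recursion (ν - 1) _ (fun s hs σ σ' h hR => ?_) fun s hs σ hσ => ?_
  · rw [h s le_rfl hs, starPart_congr fun j hj => h j (by omega)] at hR
    exact hR
  have hs' := Finset.mem_Icc.1 hs
  have hz : ContDiffOn ℝ (if s = ν - 1 then ν - 1 else ν - 2 : ℕ) (C.starPart σ (s + 1)) (Ici 0) := by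
    refine ContDiffOn.sum fun j hj => (hσ j hj).1.of_le ?_
    rw [Finset.mem_Icc] at hj
    norm_cast
    split_ifs <;> omega
  have hzm : ∀ t, 0 ≤ t → (C.starPart σ (s + 1) t : E.D) ∈ S.starSum (s + 1) := fun t ht =>
    starPart_mem_starSum fun j hj => ((hσ j hj).2 t ht).1
  have hV : (⨆ j ∈ Finset.Icc s (ν - 1), C.DS (C.star j) : Submodule 𝕜 E.D) ≤ C.DS C.all :=
    iSup₂_le fun j _ => C.DS_mono (C.star_subset_all j)
  have hF : ContDiffOn ℝ (if s = ν - 1 then ν - 1 else ν - 2 : ℕ)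
      (fun p : ℝ × C.DS (C.star s) => C.Fstar f s p.1 p.2 (C.starPart σ (s + 1) p.1))
      {p | 0 ≤ p.1 ∧ (p.2 : E.D) ∈ S.Mstar s} := by
    have hcast : (if s = ν - 1 then (((ν - 1 : ℕ) : ℕ∞) : WithTop ℕ∞)
        else (((ν - 2 : ℕ) : ℕ∞) : WithTop ℕ∞)) =
          ((if s = ν - 1 then ν - 1 else ν - 2 : ℕ) : WithTop ℕ∞) := by
      split_ifs <;> rfl
    have hsm := hS.smooth.1 s hs
    rw [hcast] at hsm
    have h1 := C.contDiffOn_comp_subspace hV (starSum_subset hS.isOpen hs'.1)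
      (Φ := fun t x => C.Q (C.star s) (f t x)) hsm
      (s := {p : ℝ × C.DS (C.star s) | 0 ≤ p.1 ∧ (p.2 : E.D) ∈ S.Mstar s})
      (h := fun p => C.inclDS (C.star_subset_all s) p.2 + C.starPart σ (s + 1) p.1)
      (((C.inclDS (C.star_subset_all s)).contDiff.comp contDiff_snd).contDiffOn.add
        (hz.comp contDiff_fst.contDiffOn fun p hp => hp.1))
      (fun p hp => ⟨hp.1, by
        rw [starSum_eq_add S hs'.2]
        exact Set.add_mem_add hp.2 (hzm p.1 hp.1)⟩)
    exact h1.sub ((C.restrictDS (C.star s) E.opB).contDiff.comp contDiff_snd).contDiffOn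
  obtain ⟨ξ, hξ, hξ0⟩ := C.exists_smooth_zero (C.star_subset_all s) (hS.isOpen.2.2.1 s hs)
    (F := fun t x => C.Fstar f s t x (C.starPart σ (s + 1) t))
    (k := if s = ν - 1 then ν - 1 else ν - 2) (by split_ifs <;> omega) hF
    (fun t _ x hx => C.Fstar_mem f s t hx _)
    (fun t ht => hS.uniqueSolvability.1 s hs t ht _ (hzm t ht))
    fun t ht x hx hx0 => hS.invertibleDerivs.1 s hs t ht x hx _ (hzm t ht) hx0
  have hst : C.starPart (Function.update σ s ξ) (s + 1) = C.starPart σ (s + 1) :=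
    starPart_congr fun j hj _ => Function.update_of_ne (by omega) _ _
  refine ⟨ξ, ?_⟩
  rw [Function.update_self, hst]
  exact ⟨hξ, hξ0⟩

theorem exists_isAdjointPart {f : ℝ → E.D → Y} {S : C.Sets} (hS : C.SolvabilityConditions f S) :
    ∃ σ τ : ℕ → ℝ → C.DS C.all, C.IsAdjointPart f S σ τ := by
  obtain ⟨σ, hσ⟩ := exists_star_components hS
  have hz : ∀ t, 0 ≤ t → (C.starPart σ 1 t : E.D) ∈ S.starSum 1 := fun t ht =>
    starPart_mem_starSum fun j hj => ((hσ j hj).2 t ht).1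
  obtain ⟨τ, hτ⟩ : ∃ τ : ℕ → ℝ → C.DS C.all, ∀ s ∈ Finset.Icc 1 (ν - 2),
      ContDiffOn ℝ s (τ s) (Ici 0) ∧ ∀ t, 0 ≤ t → (τ s t : E.D) ∈ S.Mwedge s ∧
        C.Fwedge f s t (τ s t) (C.starPart σ 1 t) (C.wedgePart τ (s + 1) t)
          (C.P (C.star (s + 1)) (C.tailDeriv σ τ (s + 1) t) +
            C.P (C.wedge (s + 1)) (C.tailDeriv σ τ (s + 1) t)) = 0 := by
    refine exists_of_downward_recursion (ν - 2) _ (fun s hs τ τ' h hR => ?_) fun s hs τ hτ => ?_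
    · have h' : C.wedgePart τ (s + 1) = C.wedgePart τ' (s + 1) :=
        wedgePart_congr fun j hj => h j (by omega)
      simp only [h s le_rfl hs, h', tailDeriv] at hR
      exact hR
    have hs' := Finset.mem_Icc.1 hs
    obtain ⟨-, hD⟩ := tailDeriv_contDiffOn (σ := σ) (τ := τ) hs'.2
      (fun j hj => (hσ j (by rw [Finset.mem_Icc] at hj ⊢; omega)).1) (fun j hj => (hτ j hj).1)
    have hz' : ContDiffOn ℝ s (C.starPart σ 1) (Ici 0) := by
      refine ContDiffOn.sum fun j hj => (hσ j hj).1.of_le ?_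
      norm_cast
      split_ifs <;> omega
    have hv : ContDiffOn ℝ s (C.wedgePart τ (s + 1)) (Ici 0) := by
      refine ContDiffOn.sum fun j hj => (hτ j hj).1.of_le ?_
      rw [Finset.mem_Icc] at hj
      norm_cast
      omega
    have hvm : ∀ t, 0 ≤ t → (C.wedgePart τ (s + 1) t : E.D) ∈ S.wedgeSum (s + 1) := fun t ht =>
      wedgePart_mem_wedgeSum fun j hj => ((hτ j hj).2 t ht).1
    have hV : ((⨆ j ∈ Finset.Icc 1 (ν - 1), C.DS (C.star j)) ⊔
        (⨆ j ∈ Finset.Icc s (ν - 2), C.DS (C.wedge j)) : Submodule 𝕜 E.D) ≤ C.DS C.all :=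
      sup_le (iSup₂_le fun j _ => C.DS_mono (C.star_subset_all j))
        (iSup₂_le fun j _ => C.DS_mono (C.wedge_subset_all j))
    have hN : S.starSum 1 + S.wedgeSum s ⊆ ((⨆ j ∈ Finset.Icc 1 (ν - 1), C.DS (C.star j)) ⊔
        (⨆ j ∈ Finset.Icc s (ν - 2), C.DS (C.wedge j)) : Submodule 𝕜 E.D) := by
      rintro _ ⟨a, ha, b, hb, rfl⟩
      exact Submodule.add_mem_sup (starSum_subset hS.isOpen le_rfl ha)
        (wedgeSum_subset hS.isOpen hs'.1 hb)
    have hF : ContDiffOn ℝ s (fun p : ℝ × C.DS (C.wedge s) =>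
        C.Fwedge f s p.1 p.2 (C.starPart σ 1 p.1) (C.wedgePart τ (s + 1) p.1)
          (C.P (C.star (s + 1)) (C.tailDeriv σ τ (s + 1) p.1) +
            C.P (C.wedge (s + 1)) (C.tailDeriv σ τ (s + 1) p.1)))
        {p | 0 ≤ p.1 ∧ (p.2 : E.D) ∈ S.Mwedge s} := by
      have h1 := C.contDiffOn_comp_subspace hV hN
        (Φ := fun t x => C.Q (C.wedge s) (f t x)) (hS.smooth.2 s hs)
        (s := {p : ℝ × C.DS (C.wedge s) | 0 ≤ p.1 ∧ (p.2 : E.D) ∈ S.Mwedge s})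
        (h := fun p => C.starPart σ 1 p.1 +
          (C.inclDS (C.wedge_subset_all s) p.2 + C.wedgePart τ (s + 1) p.1))
        ((hz'.comp contDiff_fst.contDiffOn fun p hp => hp.1).add
          (((C.inclDS (C.wedge_subset_all s)).contDiff.comp contDiff_snd).contDiffOn.add
          (hv.comp contDiff_fst.contDiffOn fun p hp => hp.1)))
        (fun p hp => ⟨hp.1, Set.add_mem_add (hz p.1 hp.1) (by
          rw [wedgeSum_eq_add S hs'.2]
          exact Set.add_mem_add hp.2 (hvm p.1 hp.1))⟩)
      refine (h1.sub ((C.restrictDS (C.wedge s) E.opB).contDiff.comp contDiff_snd).contDiffOn).sub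
        ((C.restrictDS C.all (E.opA.comp (C.P (C.star (s + 1)) +
          C.P (C.wedge (s + 1))))).contDiff.comp_contDiffOn
            (hD.comp contDiff_fst.contDiffOn fun p hp => hp.1))
    obtain ⟨ξ, hξ, hξ0⟩ := C.exists_smooth_zero (C.wedge_subset_all s) (hS.isOpen.2.2.2 s hs)
      (F := fun t x => C.Fwedge f s t x (C.starPart σ 1 t) (C.wedgePart τ (s + 1) t)
          (C.P (C.star (s + 1)) (C.tailDeriv σ τ (s + 1) t) +
            C.P (C.wedge (s + 1)) (C.tailDeriv σ τ (s + 1) t))) hs'.1 hF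
      (fun t _ x hx => C.Fwedge_mem f s t hx _ _ (C.P_mem _ _) (C.P_mem _ _))
      (fun t ht => hS.uniqueSolvability.2.1 s hs t ht _ (hz t ht) _ (hvm t ht) _ (C.P_mem _ _) _
        (C.P_mem _ _))
      fun t ht x hx hx0 => hS.invertibleDerivs.2 s hs t ht x hx _ (hz t ht) _ (hvm t ht) _
        (C.P_mem _ _) _ (C.P_mem _ _) hx0
    have hst : C.wedgePart (Function.update τ s ξ) (s + 1) = C.wedgePart τ (s + 1) :=
      wedgePart_congr fun j hj _ => Function.update_of_ne (by omega) _ _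
    refine ⟨ξ, ?_⟩
    simp only [Function.update_self, hst, tailDeriv]
    exact ⟨hξ, hξ0⟩
  exact ⟨σ, τ, fun s hs => (hσ s hs).1, fun s hs t ht => ((hσ s hs).2 t ht).1,
    fun s hs t ht => ((hσ s hs).2 t ht).2, fun s hs => (hτ s hs).1,
    fun s hs t ht => ((hτ s hs).2 t ht).1, fun s hs t ht => ((hτ s hs).2 t ht).2⟩

end CanonicalSystem

end

section

variable {𝕜 X Y : Type*} [RCLike 𝕜]
  [NormedAddCommGroup X] [NormedSpace 𝕜 X] [NormedAddCommGroup Y] [NormedSpace 𝕜 Y]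

namespace CanonicalSystem

variable {E : OperatorPair 𝕜 X Y} {ν : ℕ} (C : CanonicalSystem E ν)

/-! ### The components of the elements of `M` -/

lemma coeff_sum_star {g : ℕ → E.D} {s : ℕ}
    (hg : ∀ j ∈ Finset.Icc s (ν - 1), g j ∈ C.DS (C.star j)) {p : Fin C.n × ℕ} (hp : p ∈ C.all) :
    C.coeff p (∑ j ∈ Finset.Icc s (ν - 1), g j) =
      if s ≤ p.2 ∧ C.m p.1 = p.2 + 1 then C.coeff p (g p.2) else 0 := by
  have hm := C.m_le p.1
  have hp' := mem_all.1 hp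
  rw [map_sum]
  split_ifs with h
  · refine Finset.sum_eq_single p.2 (fun j hj hjp => ?_) fun hj => ?_
    · exact C.coeff_eq_zero (C.star_subset_all j) hp
        (fun h' => hjp (mem_star.1 h').2.symm) (hg j hj)
    · exact absurd (Finset.mem_Icc.2 ⟨h.1, by omega⟩) hj
  · refine Finset.sum_eq_zero fun j hj => C.coeff_eq_zero (C.star_subset_all j) hp
      (fun h' => h ?_) (hg j hj)
    rw [mem_star] at h'
    rw [Finset.mem_Icc] at hj
    omega

lemma coeff_sum_wedge {g : ℕ → E.D} {s : ℕ}
    (hg : ∀ j ∈ Finset.Icc s (ν - 2), g j ∈ C.DS (C.wedge j)) {p : Fin C.n × ℕ} (hp : p ∈ C.all) :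
    C.coeff p (∑ j ∈ Finset.Icc s (ν - 2), g j) =
      if s ≤ p.2 ∧ p.2 + 2 ≤ C.m p.1 then C.coeff p (g p.2) else 0 := by
  have hm := C.m_le p.1
  have hp' := mem_all.1 hp
  rw [map_sum]
  split_ifs with h
  · refine Finset.sum_eq_single p.2 (fun j hj hjp => ?_) fun hj => ?_
    · exact C.coeff_eq_zero (C.wedge_subset_all j) hp
        (fun h' => hjp (mem_wedge.1 h').2.symm) (hg j hj)
    · exact absurd (Finset.mem_Icc.2 ⟨h.1, by omega⟩) hj
  · refine Finset.sum_eq_zero fun j hj => C.coeff_eq_zero (C.wedge_subset_all j) hp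
      (fun h' => h ?_) (hg j hj)
    rw [mem_wedge] at h'
    rw [Finset.mem_Icc] at hj
    omega

lemma coeff_sum_add_sum {g h : ℕ → E.D} {s : ℕ}
    (hg : ∀ j ∈ Finset.Icc s (ν - 1), g j ∈ C.DS (C.star j))
    (hh : ∀ j ∈ Finset.Icc s (ν - 2), h j ∈ C.DS (C.wedge j)) {p : Fin C.n × ℕ} (hp : p ∈ C.all) :
    C.coeff p (∑ j ∈ Finset.Icc s (ν - 1), g j + ∑ j ∈ Finset.Icc s (ν - 2), h j) =
      if s ≤ p.2 then (if C.m p.1 = p.2 + 1 then C.coeff p (g p.2) else C.coeff p (h p.2))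
      else 0 := by
  have hp' := mem_all.1 hp
  rw [map_add, C.coeff_sum_star hg hp, C.coeff_sum_wedge hh hp]
  by_cases h1 : s ≤ p.2
  · by_cases h2 : C.m p.1 = p.2 + 1
    · rw [if_pos ⟨h1, h2⟩, if_neg (by omega), if_pos h1, if_pos h2, add_zero]
    · rw [if_neg (by omega), if_pos (by omega), if_pos h1, if_neg h2, zero_add]
  · rw [if_neg (by omega), if_neg (by omega), if_neg h1, add_zero]

lemma sum_mem_DS_all {g h : ℕ → E.D} {s r : ℕ}
    (hg : ∀ j ∈ Finset.Icc s (ν - 1), g j ∈ C.DS (C.star j))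
    (hh : ∀ j ∈ Finset.Icc r (ν - 2), h j ∈ C.DS (C.wedge j)) :
    ∑ j ∈ Finset.Icc s (ν - 1), g j + ∑ j ∈ Finset.Icc r (ν - 2), h j ∈ C.DS C.all :=
  add_mem (Submodule.sum_mem _ fun j hj => C.DS_mono (C.star_subset_all j) (hg j hj))
    (Submodule.sum_mem _ fun j hj => C.DS_mono (C.wedge_subset_all j) (hh j hj))

lemma decomposition (x : E.D) :
    C.P1 x + C.P C.zero x + (∑ j ∈ Finset.Icc 1 (ν - 1), C.P (C.star j) x +
      ∑ j ∈ Finset.Icc 1 (ν - 2), C.P (C.wedge j) x) = x := by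
  classical
  have hmem := C.sum_mem_DS_all (s := 1) (r := 1) (fun j _ => C.P_mem (C.star j) x)
    (fun j _ => C.P_mem (C.wedge j) x)
  refine C.ext_D ?_ fun p hp => ?_
  · rw [map_add, map_add, C.P1_of_mem_DS le_rfl hmem,
      C.P1_of_mem_DS C.zero_subset_all (C.P_mem _ _), add_zero, add_zero]
    exact C.P1_eq_self_iff.2 fun p hp => C.coeff_P1 hp x
  · rw [map_add, map_add, C.coeff_P1 hp, C.coeff_P C.zero_subset_all hp,
      C.coeff_sum_add_sum (fun j _ => C.P_mem (C.star j) x) (fun j _ => C.P_mem (C.wedge j) x) hp,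
      C.coeff_P (C.star_subset_all _) hp, C.coeff_P (C.wedge_subset_all _) hp]
    have hp' := mem_all.1 hp
    simp only [mem_zero, mem_star, mem_wedge]
    by_cases h0 : p.2 = 0
    · simp [h0]
    · by_cases h2 : C.m p.1 = p.2 + 1
      · simp [h0, h2, Nat.one_le_iff_ne_zero]
      · have h3 : p.2 + 2 ≤ C.m p.1 := by omega
        simp [h0, h2, h3, Nat.one_le_iff_ne_zero]

variable {C}

lemma components_of_mem_M {S : C.Sets} (hS : S.Open) {x : E.D} (hx : x ∈ S.M) :
    C.P1 x ∈ S.M1 ∧ C.P C.zero x ∈ S.M20 ∧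
      (∀ s ∈ Finset.Icc 1 (ν - 1), C.P (C.star s) x ∈ S.Mstar s) ∧
      ∀ s ∈ Finset.Icc 1 (ν - 2), C.P (C.wedge s) x ∈ S.Mwedge s := by
  obtain ⟨_, ⟨x1, h1, x20, h20, rfl⟩, _, ⟨a, ha, b, hb, rfl⟩, rfl⟩ := hx
  obtain ⟨g, hg, rfl⟩ := (Set.mem_finsetSum _ _ _).1 ha
  obtain ⟨h, hh, rfl⟩ := (Set.mem_finsetSum _ _ _).1 hb
  have hgD : ∀ j ∈ Finset.Icc 1 (ν - 1), g j ∈ C.DS (C.star j) := fun j hj =>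
    (hS.2.2.1 j hj).1 (hg hj)
  have hhD : ∀ j ∈ Finset.Icc 1 (ν - 2), h j ∈ C.DS (C.wedge j) := fun j hj =>
    (hS.2.2.2 j hj).1 (hh hj)
  have h20D : x20 ∈ C.DS C.zero := hS.2.1.1 h20
  have h1P := C.mem_D1_iff.1 h1.1
  have h1c := C.P1_eq_self_iff.1 h1P
  have hc : ∀ p ∈ C.all, C.coeff p (x1 + x20 + (∑ j ∈ Finset.Icc 1 (ν - 1), g j +
      ∑ j ∈ Finset.Icc 1 (ν - 2), h j)) = C.coeff p x20 + if 1 ≤ p.2 then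
        (if C.m p.1 = p.2 + 1 then C.coeff p (g p.2) else C.coeff p (h p.2)) else 0 :=
    fun p hp => by
      rw [map_add, map_add, h1c p hp, C.coeff_sum_add_sum hgD hhD hp, zero_add]
  have hmem := C.sum_mem_DS_all hgD hhD
  beta_reduce
  refine ⟨?_, ?_, fun s hs => ?_, fun s hs => ?_⟩
  · rw [map_add, map_add, C.P1_of_mem_DS le_rfl hmem, C.P1_of_mem_DS C.zero_subset_all h20D,
      add_zero, add_zero, h1P]
    exact h1
  · rw [C.P_congr (z := x20) fun p hp => ?_, C.P_eq_self C.zero_subset_all h20D]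
    · exact h20
    · rw [hc p (C.zero_subset_all hp), mem_zero.1 hp, if_neg (by omega), add_zero]
  · rw [C.P_congr (z := g s) fun p hp => ?_, C.P_eq_self (C.star_subset_all s) (hgD s hs)]
    · exact hg hs
    · have hp' := mem_star.1 hp
      have hs' := Finset.mem_Icc.1 hs
      rw [hc p (C.star_subset_all s hp), if_pos (by omega), if_pos (by omega),
        C.coeff_eq_zero C.zero_subset_all (C.star_subset_all s hp)
          (fun h' => by rw [mem_zero] at h'; omega) h20D, zero_add, hp'.2]
  · rw [C.P_congr (z := h s) fun p hp => ?_, C.P_eq_self (C.wedge_subset_all s) (hhD s hs)]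
    · exact hh hs
    · have hp' := mem_wedge.1 hp
      have hs' := Finset.mem_Icc.1 hs
      rw [hc p (C.wedge_subset_all s hp), if_pos (by omega), if_neg (by omega),
        C.coeff_eq_zero C.zero_subset_all (C.wedge_subset_all s hp)
          (fun h' => by rw [mem_zero] at h'; omega) h20D, zero_add, hp'.2]

/-! ### Coordinates of the right-hand side -/

variable {f : ℝ → E.D → Y}

/-- In the coordinates of order at least one, the right-hand side involves only the components
that its structure admits. -/
lemma q_f_star (hfs : C.HasStructure f) {t : ℝ} (ht : 0 ≤ t) {s : ℕ} (hs : 1 ≤ s)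
    {p : Fin C.n × ℕ} (hp : p ∈ C.star s) (x : E.D) :
    C.q p.1 p.2 (f t x) =
      C.q p.1 p.2 (f t (∑ j ∈ Finset.Icc s (ν - 1), C.P (C.star j) x)) := by
  classical
  have hpa := C.star_subset_all s hp
  have hp' := mem_star.1 hp
  have hm := C.m_le p.1
  conv_lhs => rw [hfs t ht x]
  rw [map_add, map_add, map_add, C.q_Q1 hpa, C.q_Q C.zero_subset_all hpa, map_sum, map_sum,
    if_neg (fun h' => by rw [mem_zero] at h'; omega), Finset.sum_eq_zero fun j _ => ?_,
    Finset.sum_eq_single s (fun j _ hj => ?_) (fun h' => ?_), C.q_Q (C.star_subset_all s) hpa,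
    if_pos hp, zero_add, zero_add, zero_add]
  · rw [C.q_Q (C.star_subset_all j) hpa, if_neg (fun h' => hj ?_)]
    exact (mem_star.1 h').2.symm.trans hp'.2
  · exact absurd (Finset.mem_Icc.2 ⟨hs, by omega⟩) h'
  · rw [C.q_Q (C.wedge_subset_all j) hpa, if_neg (fun h' => ?_)]
    rw [mem_wedge] at h'; omega

lemma q_f_wedge (hfs : C.HasStructure f) {t : ℝ} (ht : 0 ≤ t) {s : ℕ} (hs : 1 ≤ s)
    {p : Fin C.n × ℕ} (hp : p ∈ C.wedge s) (x : E.D) :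
    C.q p.1 p.2 (f t x) =
      C.q p.1 p.2 (f t (∑ j ∈ Finset.Icc 1 (ν - 1), C.P (C.star j) x +
        ∑ j ∈ Finset.Icc s (ν - 2), C.P (C.wedge j) x)) := by
  classical
  have hpa := C.wedge_subset_all s hp
  have hp' := mem_wedge.1 hp
  have hm := C.m_le p.1
  conv_lhs => rw [hfs t ht x]
  have h0 : ∀ j ∈ Finset.Icc 1 (ν - 1), C.q p.1 p.2 (C.Q (C.star j)
      (f t (∑ i ∈ Finset.Icc j (ν - 1), C.P (C.star i) x))) = 0 := fun j _ => by
    rw [C.q_Q (C.star_subset_all j) hpa, if_neg (fun h' => ?_)]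
    rw [mem_star] at h'; omega
  rw [map_add, map_add, map_add, C.q_Q1 hpa, C.q_Q C.zero_subset_all hpa, map_sum, map_sum,
    Finset.sum_eq_zero h0, if_neg (fun h' => by rw [mem_zero] at h'; omega),
    Finset.sum_eq_single s (fun j _ hj => ?_) (fun h' => ?_), C.q_Q (C.wedge_subset_all s) hpa,
    if_pos hp, zero_add, zero_add, add_zero]
  · rw [C.q_Q (C.wedge_subset_all j) hpa, if_neg (fun h' => hj ?_)]
    exact (mem_wedge.1 h').2.symm.trans hp'.2
  · exact absurd (Finset.mem_Icc.2 ⟨hs, by omega⟩) h'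

end CanonicalSystem

end

/-! ### The derivative of the components of order at least one -/

section

variable {𝕜 X Y : Type*} [RCLike 𝕜]
  [NormedAddCommGroup X] [NormedSpace 𝕜 X] [NormedAddCommGroup Y] [NormedSpace 𝕜 Y]

namespace CanonicalSystem

variable {E : OperatorPair 𝕜 X Y} {ν : ℕ} {C : CanonicalSystem E ν}

lemma coeff_star_add_wedge {s : ℕ} {p : Fin C.n × ℕ} (hp : p ∈ C.all) (hps : p.2 = s) (x : E.D) :
    C.coeff p (C.P (C.star s) x + C.P (C.wedge s) x) = C.coeff p x := by
  classical
  have hp' := mem_all.1 hp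
  rw [map_add, C.coeff_P (C.star_subset_all s) hp, C.coeff_P (C.wedge_subset_all s) hp]
  simp only [mem_star, mem_wedge]
  by_cases h : C.m p.1 = s + 1
  · rw [if_pos ⟨h, hps⟩, if_neg (by omega), add_zero]
  · rw [if_neg (by omega), if_pos ⟨by omega, hps⟩, zero_add]

/-- The equation `F₂₀ = 0` in coordinates, if the arguments `d`, `e` are the components of order one
of a vector `w` of `D₂`. -/
lemma F20_eq_zero_iff_of_components (f : ℝ → E.D → Y) (t : ℝ) (x1 xs w : E.D) {u : E.D}
    (hu : u ∈ C.DS C.zero) :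
    C.F20 f t x1 u xs (C.P (C.star 1) w + C.P (C.wedge 1) w) = 0 ↔
      ∀ p ∈ C.zero, C.q p.1 p.2 (f t (x1 + u + xs)) =
        C.q p.1 p.2 (E.opA w) + C.coeff p u := by
  rw [C.F20_eq_zero_iff f t x1 _ _ hu]
  refine forall₂_congr fun p hp => ?_
  have hp0 := mem_zero.1 hp
  have hp' := mem_all.1 (C.zero_subset_all hp)
  have : C.q p.1 p.2 (E.opA (C.P (C.star 1) w + C.P (C.wedge 1) w)) = C.q p.1 p.2 (E.opA w) := by
    by_cases h : p.2 + 1 = C.m p.1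
    · rw [C.q_opA_of_eq h, C.q_opA_of_eq h]
    · rw [C.q_opA_of_lt (by omega), C.q_opA_of_lt (by omega), coeff_star_add_wedge
        (mem_all.2 (show p.2 + 1 < C.m p.1 by omega)) (by simp [hp0])]
  rw [this, sub_eq_iff_eq_add']

variable [NormedSpace ℝ X] [IsScalarTower ℝ 𝕜 X]

variable (C) in
/-- The component `x_{2Σ}(t)`, assembled from its parts. -/
def sigmaPart (σ τ : ℕ → ℝ → C.DS C.all) (t : ℝ) : C.DS C.all :=
  C.starPart σ 1 t + C.wedgePart τ 1 t

namespace IsAdjointPart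

variable {f : ℝ → E.D → Y} {S : C.Sets} {σ τ : ℕ → ℝ → C.DS C.all}

lemma sigmaPart_mem (ha : C.IsAdjointPart f S σ τ) {t : ℝ} (ht : 0 ≤ t) :
    (C.sigmaPart σ τ t : E.D) ∈ S.MSigma :=
  Set.add_mem_add (starPart_mem_starSum fun j hj => ha.star_mem j hj t ht)
    (wedgePart_mem_wedgeSum fun j hj => ha.wedge_mem j hj t ht)

lemma coeff_tail (hS : S.Open) (ha : C.IsAdjointPart f S σ τ) {t : ℝ} (ht : 0 ≤ t) {s : ℕ}
    (hs : 1 ≤ s) {p : Fin C.n × ℕ} (hp : p ∈ C.all) :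
    C.coeff p (C.starPart σ s t + C.wedgePart τ s t : C.DS C.all) =
      if s ≤ p.2 then (if C.m p.1 = p.2 + 1 then C.coeff p (σ p.2 t) else C.coeff p (τ p.2 t))
      else 0 := by
  rw [Submodule.coe_add, starPart, wedgePart, Submodule.coe_sum, Submodule.coe_sum]
  refine C.coeff_sum_add_sum (g := fun j => (σ j t : E.D)) (h := fun j => (τ j t : E.D))
    (fun j hj => ?_) (fun j hj => ?_) hp
  · have hj' : j ∈ Finset.Icc 1 (ν - 1) := by rw [Finset.mem_Icc] at hj ⊢; omega
    exact (hS.2.2.1 j hj').1 (ha.star_mem j hj' t ht)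
  · have hj' : j ∈ Finset.Icc 1 (ν - 2) := by rw [Finset.mem_Icc] at hj ⊢; omega
    exact (hS.2.2.2 j hj').1 (ha.wedge_mem j hj' t ht)

lemma coeff_sigmaPart_zero (hS : S.Open) (ha : C.IsAdjointPart f S σ τ) {t : ℝ} (ht : 0 ≤ t)
    {p : Fin C.n × ℕ} (hp : p ∈ C.all) (hp0 : p.2 = 0) : C.coeff p (C.sigmaPart σ τ t) = 0 := by
  rw [sigmaPart, ha.coeff_tail hS ht le_rfl hp, if_neg (by omega)]

lemma P_star (hS : S.Open) (ha : C.IsAdjointPart f S σ τ) {t : ℝ} (ht : 0 ≤ t) {x1 u : E.D}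
    (h1 : x1 ∈ C.D1) (hu : u ∈ C.DS C.zero) {s : ℕ} (hs : s ∈ Finset.Icc 1 (ν - 1)) :
    C.P (C.star s) (x1 + u + C.sigmaPart σ τ t) = σ s t := by
  have hs' := Finset.mem_Icc.1 hs
  rw [C.P_congr (z := (σ s t : E.D)) fun p hp => ?_, C.P_eq_self (C.star_subset_all s)
    ((hS.2.2.1 s hs).1 (ha.star_mem s hs t ht))]
  have hp' := mem_star.1 hp
  have hpa := C.star_subset_all s hp
  rw [map_add, map_add, C.P1_eq_self_iff.1 (C.mem_D1_iff.1 h1) p hpa,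
    C.coeff_eq_zero C.zero_subset_all hpa (fun h' => by rw [mem_zero] at h'; omega) hu, sigmaPart,
    ha.coeff_tail hS ht le_rfl hpa, if_pos (by omega), if_pos (by omega), zero_add, zero_add, hp'.2]

lemma P_wedge (hS : S.Open) (ha : C.IsAdjointPart f S σ τ) {t : ℝ} (ht : 0 ≤ t) {x1 u : E.D}
    (h1 : x1 ∈ C.D1) (hu : u ∈ C.DS C.zero) {s : ℕ} (hs : s ∈ Finset.Icc 1 (ν - 2)) :
    C.P (C.wedge s) (x1 + u + C.sigmaPart σ τ t) = τ s t := by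
  have hs' := Finset.mem_Icc.1 hs
  rw [C.P_congr (z := (τ s t : E.D)) fun p hp => ?_, C.P_eq_self (C.wedge_subset_all s)
    ((hS.2.2.2 s hs).1 (ha.wedge_mem s hs t ht))]
  have hp' := mem_wedge.1 hp
  have hpa := C.wedge_subset_all s hp
  rw [map_add, map_add, C.P1_eq_self_iff.1 (C.mem_D1_iff.1 h1) p hpa,
    C.coeff_eq_zero C.zero_subset_all hpa (fun h' => by rw [mem_zero] at h'; omega) hu, sigmaPart,
    ha.coeff_tail hS ht le_rfl hpa, if_pos (by omega), if_neg (by omega), zero_add, zero_add, hp'.2]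

lemma hasDerivWithinAt_tail (ha : C.IsAdjointPart f S σ τ) {t : ℝ} (ht : 0 ≤ t) {s : ℕ}
    (hs : s ≤ ν - 2) :
    HasDerivWithinAt (fun t => C.starPart σ (s + 1) t + C.wedgePart τ (s + 1) t)
      (C.tailDeriv σ τ (s + 1) t) (Ici 0) t := by
  have h := (tailDeriv_contDiffOn hs
    (fun j hj => ha.star_contDiffOn j (by rw [Finset.mem_Icc] at hj ⊢; omega))
    (fun j hj => ha.wedge_contDiffOn j (by rw [Finset.mem_Icc] at hj ⊢; omega))).1
  exact (h.differentiableOn (by exact_mod_cast Nat.succ_ne_zero s) t ht).hasDerivWithinAt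

lemma continuousOn_tailDeriv (ha : C.IsAdjointPart f S σ τ) :
    ContinuousOn (C.tailDeriv σ τ 1) (Ici 0) :=
  (tailDeriv_contDiffOn (s := 0) (Nat.zero_le _)
    (fun j hj => ha.star_contDiffOn j (by rw [Finset.mem_Icc] at hj ⊢; omega))
    (fun j hj => ha.wedge_contDiffOn j (by rw [Finset.mem_Icc] at hj ⊢; omega))).2.continuousOn

lemma hasDerivWithinAt_sigmaPart (ha : C.IsAdjointPart f S σ τ) {t : ℝ} (ht : 0 ≤ t) :
    HasDerivWithinAt (C.sigmaPart σ τ) (C.tailDeriv σ τ 1 t) (Ici 0) t :=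
  ha.hasDerivWithinAt_tail ht (Nat.zero_le _)

lemma continuousOn_sigmaPart (ha : C.IsAdjointPart f S σ τ) :
    ContinuousOn (C.sigmaPart σ τ) (Ici 0) := fun _ ht =>
  (ha.hasDerivWithinAt_sigmaPart ht).continuousWithinAt

lemma hasDerivWithinAt_comp {h : ℝ → C.DS C.all} {h' : C.DS C.all} {J : Set ℝ} {t : ℝ}
    (hd : HasDerivWithinAt h h' J t) {F : Type*} [NormedAddCommGroup F] [NormedSpace 𝕜 F]
    [NormedSpace ℝ F] [IsScalarTower ℝ 𝕜 F] (T : E.D →ₗ[𝕜] F) :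
    HasDerivWithinAt (fun t => T (h t)) (T h') J t :=
  (C.restrictDS C.all T).hasFDerivAt.comp_hasDerivWithinAt t hd

lemma coeff_tailDeriv (hS : S.Open) (ha : C.IsAdjointPart f S σ τ) {t : ℝ} (ht : 0 ≤ t) {s : ℕ}
    (hs : s ≤ ν - 2) {p : Fin C.n × ℕ} (hp : p ∈ C.all) (hsp : s + 1 ≤ p.2) :
    C.coeff p (C.tailDeriv σ τ (s + 1) t) = C.coeff p (C.tailDeriv σ τ 1 t) := by
  have h1 := hasDerivWithinAt_comp (ha.hasDerivWithinAt_tail ht hs) (C.coeff p)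
  have h2 := hasDerivWithinAt_comp (ha.hasDerivWithinAt_sigmaPart ht) (C.coeff p)
  refine (uniqueDiffOn_Ici 0 t ht).eq_deriv _ h1 (h2.congr_of_mem (fun r hr => ?_) ht)
  rw [sigmaPart, ha.coeff_tail hS hr (by omega) hp, ha.coeff_tail hS hr le_rfl hp, if_pos hsp,
    if_pos (show 1 ≤ p.2 by omega)]

/-- The coordinates of order at least one of the equation `A x'_{2Σ} + B x = f(t, x)` hold for
`x = x₁ + x₂₀ + x_{2Σ}(t)`, whatever the values of `x₁` and `x₂₀` are. -/
lemma q_f_eq (hfs : C.HasStructure f) (hS : S.Open) (ha : C.IsAdjointPart f S σ τ) {t : ℝ}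
    (ht : 0 ≤ t) {x1 u : E.D} (h1 : x1 ∈ C.D1) (hu : u ∈ C.DS C.zero) {p : Fin C.n × ℕ}
    (hp : p ∈ C.all) (hp1 : 1 ≤ p.2) :
    C.q p.1 p.2 (f t (x1 + u + C.sigmaPart σ τ t)) =
      C.q p.1 p.2 (E.opA (C.tailDeriv σ τ 1 t)) + C.coeff p (C.sigmaPart σ τ t) := by
  have hp' := mem_all.1 hp
  have hm := C.m_le p.1
  have hstar : ∀ s, 1 ≤ s → ∑ j ∈ Finset.Icc s (ν - 1),
      C.P (C.star j) (x1 + u + C.sigmaPart σ τ t) = C.starPart σ s t := fun s hs => by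
    rw [starPart, Submodule.coe_sum]
    refine Finset.sum_congr rfl fun j hj => ha.P_star hS ht h1 hu ?_
    rw [Finset.mem_Icc] at hj ⊢; omega
  rw [sigmaPart, ha.coeff_tail hS ht le_rfl hp, if_pos hp1]
  by_cases h : C.m p.1 = p.2 + 1
  · have hs : p.2 ∈ Finset.Icc 1 (ν - 1) := Finset.mem_Icc.2 ⟨hp1, by omega⟩
    have hps : p ∈ C.star p.2 := mem_star.2 ⟨h, rfl⟩
    have he := (C.Fstar_eq_zero_iff f p.2 t ((hS.2.2.1 _ hs).1 (ha.star_mem _ hs t ht)) _).1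
      (ha.star_eq _ hs t ht) p hps
    rw [if_pos h, C.q_opA_of_eq h.symm, zero_add, ← sigmaPart, q_f_star hfs ht hp1 hps,
      hstar _ hp1, ← he, starPart, sum_Icc_eq_add (by omega)]
    rfl
  · have hs : p.2 ∈ Finset.Icc 1 (ν - 2) := Finset.mem_Icc.2 ⟨hp1, by omega⟩
    have hps : p ∈ C.wedge p.2 := mem_wedge.2 ⟨by omega, rfl⟩
    have hpn : (p.1, p.2 + 1) ∈ C.all := mem_all.2 (show p.2 + 1 < C.m p.1 by omega)
    have he := (C.Fwedge_eq_zero_iff f p.2 t ((hS.2.2.2 _ hs).1 (ha.wedge_mem _ hs t ht)) _ _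
      (C.P_mem _ _) (C.P_mem _ _)).1 (ha.wedge_eq _ hs t ht) p hps
    rw [coeff_star_add_wedge hpn rfl, ha.coeff_tailDeriv hS ht (by omega) hpn le_rfl] at he
    rw [if_neg h, C.q_opA_of_lt (by omega), ← sigmaPart, q_f_wedge hfs ht hp1 hps, hstar 1 le_rfl,
      ← he]
    have hwedge : ∑ j ∈ Finset.Icc p.2 (ν - 2),
        C.P (C.wedge j) (x1 + u + C.sigmaPart σ τ t) =
          (τ p.2 t : E.D) + C.wedgePart τ (p.2 + 1) t := by
      rw [wedgePart, Submodule.coe_sum, sum_Icc_eq_add (by omega), ha.P_wedge hS ht h1 hu hs]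
      refine congrArg _ (Finset.sum_congr rfl fun j hj => ha.P_wedge hS ht h1 hu ?_)
      rw [Finset.mem_Icc] at hj ⊢; omega
    rw [hwedge]
    ring

end IsAdjointPart

end CanonicalSystem

end

/-! ### The equation for `x₂₀` in the coordinates of `Y₁` -/

section

variable {𝕜 X Y : Type*} [RCLike 𝕜]
  [NormedAddCommGroup X] [NormedSpace 𝕜 X] [NormedAddCommGroup Y] [NormedSpace 𝕜 Y]

namespace CanonicalSystem

variable {E : OperatorPair 𝕜 X Y} {ν : ℕ} {C : CanonicalSystem E ν}

lemma sigma_subset_all : C.sigma ⊆ C.all := Finset.filter_subset _ _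

lemma MSigma_subset {S : C.Sets} (hS : S.Open) : S.MSigma ⊆ C.DS C.sigma := by
  rintro _ ⟨a, ha, b, hb, rfl⟩
  obtain ⟨g, hg, rfl⟩ := (Set.mem_finsetSum _ _ _).1 ha
  obtain ⟨h, hh, rfl⟩ := (Set.mem_finsetSum _ _ _).1 hb
  refine add_mem (Submodule.sum_mem _ fun j hj => C.DS_mono (fun p hp => ?_)
    ((hS.2.2.1 j hj).1 (hg hj))) (Submodule.sum_mem _ fun j hj => C.DS_mono (fun p hp => ?_)
    ((hS.2.2.2 j hj).1 (hh hj)))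
  · have hj' := Finset.mem_Icc.1 hj
    have hp' := mem_star.1 hp
    exact Finset.mem_filter.2 ⟨C.star_subset_all j hp, by omega⟩
  · have hj' := Finset.mem_Icc.1 hj
    have hp' := mem_wedge.1 hp
    exact Finset.mem_filter.2 ⟨C.wedge_subset_all j hp, by omega⟩

variable [NormedSpace ℝ X] [IsScalarTower ℝ 𝕜 X]

/-- What the right-hand side of the reduced differential equation is made of: the bounded inverse
`R` of `Ã`, and the components of order at least one, which depend on `t` only. -/
structure Reduction (f : ℝ → E.D → Y) (S : C.Sets) where
  R : Y →L[𝕜] E.D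
  Atilde_R : ∀ y, C.Atilde (R y) = y
  R_Atilde : ∀ x, R (C.Atilde x) = x
  σ : ℕ → ℝ → C.DS C.all
  τ : ℕ → ℝ → C.DS C.all
  isAdjointPart : C.IsAdjointPart f S σ τ

namespace Reduction

variable {f : ℝ → E.D → Y} {S : C.Sets} (r : C.Reduction f S)

/-- The component `x_{2Σ}(t)`. -/
def xs (t : ℝ) : C.DS C.all := C.sigmaPart r.σ r.τ t

/-- The derivative of `x_{2Σ}`. -/
def dxs (t : ℝ) : C.DS C.all := C.tailDeriv r.σ r.τ 1 t

/-- The element `x₁ + x₂₀ + x_{2Σ}(t)` with `x₁ = Ã⁻¹ w` and `x₂₀ = u`. -/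
def point (t : ℝ) (w : C.Y1) (u : C.DS C.zero) : E.D := r.R w + u + r.xs t

/-- The value of `F₂₀` at `x₁ = Ã⁻¹ w`, `x₂₀ = u` and the components of order at least one. -/
def F (t : ℝ) (w : C.Y1) (u : C.DS C.zero) : C.YS C.zero :=
  ⟨C.F20 f t (r.R w) u (r.xs t) (C.P (C.star 1) (r.dxs t) + C.P (C.wedge 1) (r.dxs t)),
    C.F20_mem f t u.2 _ _ _⟩

lemma xs_mem {t : ℝ} (ht : 0 ≤ t) : (r.xs t : E.D) ∈ S.MSigma := r.isAdjointPart.sigmaPart_mem ht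

lemma continuousOn_xs : ContinuousOn r.xs (Ici 0) := r.isAdjointPart.continuousOn_sigmaPart

lemma continuousOn_dxs : ContinuousOn r.dxs (Ici 0) := r.isAdjointPart.continuousOn_tailDeriv

lemma R_mem_D1 (w : C.Y1) : r.R w ∈ C.D1 := by
  rw [mem_D1_iff]
  refine C.Atilde_injective ?_
  rw [← C.Q1_Atilde, r.Atilde_R, C.mem_Y1_iff.1 w.2]

lemma mem_preimageD1_iff {Ω : Set C.Y1} {x : E.D} :
    x ∈ C.preimageD1 Ω ↔ ∃ w ∈ Ω, r.R w = x := by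
  constructor
  · rintro ⟨-, w, hw, h⟩
    exact ⟨w, hw, by rw [← h, r.R_Atilde]⟩
  · rintro ⟨w, hw, rfl⟩
    exact ⟨r.R_mem_D1 w, w, hw, r.Atilde_R _⟩

lemma R_mem_M1 {w : C.Y1} (hw : w ∈ S.M1t) : r.R w ∈ S.M1 :=
  r.mem_preimageD1_iff.2 ⟨w, hw, rfl⟩

lemma F_eq_zero_iff (t : ℝ) (w : C.Y1) (u : C.DS C.zero) :
    r.F t w u = 0 ↔
      C.F20 f t (r.R w) u (r.xs t) (C.P (C.star 1) (r.dxs t) + C.P (C.wedge 1) (r.dxs t)) = 0 := by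
  rw [F, Submodule.mk_eq_zero]

variable [NormedSpace ℝ Y] [IsScalarTower ℝ 𝕜 Y]

/-- `R` as a real-linear map from `Y₁` to `D₁`. -/
def R1 : C.Y1 →L[ℝ] C.D1 :=
  ((r.R.comp C.Y1.subtypeL).codRestrict C.D1 r.R_mem_D1).restrictScalars ℝ

@[simp]
lemma coe_R1 (w : C.Y1) : (r.R1 w : E.D) = r.R w := rfl

/-- A continuous partial derivative of a part of `f`, in the coordinates `(w, x₂₀)`. -/
lemma exists_partialDeriv (hS : S.Open) {T : Y →L[𝕜] Y} (hT : C.ContinuousPartialDeriv f S T) :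
    ∃ H : ℝ × (C.Y1 × C.DS C.zero) → (C.Y1 × C.DS C.zero) →L[ℝ] Y,
      (∀ t, 0 ≤ t → ∀ w ∈ S.M1t, ∀ u : C.DS C.zero, (u : E.D) ∈ S.M20 →
        HasFDerivAt (fun q : C.Y1 × C.DS C.zero => T (f t (r.point t q.1 q.2)))
          (H (t, (w, u))) (w, u)) ∧
      ContinuousOn H (Ici 0 ×ˢ (S.M1t ×ˢ {u : C.DS C.zero | (u : E.D) ∈ S.M20})) := by
  obtain ⟨G, hG, hGc⟩ := hT
  obtain ⟨π, hπ⟩ := C.exists_projection (C.DS_mono (sigma_subset_all (C := C)))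
  have hπ' : ∀ t, 0 ≤ t → (π (r.xs t) : E.D) = r.xs t := fun t ht => by
    rw [hπ _ (MSigma_subset hS (r.xs_mem ht))]
  let A : (C.Y1 × C.DS C.zero) →L[ℝ] (C.D1 × C.DS C.zero × C.DS C.sigma) :=
    (r.R1.comp (ContinuousLinearMap.fst ℝ _ _)).prod ((ContinuousLinearMap.snd ℝ _ _).prod 0)
  let a : ℝ × (C.Y1 × C.DS C.zero) → C.D1 × C.DS C.zero × C.DS C.sigma :=
    fun q => (r.R1 q.2.1, q.2.2, π (r.xs q.1))
  refine ⟨fun q => (G (q.1, a q)).comp A, fun t ht w hw u hu => ?_, ?_⟩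
  · have ha : HasFDerivAt (fun q : C.Y1 × C.DS C.zero => a (t, q)) A (w, u) := by
      have h1 := (r.R1.comp (ContinuousLinearMap.fst ℝ C.Y1 (C.DS C.zero))).hasFDerivAt
        (x := (w, u))
      have h2 := (ContinuousLinearMap.snd ℝ C.Y1 (C.DS C.zero)).hasFDerivAt (x := (w, u))
      exact h1.prodMk (h2.prodMk (hasFDerivAt_const (π (r.xs t)) _))
    have h := (hG t ht (a (t, (w, u))) (r.R_mem_M1 hw) hu
      (by change (π (r.xs t) : E.D) ∈ _; rw [hπ' t ht]; exact r.xs_mem ht)).comp (w, u) ha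
    refine h.congr_of_eventuallyEq (Eventually.of_forall fun q => ?_)
    simp only [point, Function.comp_apply, a, hπ' t ht, coe_R1]
  · refine ContinuousOn.clm_comp (hGc.comp (t := {p | 0 ≤ p.1 ∧ (p.2.1 : E.D) ∈ S.M1 ∧
      (p.2.2.1 : E.D) ∈ S.M20 ∧ (p.2.2.2 : E.D) ∈ S.MSigma}) ?_ ?_) continuousOn_const
    · refine continuousOn_fst.prodMk (ContinuousOn.prodMk ?_ (ContinuousOn.prodMk ?_ ?_))
      · exact (by fun_prop : Continuous fun q : ℝ × (C.Y1 × C.DS C.zero) =>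
          r.R1 q.2.1).continuousOn
      · fun_prop
      · exact π.continuous.comp_continuousOn
          (r.continuousOn_xs.comp continuousOn_fst fun q hq => hq.1)
    · rintro ⟨t, w, u⟩ ⟨ht, hw, hu⟩
      exact ⟨ht, r.R_mem_M1 hw, hu, by
        change (π (r.xs t) : E.D) ∈ _; rw [hπ' t ht]; exact r.xs_mem ht⟩

/-- Local Lipschitz continuity of a part of `f` in the coordinates `(w, x₂₀)`. -/
lemma exists_lipschitz (hS : S.Open) {T : Y →L[𝕜] Y}
    (hT : C.LocallyLipschitzPart f S T ∨ C.ContinuousPartialDeriv f S T) {t₀ : ℝ} (ht₀ : 0 ≤ t₀)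
    {w₀ : C.Y1} (hw₀ : w₀ ∈ S.M1t) {b : C.DS C.zero} (hb : (b : E.D) ∈ S.M20) :
    ∃ ε > 0, ∃ K : ℝ, 0 ≤ K ∧ ∀ t, 0 ≤ t → |t - t₀| < ε →
      ∀ w ∈ S.M1t, ‖w - w₀‖ < ε → ∀ w' ∈ S.M1t, ‖w' - w₀‖ < ε →
      ∀ u : C.DS C.zero, (u : E.D) ∈ S.M20 → ‖u - b‖ < ε →
      ∀ u' : C.DS C.zero, (u' : E.D) ∈ S.M20 → ‖u' - b‖ < ε →
        ‖T (f t (r.point t w u)) - T (f t (r.point t w' u'))‖ ≤ K * (‖w - w'‖ + ‖u - u'‖) := by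
  rcases hT with hT | hT
  · obtain ⟨ε, hε, L, hL⟩ := hT t₀ ht₀ _ (r.R_mem_M1 hw₀) b hb _ (r.xs_mem ht₀)
    obtain ⟨ε₁, hε₁, hxs⟩ := Metric.continuousWithinAt_iff.1 (r.continuousOn_xs t₀ ht₀) ε hε
    have hR : ∀ w w' : C.Y1, ‖r.R w - r.R w'‖ ≤ ‖r.R‖ * ‖w - w'‖ := fun w w' => by
      rw [← map_sub]; exact r.R.le_opNorm _
    have hRε : ∀ w : C.Y1, ‖w - w₀‖ < min (min ε ε₁) (ε / (‖r.R‖ + 1)) →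
        ‖r.R w - r.R w₀‖ < ε := fun w hw => by
      have h1 := (lt_div_iff₀ (by positivity)).1 (hw.trans_le (min_le_right _ _))
      have h2 := hR w w₀
      have h3 := norm_nonneg (w - w₀)
      nlinarith
    refine ⟨min (min ε ε₁) (ε / (‖r.R‖ + 1)), by positivity, |L| * (‖r.R‖ + 1), by positivity,
      fun t ht htt w hw hww w' hw' hww' u hu hub u' hu' hub' => ?_⟩
    have h := hL t ht (htt.trans_le ((min_le_left _ _).trans (min_le_left _ _))) _ (r.xs_mem ht)
      (by
        have := hxs ht (by
          rw [Real.dist_eq]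
          exact htt.trans_le ((min_le_left _ _).trans (min_le_right _ _)))
        rwa [dist_eq_norm] at this) _ (r.R_mem_M1 hw) (hRε w hww)
      u hu (hub.trans_le ((min_le_left _ _).trans (min_le_left _ _))) _ (r.R_mem_M1 hw')
      (hRε w' hww') u' hu' (hub'.trans_le ((min_le_left _ _).trans (min_le_left _ _)))
    refine h.trans ?_
    have h1 : ‖r.R w - r.R w'‖ + ‖(u : E.D) - u'‖ ≤ (‖r.R‖ + 1) * (‖w - w'‖ + ‖u - u'‖) := by
      have h2 := hR w w'
      have h3 := norm_nonneg (w - w')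
      have h4 := mul_nonneg (norm_nonneg r.R) (norm_nonneg (u - u'))
      have h5 : ‖(u : E.D) - u'‖ = ‖u - u'‖ := rfl
      rw [h5]; linarith
    calc L * (‖r.R w - r.R w'‖ + ‖(u : E.D) - u'‖)
        ≤ |L| * (‖r.R w - r.R w'‖ + ‖(u : E.D) - u'‖) := by
          gcongr; exact le_abs_self L
      _ ≤ |L| * ((‖r.R‖ + 1) * (‖w - w'‖ + ‖u - u'‖)) := by gcongr
      _ = _ := by ring
  · obtain ⟨H, hH, hHc⟩ := r.exists_partialDeriv hS hT
    have hHn : ContinuousOn (fun q => ‖H q‖)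
        (Ici 0 ×ˢ (S.M1t ×ˢ {u : C.DS C.zero | (u : E.D) ∈ S.M20})) :=
      ContinuousOn.norm (f := H) hHc
    obtain ⟨ε₁, hε₁, h1⟩ := Metric.continuousWithinAt_iff.1
      (hHn (t₀, (w₀, b)) ⟨ht₀, hw₀, hb⟩) 1 one_pos
    obtain ⟨ε₂, hε₂, h2⟩ := Metric.isOpen_iff.1 (hS.1.prod hS.2.1.2) (w₀, b) ⟨hw₀, hb⟩
    refine ⟨min ε₁ ε₂, by positivity, ‖H (t₀, (w₀, b))‖ + 1, by positivity,
      fun t ht htt w hw hww w' hw' hww' u hu hub u' hu' hub' => ?_⟩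
    have hball : ∀ {w : C.Y1} {u : C.DS C.zero}, ‖w - w₀‖ < min ε₁ ε₂ → ‖u - b‖ < min ε₁ ε₂ →
        (w, u) ∈ Metric.ball (w₀, b) (min ε₁ ε₂) := fun {w u} hw hu => by
      rw [Metric.mem_ball, Prod.dist_eq, dist_eq_norm, dist_eq_norm]
      exact max_lt hw hu
    have key := Convex.norm_image_sub_le_of_norm_hasFDerivWithin_le
      (f := fun q : C.Y1 × C.DS C.zero => T (f t (r.point t q.1 q.2)))
      (f' := fun q => H (t, q)) (C := ‖H (t₀, (w₀, b))‖ + 1)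
      (s := Metric.ball (w₀, b) (min ε₁ ε₂)) (fun q hq => ?_) (fun q hq => ?_)
      (convex_ball _ _) (hball hww' hub') (hball hww hub)
    · refine key.trans (mul_le_mul_of_nonneg_left ?_ (by positivity))
      rw [Prod.mk_sub_mk, Prod.norm_mk]
      exact max_le (le_add_of_nonneg_right (norm_nonneg _))
        (le_add_of_nonneg_left (norm_nonneg _))
    · have hq' := h2 (Metric.ball_subset_ball (min_le_right _ _) hq)
      exact (hH t ht q.1 hq'.1 q.2 hq'.2).hasFDerivWithinAt
    · have hq' := h2 (Metric.ball_subset_ball (min_le_right _ _) hq)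
      have h3 := h1 (x := (t, q)) ⟨ht, hq'.1, hq'.2⟩ (by
        rw [Prod.dist_eq, Real.dist_eq]
        exact max_lt (htt.trans_le (min_le_left _ _))
          ((Metric.mem_ball.1 hq).trans_le (min_le_left _ _)))
      rw [Real.dist_eq] at h3
      linarith [(abs_lt.1 h3).2]

/-- Near a solution of `F₂₀ = 0` the map `F₂₀` is, as a function of `x₂₀`, uniformly close to an
isomorphism. -/
lemma exists_approximatesLinearOn (hS : C.SolvabilityConditions f S) {t₀ : ℝ} (ht₀ : 0 ≤ t₀)
    {w₀ : C.Y1} (hw₀ : w₀ ∈ S.M1t) {b : C.DS C.zero} (hb : (b : E.D) ∈ S.M20)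
    (hF : r.F t₀ w₀ b = 0) :
    ∃ (L : C.DS C.zero ≃L[ℝ] C.YS C.zero) (c : ℝ≥0) (ε : ℝ),
      c * ‖(L.symm : C.YS C.zero →L[ℝ] C.DS C.zero)‖ < 1 ∧ 0 < ε ∧
      ∀ t, 0 ≤ t → |t - t₀| < ε → ∀ w ∈ S.M1t, ‖w - w₀‖ < ε →
        ApproximatesLinearOn (r.F t w) (L : C.DS C.zero →L[ℝ] C.YS C.zero)
          (Metric.ball b ε) c := by
  have hF' := (r.F_eq_zero_iff _ _ _).1 hF
  rcases hS.lipschitz_or_differentiable with h | h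
  · obtain ⟨δ, hδ, ε, hε, Z, k, hk, hZ⟩ := h.2.2 t₀ ht₀ _ (r.R_mem_M1 hw₀) b hb _
      (r.xs_mem ht₀) _ (C.P_mem _ _) _ (C.P_mem _ _) hF'
    have hc : ∀ T : E.D →ₗ[𝕜] E.D, ContinuousOn (fun t => T (r.dxs t)) (Ici 0) := fun T =>
      (C.restrictDS C.all T).continuous.comp_continuousOn r.continuousOn_dxs
    obtain ⟨δ₁, hδ₁, h1⟩ := Metric.continuousWithinAt_iff.1 (r.continuousOn_xs t₀ ht₀) δ hδ
    obtain ⟨δ₂, hδ₂, h2⟩ := Metric.continuousWithinAt_iff.1 (hc (C.P (C.star 1)) t₀ ht₀) δ hδ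
    obtain ⟨δ₃, hδ₃, h3⟩ := Metric.continuousWithinAt_iff.1 (hc (C.P (C.wedge 1)) t₀ ht₀) δ hδ
    obtain ⟨δ₄, hδ₄, h4⟩ := Metric.continuousAt_iff.1
      (r.R1.continuous.continuousAt (x := w₀)) δ hδ
    refine ⟨Z, k.toNNReal, min ε (min δ (min (min δ₁ δ₂) (min δ₃ δ₄))), ?_, by positivity,
      fun t ht htt w hw hww u hu v hv => ?_⟩
    -- a negative constant `k` is replaced by zero
    · rcases le_total k 0 with hk0 | hk0
      · rw [Real.toNNReal_of_nonpos hk0]; simp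
      · rw [Real.coe_toNNReal _ hk0]; exact hk
    · simp only [lt_min_iff] at htt hww
      have := hZ t ht htt.2.1 (r.R w) (r.R_mem_D1 w)
        (by have := h4 (x := w) (by rw [dist_eq_norm]; exact hww.2.2.2.2)
            rwa [dist_eq_norm] at this) _ (MSigma_subset hS.isOpen (r.xs_mem ht))
        (by have := h1 ht (by rw [Real.dist_eq]; exact htt.2.2.1.1)
            rwa [dist_eq_norm] at this) _ (C.P_mem _ _)
        (by have := h2 ht (by rw [Real.dist_eq]; exact htt.2.2.1.2)
            rwa [dist_eq_norm] at this) _ (C.P_mem _ _)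
        (by have := h3 ht (by rw [Real.dist_eq]; exact htt.2.2.2.1)
            rwa [dist_eq_norm] at this) u v
        (by rw [Metric.mem_ball, dist_eq_norm] at hu
            exact hu.trans_le (min_le_left _ _))
        (by rw [Metric.mem_ball, dist_eq_norm] at hv
            exact hv.trans_le (min_le_left _ _))
      refine le_trans ?_ (this.trans
        (mul_le_mul_of_nonneg_right (Real.le_coe_toNNReal k) (norm_nonneg _)))
      exact le_of_eq rfl
  · obtain ⟨H, hH, hHc⟩ := r.exists_partialDeriv hS.isOpen h.2.1
    let Qh : Y →L[ℝ] C.YS C.zero :=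
      ((C.Q C.zero).codRestrict (C.YS C.zero) (C.Q_mem C.zero)).restrictScalars ℝ
    have hQh : ∀ y (hy : y ∈ C.YS C.zero), Qh y = ⟨y, hy⟩ := fun y hy =>
      Subtype.ext (C.Q_eq_self C.zero_subset_all hy)
    let D : (ℝ × C.Y1) × C.DS C.zero → C.DS C.zero →L[ℝ] C.YS C.zero := fun q =>
      Qh.comp ((H (q.1.1, (q.1.2, q.2))).comp (ContinuousLinearMap.inr ℝ _ _) -
        C.restrictDS C.zero E.opB)
    have hDd : ∀ l ∈ Ici (0 : ℝ) ×ˢ S.M1t, ∀ u ∈ {u : C.DS C.zero | (u : E.D) ∈ S.M20},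
        HasFDerivAt (r.F l.1 l.2) (D (l, u)) u := by
      rintro ⟨t, w⟩ ⟨ht, hw⟩ u hu
      have h1 : HasFDerivAt (fun u : C.DS C.zero => C.Q C.zero (f t (r.point t w u)))
          ((H (t, (w, u))).comp (ContinuousLinearMap.inr ℝ _ _)) u :=
        HasFDerivAt.comp u (hH t ht w hw u hu)
          (hasFDerivAt_prodMk_right w u)
      have h2 := Qh.hasFDerivAt.comp u
        ((h1.sub (C.restrictDS C.zero E.opB).hasFDerivAt).sub_const
          (C.Q C.zero (E.opA (C.P (C.star 1) (r.dxs t) + C.P (C.wedge 1) (r.dxs t)))))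
      refine h2.congr_of_eventuallyEq (Eventually.of_forall fun v => ?_)
      exact (hQh _ (r.F t w v).2).symm
    have hDc : ContinuousOn D ((Ici (0 : ℝ) ×ˢ S.M1t) ×ˢ
        {u : C.DS C.zero | (u : E.D) ∈ S.M20}) := by
      refine continuousOn_const.clm_comp (ContinuousOn.sub (ContinuousOn.clm_comp
        (hHc.comp (by fun_prop) ?_) continuousOn_const) continuousOn_const)
      rintro ⟨⟨t, w⟩, u⟩ ⟨⟨ht, hw⟩, hu⟩
      exact ⟨ht, hw, hu⟩
    obtain ⟨L, hL⟩ := h.2.2 t₀ ht₀ _ (r.R_mem_M1 hw₀) b hb _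
      (r.xs_mem ht₀) _ (C.P_mem _ _) _ (C.P_mem _ _) hF'
    have hLD : D ((t₀, w₀), b) = (L : C.DS C.zero →L[ℝ] C.YS C.zero) := by
      refine (hDd (t₀, w₀) ⟨ht₀, hw₀⟩ b hb).unique ?_
      have h1 := Qh.hasFDerivAt.comp b hL
      have h2 : HasFDerivAt (r.F t₀ w₀) _ b := h1.congr_of_eventuallyEq
        (Eventually.of_forall fun v => (hQh _ (r.F t₀ w₀ v).2).symm)
      refine h2.congr_fderiv ?_
      ext u
      exact congrArg Subtype.val (hQh _ (L u).2)
    obtain ⟨c, hc, hcL⟩ := exists_small_bound L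
    obtain ⟨ε, hε, happ⟩ := eventually_approximatesLinearOn (s := Ici (0 : ℝ) ×ˢ S.M1t)
      (Φ := fun l => r.F l.1 l.2) hS.isOpen.2.1.2 hDd hb
      (hDc ((t₀, w₀), b) ⟨⟨ht₀, hw₀⟩, hb⟩) hc
    refine ⟨L, c, ε, hcL, hε, fun t ht htt w hw hww => ?_⟩
    have := happ (t, w) ⟨ht, hw⟩ (by
      rw [Prod.dist_eq, Real.dist_eq, dist_eq_norm]; exact max_lt htt hww)
    rwa [hLD] at this

end Reduction

end CanonicalSystem

end

/-! ### The reduced differential equation -/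

section

variable {𝕜 X Y : Type*} [RCLike 𝕜]
  [NormedAddCommGroup X] [NormedSpace 𝕜 X] [NormedAddCommGroup Y] [NormedSpace 𝕜 Y]

namespace CanonicalSystem

variable {E : OperatorPair 𝕜 X Y} {ν : ℕ} {C : CanonicalSystem E ν}
lemma continuousOn_toY1 {α : Type*} [TopologicalSpace α] {s : Set α} {y : α → Y}
    (hy : ContinuousOn y s) : ContinuousOn (fun x => C.toY1 (y x)) s :=
  continuousOn_iff_continuous_domRestrict.2
    ((C.Q1.continuous.comp (continuousOn_iff_continuous_domRestrict.1 hy)).subtype_mk _)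

variable [NormedSpace ℝ X] [IsScalarTower ℝ 𝕜 X]

namespace Reduction

variable {f : ℝ → E.D → Y} {S : C.Sets} (r : C.Reduction f S)

/-- `x₂₀ = η(t, w)` is the unique solution in `M₂₀` of `F₂₀ = 0`, and it is continuous. -/
structure IsRoot (η : ℝ → C.Y1 → C.DS C.zero) : Prop where
  mem : ∀ t, 0 ≤ t → ∀ w ∈ S.M1t, (η t w : E.D) ∈ S.M20
  F_eq_zero : ∀ t, 0 ≤ t → ∀ w ∈ S.M1t, r.F t w (η t w) = 0
  eq_of_F_eq_zero : ∀ t, 0 ≤ t → ∀ w ∈ S.M1t, ∀ u : C.DS C.zero, (u : E.D) ∈ S.M20 →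
    r.F t w u = 0 → u = η t w
  continuousOn : ContinuousOn (fun p : ℝ × C.Y1 => η p.1 p.2) (Ici 0 ×ˢ S.M1t)

/-- The right-hand side of the reduced equation `w' = Q₁ f(t, x) - Q₁ B Ã⁻¹ w` in `Y₁`. -/
def field (η : ℝ → C.Y1 → C.DS C.zero) (t : ℝ) (w : C.Y1) : C.Y1 :=
  C.toY1 (f t (r.point t w (η t w))) - C.toY1 (E.opB (r.R w))

lemma continuousOn_f_point (hf : ContinuousOn (fun p : ℝ × E.D => f p.1 p.2) {p | 0 ≤ p.1})
    {α : Type*} [TopologicalSpace α] {s : Set α} {a : α → ℝ} {w : α → C.Y1}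
    {u : α → C.DS C.zero} (ha : ContinuousOn a s) (ha0 : ∀ x ∈ s, 0 ≤ a x)
    (hw : ContinuousOn w s) (hu : ContinuousOn u s) :
    ContinuousOn (fun x => r.point (a x) (w x) (u x)) s ∧
      ContinuousOn (fun x => f (a x) (r.point (a x) (w x) (u x))) s := by
  have h : ContinuousOn (fun x => r.point (a x) (w x) (u x)) s := by
    refine ContinuousOn.add (ContinuousOn.add ?_ ?_) ?_
    · exact r.R.continuous.comp_continuousOn (continuous_subtype_val.comp_continuousOn hw)
    · exact continuous_subtype_val.comp_continuousOn hu
    · exact continuous_subtype_val.comp_continuousOn (r.continuousOn_xs.comp ha ha0)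
  exact ⟨h, hf.comp (ha.prodMk h) ha0⟩

variable [NormedSpace ℝ Y] [IsScalarTower ℝ 𝕜 Y]

lemma continuousOn_F (hf : ContinuousOn (fun p : ℝ × E.D => f p.1 p.2) {p | 0 ≤ p.1})
    (u : C.DS C.zero) : ContinuousOn (fun p : ℝ × C.Y1 => r.F p.1 p.2 u) (Ici 0 ×ˢ S.M1t) := by
  have h1 := (r.continuousOn_f_point hf (s := Ici (0 : ℝ) ×ˢ S.M1t) (u := fun _ => u)
    continuousOn_fst (fun p hp => hp.1) continuousOn_snd continuousOn_const).2
  have h2 : ContinuousOn (fun p : ℝ × C.Y1 => C.Q C.zero (E.opA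
      (C.P (C.star 1) (r.dxs p.1) + C.P (C.wedge 1) (r.dxs p.1)))) (Ici 0 ×ˢ S.M1t) :=
    (C.restrictDS C.all ((C.Q C.zero).toLinearMap.comp (E.opA.comp
      (C.P (C.star 1) + C.P (C.wedge 1))))).continuous.comp_continuousOn
        (r.continuousOn_dxs.comp continuousOn_fst fun p hp => hp.1)
  have h3 : ContinuousOn (fun p : ℝ × C.Y1 => (r.F p.1 p.2 u : Y)) (Ici 0 ×ˢ S.M1t) :=
    (((C.Q C.zero).continuous.comp_continuousOn h1).sub continuousOn_const).sub h2
  exact Topology.IsInducing.subtypeVal.continuousOn_iff.2 h3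

theorem exists_isRoot (hS : C.SolvabilityConditions f S)
    (hf : ContinuousOn (fun p : ℝ × E.D => f p.1 p.2) {p | 0 ≤ p.1}) : ∃ η, r.IsRoot η := by
  have hex : ∀ t, 0 ≤ t → ∀ w ∈ S.M1t, ∃ u : C.DS C.zero, (u : E.D) ∈ S.M20 ∧ r.F t w u = 0 ∧
      ∀ v : C.DS C.zero, (v : E.D) ∈ S.M20 → r.F t w v = 0 → v = u := fun t ht w hw => by
    obtain ⟨u, ⟨hu, hu0⟩, huniq⟩ := hS.uniqueSolvability.2.2 t ht _ (r.R_mem_M1 hw) _ (r.xs_mem ht)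
      _ (C.P_mem _ (r.dxs t)) _ (C.P_mem _ (r.dxs t))
    exact ⟨⟨u, hS.isOpen.2.1.1 hu⟩, hu, (r.F_eq_zero_iff _ _ _).2 hu0, fun v hv hv0 =>
      Subtype.ext (huniq v ⟨hv, (r.F_eq_zero_iff _ _ _).1 hv0⟩)⟩
  choose! η hη hη0 hηu using hex
  refine ⟨η, hη, hη0, fun t ht w hw u hu hu0 => hηu t ht w hw u hu hu0, ?_⟩
  rintro ⟨t₀, w₀⟩ ⟨ht₀, hw₀⟩
  obtain ⟨L, c, ε, hc, hε, happ⟩ := r.exists_approximatesLinearOn hS ht₀ hw₀ (hη t₀ ht₀ w₀ hw₀)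
    (hη0 t₀ ht₀ w₀ hw₀)
  refine continuousWithinAt_of_unique_zero (M := {u : C.DS C.zero | (u : E.D) ∈ S.M20})
    (Φ := fun l : ℝ × C.Y1 => r.F l.1 l.2) (s := Ici 0 ×ˢ S.M1t) (l₀ := (t₀, w₀))
    (η := fun l => η l.1 l.2) ⟨ht₀, hw₀⟩ hS.isOpen.2.1.2
    (fun l hl => ⟨hη l.1 hl.1 l.2 hl.2, hη0 l.1 hl.1 l.2 hl.2⟩)
    (fun l hl u hu hu0 => hηu l.1 hl.1 l.2 hl.2 u hu hu0)
    (r.continuousOn_F hf _ (t₀, w₀) ⟨ht₀, hw₀⟩) L hc hε ?_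
  filter_upwards [self_mem_nhdsWithin, mem_nhdsWithin_of_mem_nhds
    (Metric.ball_mem_nhds (t₀, w₀) hε)] with l hl hlb
  rw [Metric.mem_ball, Prod.dist_eq, max_lt_iff, Real.dist_eq, dist_eq_norm] at hlb
  exact happ l.1 hl.1 hlb.1 l.2 hl.2 hlb.2

theorem locallyLipschitzField [CompleteSpace Y] (hS : C.SolvabilityConditions f S)
    (hf : ContinuousOn (fun p : ℝ × E.D => f p.1 p.2) {p | 0 ≤ p.1})
    {η : ℝ → C.Y1 → C.DS C.zero} (hη : r.IsRoot η) :
    LocallyLipschitzField (r.field η) S.M1t where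
  isOpen := hS.isOpen.1
  continuousOn := by
    have h1 := (r.continuousOn_f_point hf (s := Ici (0 : ℝ) ×ˢ S.M1t)
      continuousOn_fst (fun p hp => hp.1) continuousOn_snd hη.continuousOn).2
    refine (continuousOn_toY1 h1).sub (continuousOn_toY1 ?_)
    exact ((E.continuous_opB_comp r.R).comp (continuous_subtype_val.comp
      continuous_snd)).continuousOn
  lipschitz t₀ ht₀ w₀ hw₀ := by
    have hQ1 : C.LocallyLipschitzPart f S C.Q1 ∨ C.ContinuousPartialDeriv f S C.Q1 :=
      hS.lipschitz_or_differentiable.imp (fun h => h.1) fun h => h.1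
    have hQ0 : C.LocallyLipschitzPart f S (C.Q C.zero) ∨
        C.ContinuousPartialDeriv f S (C.Q C.zero) :=
      hS.lipschitz_or_differentiable.imp (fun h => h.2.1) fun h => h.2.1
    obtain ⟨ε₁, hε₁, K₁, hK₁, h1⟩ := r.exists_lipschitz hS.isOpen hQ1 ht₀ hw₀
      (hη.mem t₀ ht₀ w₀ hw₀)
    obtain ⟨ε₂, hε₂, K₂, hK₂, h2⟩ := r.exists_lipschitz hS.isOpen hQ0 ht₀ hw₀
      (hη.mem t₀ ht₀ w₀ hw₀)
    obtain ⟨L, c, ε₃, hc, hε₃, happ⟩ := r.exists_approximatesLinearOn hS ht₀ hw₀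
      (hη.mem t₀ ht₀ w₀ hw₀) (hη.F_eq_zero t₀ ht₀ w₀ hw₀)
    have hε₁' : min ε₁ (min ε₂ ε₃) ≤ ε₁ := min_le_left _ _
    have hε₂' : min ε₁ (min ε₂ ε₃) ≤ ε₂ := (min_le_right _ _).trans (min_le_left _ _)
    have hε₃' : min ε₁ (min ε₂ ε₃) ≤ ε₃ := (min_le_right _ _).trans (min_le_right _ _)
    obtain ⟨δ, hδ, K₃, h3⟩ := exists_lipschitz_of_unique_zero
      (M := {u : C.DS C.zero | (u : E.D) ∈ S.M20}) (Φ := r.F) (η := η) (K := K₂)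
      (fun t ht w hw => ⟨hη.mem t ht w hw, hη.F_eq_zero t ht w hw⟩)
      (hη.continuousOn (t₀, w₀) ⟨ht₀, hw₀⟩) L hc (r := min ε₁ (min ε₂ ε₃)) (by positivity)
      (fun t ht htt w hw hww => (happ t ht (htt.trans_le hε₃') w hw
        (hww.trans_le hε₃')).mono_set (Metric.ball_subset_ball hε₃'))
      (fun t ht htt w hw hww w' hw' hww' u hu huu => by
        have h := h2 t ht (htt.trans_le hε₂') w hw (hww.trans_le hε₂') w' hw'
          (hww'.trans_le hε₂') u hu (huu.trans_le hε₂') u hu (huu.trans_le hε₂')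
        rw [sub_self, norm_zero, add_zero] at h
        refine le_trans (le_of_eq ?_) h
        rw [Submodule.coe_norm, Submodule.coe_sub]
        simp only [F, F20, point]
        congr 1
        abel)
    let B : Y →L[𝕜] Y := C.Q1.comp ⟨E.opB.comp r.R.toLinearMap, E.continuous_opB_comp r.R⟩
    refine ⟨min δ ε₁, by positivity, (K₁ * (1 + |K₃|) + ‖B‖).toNNReal, fun t ht htt => ?_⟩
    refine LipschitzOnWith.of_dist_le_mul fun w hw w' hw' => ?_
    rw [Real.coe_toNNReal _ (by positivity), dist_eq_norm, dist_eq_norm]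
    have hwb := hw.1
    have hwb' := hw'.1
    rw [Metric.mem_ball, dist_eq_norm, lt_min_iff] at hwb hwb'
    rw [lt_min_iff] at htt
    obtain ⟨h4, h5⟩ := h3 t ht htt.1 w hw.2 hwb.1
    obtain ⟨h4', -⟩ := h3 t ht htt.1 w' hw'.2 hwb'.1
    have h6 := h1 t ht htt.2 w hw.2 hwb.2 w' hw'.2 hwb'.2 (η t w) (hη.mem t ht w hw.2)
      (h4.trans_le hε₁') (η t w') (hη.mem t ht w' hw'.2) (h4'.trans_le hε₁')
    have h7 : ‖η t w - η t w'‖ ≤ |K₃| * ‖w - w'‖ := (h5 w' hw'.2 hwb'.1).trans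
      (mul_le_mul_of_nonneg_right (le_abs_self _) (norm_nonneg _))
    have h8 : ((r.field η t w - r.field η t w' : C.Y1) : Y) =
        (C.Q1 (f t (r.point t w (η t w))) - C.Q1 (f t (r.point t w' (η t w')))) -
          B (w - w' : C.Y1) := by
      have : B (w - w' : C.Y1) = C.Q1 (E.opB (r.R w)) - C.Q1 (E.opB (r.R w')) := by
        rw [Submodule.coe_sub, map_sub]; rfl
      rw [this]
      simp only [field, toY1, Submodule.coe_sub]
      abel
    rw [Submodule.coe_norm, h8]
    calc _ ≤ K₁ * (‖w - w'‖ + ‖η t w - η t w'‖) + ‖B‖ * ‖w - w'‖ :=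
          (norm_sub_le _ _).trans (add_le_add h6 (B.le_opNorm _))
      _ ≤ K₁ * (‖w - w'‖ + |K₃| * ‖w - w'‖) + ‖B‖ * ‖w - w'‖ := by gcongr
      _ = _ := by ring

end Reduction

end CanonicalSystem

end

/-! ### Equivalence with the reduced equation -/

section

variable {𝕜 X Y : Type*} [RCLike 𝕜]
  [NormedAddCommGroup X] [NormedSpace 𝕜 X] [NormedAddCommGroup Y] [NormedSpace 𝕜 Y]

namespace CanonicalSystem

variable {E : OperatorPair 𝕜 X Y} {ν : ℕ} {C : CanonicalSystem E ν}
lemma hasDerivWithinAt_q [NormedSpace ℝ Y] [IsScalarTower ℝ 𝕜 Y] {y : ℝ → Y} {y' : Y} {J : Set ℝ} {t : ℝ} (h : HasDerivWithinAt y y' J t)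
    (p : Fin C.n × ℕ) :
    HasDerivWithinAt (fun t => C.q p.1 p.2 (y t)) (C.q p.1 p.2 y') J t :=
  ((C.q p.1 p.2).restrictScalars ℝ).hasFDerivAt.comp_hasDerivWithinAt t h

variable [NormedSpace ℝ X] [IsScalarTower ℝ 𝕜 X]

namespace Reduction

variable {f : ℝ → E.D → Y} {S : C.Sets} (r : C.Reduction f S)

lemma P1_R (w : C.Y1) : C.P1 (r.R w) = r.R w := C.mem_D1_iff.1 (r.R_mem_D1 w)

lemma opA_R (w : C.Y1) : E.opA (r.R w) = w := by
  rw [← r.P1_R, ← C.Atilde_P1, r.P1_R, r.Atilde_R]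

lemma P1_point (t : ℝ) (w : C.Y1) (u : C.DS C.zero) : C.P1 (r.point t w u) = r.R w := by
  rw [point, map_add, map_add, r.P1_R, C.P1_of_mem_DS C.zero_subset_all u.2,
    C.P1_of_mem_DS le_rfl (r.xs t).2, add_zero, add_zero]

lemma opA_point (t : ℝ) (w : C.Y1) (u : C.DS C.zero) :
    E.opA (r.point t w u) = w + E.opA (r.xs t) := by
  rw [point, map_add, map_add, r.opA_R, C.opA_of_mem_zero u.2, add_zero]

lemma Q1_opA_point (t : ℝ) (w : C.Y1) (u : C.DS C.zero) :
    C.toY1 (E.opA (r.point t w u)) = w := by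
  refine Subtype.ext ?_
  change C.Q1 (E.opA (r.point t w u)) = w
  rw [C.Q1_opA, r.P1_point, r.opA_R]

lemma point_mem_M {t : ℝ} (ht : 0 ≤ t) {w : C.Y1} (hw : w ∈ S.M1t) {u : C.DS C.zero}
    (hu : (u : E.D) ∈ S.M20) : r.point t w u ∈ S.M :=
  Set.add_mem_add (Set.add_mem_add (r.R_mem_M1 hw) hu) (r.xs_mem ht)

variable {η : ℝ → C.Y1 → C.DS C.zero}

/-- At `x = x₁ + x₂₀ + x_{2Σ}(t)` with `F₂₀ = 0`, the equation `y' + B x = f(t, x)` holds if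
`y' = w' + A x'_{2Σ}` with the value of `w'` that the reduced equation prescribes. -/
lemma field_add_eq (hfs : C.HasStructure f) (hS : S.Open) (hη : r.IsRoot η) {t : ℝ} (ht : 0 ≤ t)
    {w : C.Y1} (hw : w ∈ S.M1t) :
    (r.field η t w + E.opA (r.dxs t)) + E.opB (r.point t w (η t w)) =
      f t (r.point t w (η t w)) := by
  have hfield : (r.field η t w : Y) =
      C.Q1 (f t (r.point t w (η t w)) - E.opB (r.R w)) := by
    rw [map_sub]; rfl
  refine C.ext_Y ?_ fun p hp => ?_
  · have h1 : C.Q1 (r.field η t w : Y) = r.field η t w := C.mem_Y1_iff.1 (r.field η t w).2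
    rw [map_add, map_add, C.Q1_opA_of_mem (r.dxs t).2, ← C.opB_P1, r.P1_point, h1, hfield, map_sub,
      ← C.opB_P1, r.P1_R]
    abel
  · rw [map_add, map_add, hfield, C.q_Q1 hp, zero_add, ← coeff_apply]
    have h1 : C.coeff p (r.R w) = 0 := C.P1_eq_self_iff.1 (r.P1_R w) p hp
    rcases Nat.eq_zero_or_pos p.2 with h0 | h0
    · have h := (F20_eq_zero_iff_of_components f t (r.R w) (r.xs t) (r.dxs t)
        (η t w).2).1 ((r.F_eq_zero_iff _ _ _).1 (hη.F_eq_zero t ht w hw)) p (mem_zero.2 h0)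
      rw [point, h, map_add, map_add, h1, zero_add, xs,
        r.isAdjointPart.coeff_sigmaPart_zero hS ht hp h0, add_zero]
    · have h := r.isAdjointPart.q_f_eq hfs hS ht (r.R_mem_D1 w) (η t w).2 hp h0
      have h2 : C.coeff p (η t w) = 0 := C.coeff_eq_zero C.zero_subset_all hp
        (fun h' => by rw [mem_zero] at h'; omega) (η t w).2
      rw [point, xs, h, map_add, map_add, h1, h2, zero_add, zero_add]
      rfl

variable [NormedSpace ℝ Y] [IsScalarTower ℝ 𝕜 Y]

/-- A solution of the reduced equation provides a solution of the given equation. -/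
theorem isSolutionOn_of_solvesOn [CompleteSpace Y] (hfs : C.HasStructure f)
    (hS : C.SolvabilityConditions f S)
    (hf : ContinuousOn (fun p : ℝ × E.D => f p.1 p.2) {p | 0 ≤ p.1}) (hη : r.IsRoot η)
    {J : Set ℝ} (hJ : ∀ t ∈ J, 0 ≤ t) {w : ℝ → C.Y1} (hw : SolvesOn (r.field η) S.M1t J w) :
    E.IsSolutionOn f S.M J (fun t => r.point t (w t) (η t (w t))) := by
  have hηw : ContinuousOn (fun t => η t (w t)) J :=
    hη.continuousOn.comp (continuousOn_id.prodMk hw.continuousOn) fun t ht => ⟨hJ t ht, (hw t ht).1⟩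
  have hpc := (r.continuousOn_f_point hf continuousOn_id hJ hw.continuousOn hηw).1
  refine ⟨continuous_subtype_val.comp_continuousOn hpc,
    fun t ht => r.point_mem_M (hJ t ht) (hw t ht).1 (hη.mem t (hJ t ht) _ (hw t ht).1),
    fun t => r.field η t (w t) + E.opA (r.dxs t), ?_, fun t ht => ⟨?_,
      r.field_add_eq hfs hS.isOpen hη (hJ t ht) (hw t ht).1⟩⟩
  · refine ContinuousOn.add (continuous_subtype_val.comp_continuousOn
      ((r.locallyLipschitzField hS hf hη).continuousOn.comp
        (continuousOn_id.prodMk hw.continuousOn) fun t ht => ⟨hJ t ht, (hw t ht).1⟩)) ?_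
    exact (C.restrictDS C.all E.opA).continuous.comp_continuousOn (r.continuousOn_dxs.mono hJ)
  · have h1 : HasDerivWithinAt (fun t => (w t : Y)) (r.field η t (w t)) J t :=
      (C.Y1.subtypeL.restrictScalars ℝ).hasFDerivAt.comp_hasDerivWithinAt t (hw t ht).2
    have h2 : HasDerivWithinAt (fun t => E.opA (r.xs t)) (E.opA (r.dxs t)) J t :=
      (IsAdjointPart.hasDerivWithinAt_comp
        (r.isAdjointPart.hasDerivWithinAt_sigmaPart (hJ t ht)) E.opA).mono hJ
    simp only [r.opA_point]
    exact h1.add h2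

end Reduction

/-! ### The components of a given solution -/

variable {f : ℝ → E.D → Y} {S : C.Sets} {σ τ : ℕ → ℝ → C.DS C.all}

lemma uniqueDiffWithinAt_of_isForwardInterval {t₀ : ℝ} {J : Set ℝ}
    (hJ : OperatorPair.IsForwardInterval t₀ J) {t : ℝ} (ht : t ∈ J) :
    UniqueDiffWithinAt ℝ J t := by
  obtain ⟨a, ha, b, hb, hab⟩ := hJ.2.2.2.exists_lt
  refine uniqueDiffOn_convex hJ.2.2.1.convex ⟨(a + b) / 2, ?_⟩ t ht
  refine interior_mono (hJ.2.2.1.out ha hb) ?_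
  rw [interior_Icc]
  constructor <;> linarith

lemma IsAdjointPart.coeff_tail_eq (hS : S.Open) (ha : C.IsAdjointPart f S σ τ) {t : ℝ}
    (ht : 0 ≤ t) {s : ℕ} (hs : 1 ≤ s) {x : E.D}
    (hstar : ∀ j ∈ Finset.Icc s (ν - 1), C.P (C.star j) x = σ j t)
    (hwedge : ∀ j ∈ Finset.Icc s (ν - 2), C.P (C.wedge j) x = τ j t)
    {p : Fin C.n × ℕ} (hp : p ∈ C.all) (hsp : s ≤ p.2) :
    C.coeff p x = C.coeff p (C.starPart σ s t + C.wedgePart τ s t : C.DS C.all) := by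
  classical
  have hp' := mem_all.1 hp
  have hm := C.m_le p.1
  rw [ha.coeff_tail hS ht hs hp, if_pos hsp]
  split_ifs with h
  · rw [← hstar p.2 (Finset.mem_Icc.2 ⟨hsp, by omega⟩), C.coeff_P (C.star_subset_all _) hp,
      if_pos (mem_star.2 ⟨h, rfl⟩)]
  · rw [← hwedge p.2 (Finset.mem_Icc.2 ⟨hsp, by omega⟩), C.coeff_P (C.wedge_subset_all _) hp,
      if_pos (mem_wedge.2 ⟨by omega, rfl⟩)]

variable [NormedSpace ℝ Y] [IsScalarTower ℝ 𝕜 Y]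

/-- In coordinates at the ends of chains `A x` vanishes; what remains of the equation there is
algebraic and determines the components `x_{2s}^{(s+1)}`, downwards in `s`. -/
lemma IsAdjointPart.star_of_isSolutionOn (hfs : C.HasStructure f)
    (hS : C.SolvabilityConditions f S) (ha : C.IsAdjointPart f S σ τ) {t₀ : ℝ} (ht₀ : 0 ≤ t₀)
    {J : Set ℝ} (hJ : OperatorPair.IsForwardInterval t₀ J) {x : ℝ → E.D}
    (hx : E.IsSolutionOn f S.M J x) {t : ℝ} (ht : t ∈ J) {s : ℕ}
    (hs : s ∈ Finset.Icc 1 (ν - 1)) : C.P (C.star s) (x t) = σ s t := by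
  classical
  obtain ⟨-, hxM, y', -, hy'⟩ := hx
  have ht0 : 0 ≤ t := ht₀.trans (hJ.2.1 ht)
  induction hk : ν - 1 - s using Nat.strong_induction_on generalizing s with
  | _ k ih =>
  have hs' := Finset.mem_Icc.1 hs
  have hz : (C.starPart σ (s + 1) t : E.D) ∈ S.starSum (s + 1) :=
    starPart_mem_starSum fun j hj => ha.star_mem j (by rw [Finset.mem_Icc] at hj ⊢; omega) t ht0
  refine (hS.uniqueSolvability.1 s hs t ht0 _ hz).unique
    ⟨(components_of_mem_M hS.isOpen (hxM t ht)).2.2.1 s hs, ?_⟩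
    ⟨ha.star_mem s hs t ht0, ha.star_eq s hs t ht0⟩
  rw [C.Fstar_eq_zero_iff f s t (C.P_mem _ _)]
  intro p hp
  have hpa := C.star_subset_all s hp
  have hp' := mem_star.1 hp
  have hsum : C.P (C.star s) (x t) + (C.starPart σ (s + 1) t : E.D) =
      ∑ j ∈ Finset.Icc s (ν - 1), C.P (C.star j) (x t) := by
    rw [sum_Icc_eq_add hs'.2, starPart, Submodule.coe_sum]
    refine congrArg _ (Finset.sum_congr rfl fun j hj => ?_)
    have hj' := Finset.mem_Icc.1 hj
    exact (ih (ν - 1 - j) (by omega) (Finset.mem_Icc.2 ⟨by omega, hj'.2⟩) rfl).symm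
  have hq0 : C.q p.1 p.2 (y' t) = 0 := by
    refine (uniqueDiffWithinAt_of_isForwardInterval hJ ht).eq_deriv _
      (hasDerivWithinAt_q (hy' t ht).1 p) ((hasDerivWithinAt_const t J (0 : 𝕜)).congr_of_mem
        (fun r _ => ?_) ht)
    exact C.q_opA_of_eq (by omega) _
  rw [hsum, ← q_f_star hfs ht0 hs'.1 hp, ← (hy' t ht).2, map_add, hq0, zero_add,
    C.coeff_P (C.star_subset_all s) hpa, if_pos hp, coeff_apply]

/-- In the remaining coordinates `A x` consists of coordinates of higher order, which are known
already, and so are their derivatives. -/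
lemma IsAdjointPart.wedge_of_isSolutionOn (hfs : C.HasStructure f)
    (hS : C.SolvabilityConditions f S) (ha : C.IsAdjointPart f S σ τ) {t₀ : ℝ} (ht₀ : 0 ≤ t₀)
    {J : Set ℝ} (hJ : OperatorPair.IsForwardInterval t₀ J) {x : ℝ → E.D}
    (hx : E.IsSolutionOn f S.M J x) {s : ℕ} (hs : s ∈ Finset.Icc 1 (ν - 2)) {t : ℝ} (ht : t ∈ J) :
    C.P (C.wedge s) (x t) = τ s t := by
  classical
  have hstar := fun t ht s hs => ha.star_of_isSolutionOn hfs hS ht₀ hJ hx (t := t) ht (s := s) hs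
  obtain ⟨-, hxM, y', -, hy'⟩ := hx
  have hJ0 : ∀ t ∈ J, 0 ≤ t := fun t ht => ht₀.trans (hJ.2.1 ht)
  induction hk : ν - 2 - s using Nat.strong_induction_on generalizing s t with
  | _ k ih =>
  have ht0 := hJ0 t ht
  have hs' := Finset.mem_Icc.1 hs
  have ih' : ∀ t ∈ J, ∀ j ∈ Finset.Icc (s + 1) (ν - 2), C.P (C.wedge j) (x t) = τ j t :=
    fun t ht j hj => by
      have hj' := Finset.mem_Icc.1 hj
      exact ih (ν - 2 - j) (by omega) (Finset.mem_Icc.2 ⟨by omega, hj'.2⟩) ht rfl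
  have hz : (C.starPart σ 1 t : E.D) ∈ S.starSum 1 :=
    starPart_mem_starSum fun j hj => ha.star_mem j hj t ht0
  have hv : (C.wedgePart τ (s + 1) t : E.D) ∈ S.wedgeSum (s + 1) :=
    wedgePart_mem_wedgeSum fun j hj => ha.wedge_mem j (by rw [Finset.mem_Icc] at hj ⊢; omega) t ht0
  refine (hS.uniqueSolvability.2.1 s hs t ht0 _ hz _ hv _
    (C.P_mem _ (C.tailDeriv σ τ (s + 1) t)) _ (C.P_mem _ (C.tailDeriv σ τ (s + 1) t))).unique
    ⟨(components_of_mem_M hS.isOpen (hxM t ht)).2.2.2 s hs, ?_⟩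
    ⟨ha.wedge_mem s hs t ht0, ha.wedge_eq s hs t ht0⟩
  rw [C.Fwedge_eq_zero_iff f s t (C.P_mem _ _) _ _ (C.P_mem _ _) (C.P_mem _ _)]
  intro p hp
  have hpa := C.wedge_subset_all s hp
  have hp' := mem_wedge.1 hp
  have hpn : (p.1, p.2 + 1) ∈ C.all := mem_all.2 (show p.2 + 1 < C.m p.1 by omega)
  have hsum : (C.starPart σ 1 t : E.D) + (C.P (C.wedge s) (x t) + C.wedgePart τ (s + 1) t) =
      ∑ j ∈ Finset.Icc 1 (ν - 1), C.P (C.star j) (x t) +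
        ∑ j ∈ Finset.Icc s (ν - 2), C.P (C.wedge j) (x t) := by
    rw [sum_Icc_eq_add hs'.2, starPart, wedgePart, Submodule.coe_sum, Submodule.coe_sum]
    exact congrArg₂ (· + ·) (Finset.sum_congr rfl fun j hj => (hstar t ht j hj).symm)
      (congrArg _ (Finset.sum_congr rfl fun j hj => (ih' t ht j hj).symm))
  have hq : C.q p.1 p.2 (y' t) = -C.coeff (p.1, p.2 + 1) (C.tailDeriv σ τ (s + 1) t) := by
    refine (uniqueDiffWithinAt_of_isForwardInterval hJ ht).eq_deriv _
      (hasDerivWithinAt_q (hy' t ht).1 p) (((IsAdjointPart.hasDerivWithinAt_comp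
        (ha.hasDerivWithinAt_tail ht0 hs'.2) (C.coeff (p.1, p.2 + 1))).mono hJ0).neg.congr_of_mem
        (fun r hr => ?_) ht)
    rw [C.q_opA_of_lt (by omega), ha.coeff_tail_eq hS.isOpen (hJ0 r hr) (by omega)
      (fun j hj => hstar r hr j (by rw [Finset.mem_Icc] at hj ⊢; omega)) (ih' r hr) hpn
      (show s + 1 ≤ p.2 + 1 by omega)]
    rfl
  rw [coeff_star_add_wedge hpn (by simp [hp'.2]), hsum,
    ← q_f_wedge hfs ht0 hs'.1 hp, ← (hy' t ht).2, map_add, hq,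
    C.coeff_P (C.wedge_subset_all s) hpa, if_pos hp, coeff_apply]
  abel

namespace Reduction

variable (r : C.Reduction f S) {η : ℝ → C.Y1 → C.DS C.zero}

/-- Every solution of the given equation comes from a solution of the reduced equation. -/
theorem solvesOn_of_isSolutionOn (hfs : C.HasStructure f)
    (hS : C.SolvabilityConditions f S) (hη : r.IsRoot η) {t₀ : ℝ} (ht₀ : 0 ≤ t₀)
    {J : Set ℝ} (hJ : OperatorPair.IsForwardInterval t₀ J) {x : ℝ → E.D}
    (hx : E.IsSolutionOn f S.M J x) :
    SolvesOn (r.field η) S.M1t J (fun t => C.toY1 (E.opA (x t))) ∧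
      ∀ t ∈ J, x t = r.point t (C.toY1 (E.opA (x t))) (η t (C.toY1 (E.opA (x t)))) := by
  classical
  have hstar := fun t ht s hs =>
    r.isAdjointPart.star_of_isSolutionOn hfs hS ht₀ hJ hx (t := t) ht (s := s) hs
  have hwedge := fun t ht s hs =>
    r.isAdjointPart.wedge_of_isSolutionOn hfs hS ht₀ hJ hx (t := t) (s := s) hs ht
  obtain ⟨-, hxM, y', -, hy'⟩ := hx
  have hJ0 : ∀ t ∈ J, 0 ≤ t := fun t ht => ht₀.trans (hJ.2.1 ht)
  have hw : ∀ t ∈ J, C.toY1 (E.opA (x t)) ∈ S.M1t ∧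
      r.R (C.toY1 (E.opA (x t))) = C.P1 (x t) := fun t ht => by
    obtain ⟨w, hw, hwx⟩ := r.mem_preimageD1_iff.1 (components_of_mem_M hS.isOpen (hxM t ht)).1
    have : C.toY1 (E.opA (x t)) = w := Subtype.ext (by
      change C.Q1 (E.opA (x t)) = w
      rw [C.Q1_opA, ← hwx, r.opA_R])
    rw [this]
    exact ⟨hw, hwx⟩
  have hdec : ∀ t ∈ J, x t = r.R (C.toY1 (E.opA (x t))) + C.P C.zero (x t) + r.xs t :=
    fun t ht => by
      conv_lhs => rw [← C.decomposition (x t)]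
      rw [(hw t ht).2, xs, sigmaPart, Submodule.coe_add, starPart, wedgePart, Submodule.coe_sum,
        Submodule.coe_sum]
      exact congrArg _ (congrArg₂ (· + ·) (Finset.sum_congr rfl (hstar t ht))
        (Finset.sum_congr rfl (hwedge t ht)))
  have heta : ∀ t ∈ J, C.P C.zero (x t) = η t (C.toY1 (E.opA (x t))) := fun t ht => by
    refine congrArg Subtype.val (hη.eq_of_F_eq_zero t (hJ0 t ht) _ (hw t ht).1
      ⟨C.P C.zero (x t), C.P_mem _ _⟩ (components_of_mem_M hS.isOpen (hxM t ht)).2.1 ?_)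
    rw [r.F_eq_zero_iff, F20_eq_zero_iff_of_components f t _ _ _ (C.P_mem _ _)]
    intro p hp
    have hpa := C.zero_subset_all hp
    have hq : C.q p.1 p.2 (y' t) = C.q p.1 p.2 (E.opA (r.dxs t)) := by
      refine (uniqueDiffWithinAt_of_isForwardInterval hJ ht).eq_deriv _
        (hasDerivWithinAt_q (hy' t ht).1 p) (((IsAdjointPart.hasDerivWithinAt_comp
          (r.isAdjointPart.hasDerivWithinAt_sigmaPart (hJ0 t ht))
            ((C.q p.1 p.2).toLinearMap.comp E.opA)).mono hJ0).congr_of_mem (fun s hs => ?_) ht)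
      have hA : E.opA (x s) = C.toY1 (E.opA (x s)) + E.opA (r.xs s) := by
        conv_lhs => rw [hdec s hs]
        rw [map_add, map_add, r.opA_R, C.opA_of_mem_zero (C.P_mem _ _), add_zero]
      have h0 : C.q p.1 p.2 (C.toY1 (E.opA (x s)) : Y) = 0 := C.q_Q1 hpa _
      rw [hA, map_add, h0, zero_add]
      rfl
    rw [← hdec t ht, ← (hy' t ht).2, map_add, hq, C.coeff_P C.zero_subset_all hpa, if_pos hp,
      coeff_apply]
  have hpt : ∀ t ∈ J, x t = r.point t (C.toY1 (E.opA (x t))) (η t (C.toY1 (E.opA (x t)))) :=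
    fun t ht => by
      conv_lhs => rw [hdec t ht, heta t ht]
      rfl
  refine ⟨fun t ht => ⟨(hw t ht).1, ?_⟩, hpt⟩
  let T : Y →L[ℝ] C.Y1 := (C.Q1.codRestrict C.Y1 fun y => ⟨y, rfl⟩).restrictScalars ℝ
  have h1 : HasDerivWithinAt (fun t => C.toY1 (E.opA (x t))) (T (y' t)) J t :=
    T.hasFDerivAt.comp_hasDerivWithinAt t (hy' t ht).1
  have h2 : T (y' t) = r.field η t (C.toY1 (E.opA (x t))) := by
    refine Subtype.ext ?_
    change C.Q1 (y' t) = C.Q1 (f t (r.point t _ _)) - C.Q1 (E.opB (r.R _))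
    rw [← hpt t ht, (hw t ht).2, ← (hy' t ht).2, map_add, ← C.opB_P1, ← C.opB_P1,
      ← (hw t ht).2, r.P1_R, add_sub_cancel_right]
  rw [← h2]
  exact h1

end Reduction

end CanonicalSystem

end

/-! ### Maximal solutions and blow-up -/

section

variable {𝕜 X Y : Type*} [RCLike 𝕜]
  [NormedAddCommGroup X] [NormedSpace 𝕜 X] [NormedAddCommGroup Y] [NormedSpace 𝕜 Y]

/-- If `D = X`, the bound is provided by the closed graph theorem. -/
lemma OperatorPair.IsBoundedA.exists_bound [CompleteSpace X] [CompleteSpace Y]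
    {E : OperatorPair 𝕜 X Y} (h : E.IsBoundedA) : ∃ K : ℝ, ∀ x : E.D, ‖E.opA x‖ ≤ K * ‖x‖ := by
  rcases h with h | h
  · have hD : ∀ x : X, x ∈ E.D := fun x => h ▸ Submodule.mem_top
    let L : X →ₗ[𝕜] Y := E.opA.comp (LinearMap.id.codRestrict E.D hD)
    have hg : (L.graph : Set (X × Y)) = E.A.graph := by
      ext ⟨x, y⟩
      simp only [SetLike.mem_coe, LinearMap.mem_graph_iff, LinearPMap.mem_graph_iff]
      constructor
      · rintro rfl; exact ⟨⟨x, hD x⟩, rfl, rfl⟩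
      · rintro ⟨z, rfl, rfl⟩; rfl
    have hL : Continuous L := L.continuous_of_isClosed_graph (by rw [hg]; exact E.closed_A)
    exact ⟨‖(⟨L, hL⟩ : X →L[𝕜] Y)‖, fun x => (⟨L, hL⟩ : X →L[𝕜] Y).le_opNorm (x : X)⟩
  · exact h

namespace CanonicalSystem

variable {E : OperatorPair 𝕜 X Y} {ν : ℕ} {C : CanonicalSystem E ν}

instance completeSpace_Y1 [CompleteSpace Y] : CompleteSpace C.Y1 := by
  have h : (C.Y1 : Set Y) = {y | C.Q1 y = y} := Set.ext fun y => C.mem_Y1_iff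
  have hc : IsClosed (C.Y1 : Set Y) := h ▸ isClosed_eq C.Q1.continuous continuous_id
  exact hc.completeSpace_coe

variable [NormedSpace ℝ X] [IsScalarTower ℝ 𝕜 X]

namespace Reduction

variable {f : ℝ → E.D → Y} {S : C.Sets} (r : C.Reduction f S) {η : ℝ → C.Y1 → C.DS C.zero}

lemma R_injective {w w' : C.Y1} (h : r.R w = r.R w') : w = w' :=
  Subtype.ext (by rw [← r.opA_R w, h, r.opA_R])

lemma boundedInside_of_boundedOnBounded (r : C.Reduction f S) (hM : S.M1t = univ) (h : C.BoundedOnBounded f S) :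
    C.BoundedInside f S := by
  intro a ha K _ hK _
  obtain ⟨ρ, hρ⟩ := hK.exists_norm_le
  obtain ⟨N, hN⟩ := h a ha (‖r.R‖ * |ρ| + 1) (by positivity)
  refine ⟨N, fun t ht x1 hx1 x20 hx20 xs hxs => ?_⟩
  obtain ⟨w, hw, rfl⟩ := r.mem_preimageD1_iff.1 hx1
  refine hN t ht _ (r.R_mem_M1 (by rw [hM]; trivial)) ?_ x20 hx20 xs hxs
  have h1 := r.R.le_opNorm w
  have h2 : ‖r.R‖ * ‖(w : Y)‖ ≤ ‖r.R‖ * |ρ| :=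
    mul_le_mul_of_nonneg_left ((hρ w hw).trans (le_abs_self ρ)) (norm_nonneg _)
  linarith

variable [NormedSpace ℝ Y] [IsScalarTower ℝ 𝕜 Y]

/-- The blow-up condition excludes solutions of the reduced equation on `[t₀, ∞)` in `Ω`. -/
lemma not_solvesOn_Ici {Ω : Set C.Y1} (hΩ : IsOpen Ω) (h : C.HasBlowUpFunctional f S Ω)
    (hη : r.IsRoot η) {t₀ : ℝ} (ht₀ : 0 ≤ t₀) {w : ℝ → C.Y1}
    (hw : SolvesOn (r.field η) S.M1t (Ici t₀) w) (hwΩ : ∀ t, t₀ ≤ t → w t ∈ Ω) : False := by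
  obtain ⟨m, V, U, ψ, hV, hUc, hU, hψ0, hψ, hUint, hψint, hineq⟩ := h
  refine not_global_of_blowUp hΩ ht₀ (w' := fun t => r.field η t (w t))
    (fun t ht => ⟨hwΩ t ht, (hw t ht).2⟩) (fun i => (hV i).2.2.1)
    (fun i => (hV i).2.2.2.differentiableOn one_ne_zero) hUc hU hψ0 hψ hUint hψint
    fun t ht j hj => ?_
  have ht0 := ht₀.trans ht
  exact hineq t ht0 _ (hη.mem t ht0 _ (hw t ht).1) _ (r.xs_mem ht0) _ (hwΩ t ht) _
    (r.R_mem_D1 (w t)) (r.Atilde_R _) j hj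

/-- A bound for the right-hand side of the reduced equation along a solution that stays away from
the boundary. -/
lemma exists_bound_field [CompleteSpace Y] (hB : C.BoundedInside f S) (hη : r.IsRoot η)
    {t₀ T : ℝ} (ht₀ : 0 ≤ t₀) (hT : t₀ < T) {w : ℝ → C.Y1}
    (hw : SolvesOn (r.field η) S.M1t (Ico t₀ T) w)
    (haway : ∀ ρ : ℝ, ∃ δ > 0, ∀ t ∈ Ico t₀ T, ‖w t‖ ≤ ρ → Metric.ball (w t) δ ⊆ S.M1t) (ρ : ℝ) :
    ∃ N : ℝ, ∀ t ∈ Ico t₀ T, ‖w t‖ ≤ ρ → ‖r.field η t (w t)‖ ≤ N := by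
  obtain ⟨δ, hδ, hball⟩ := haway ρ
  set K : Set C.Y1 := closure {v | ∃ t ∈ Ico t₀ T, ‖w t‖ ≤ ρ ∧ w t = v} with hK
  have hKb : Bornology.IsBounded K := by
    refine Bornology.IsBounded.closure ((Metric.isBounded_closedBall (x := (0 : C.Y1))
      (r := ρ)).subset ?_)
    rintro _ ⟨t, -, ht, rfl⟩
    simpa using ht
  have hKM : ∀ v ∈ K, Metric.ball v (δ / 2) ⊆ S.M1t := fun v hv y hy => by
    obtain ⟨_, ⟨t, ht, htρ, rfl⟩, hvt⟩ := Metric.mem_closure_iff.1 hv (δ / 2) (by positivity)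
    refine hball t ht htρ ?_
    rw [Metric.mem_ball] at hy ⊢
    linarith [dist_triangle y v (w t)]
  obtain ⟨N, hN⟩ := hB T (ht₀.trans_lt hT) K isClosed_closure hKb ⟨δ / 2, by positivity, hKM⟩
  let B : Y →L[𝕜] Y := C.Q1.comp ⟨E.opB.comp r.R.toLinearMap, E.continuous_opB_comp r.R⟩
  refine ⟨N + ‖B‖ * ρ, fun t ht htρ => ?_⟩
  have hwt := hw t ht
  have ht0 := ht₀.trans ht.1
  have h1 := hN t ⟨ht0, ht.2.le⟩ (r.R (w t))
    (r.mem_preimageD1_iff.2 ⟨w t, subset_closure ⟨t, ht, htρ, rfl⟩, rfl⟩) _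
    (hη.mem t ht0 _ hwt.1) _ (r.xs_mem ht0)
  have h2 : ‖B (w t)‖ ≤ ‖B‖ * ρ :=
    (B.le_opNorm _).trans (mul_le_mul_of_nonneg_left htρ (norm_nonneg _))
  have h3 : ‖r.field η t (w t)‖ = ‖C.Q1 (f t (r.point t (w t) (η t (w t)))) - B (w t)‖ := rfl
  rw [h3]
  exact (norm_sub_le _ _).trans (add_le_add h1 h2)

/-- The solution of the initial value problem, if the reduced equation has no global solution. -/
theorem exists_isUniqueMaximalSolution [CompleteSpace X] [CompleteSpace Y]
    (hfs : C.HasStructure f) (hS : C.SolvabilityConditions f S)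
    (hf : ContinuousOn (fun p : ℝ × E.D => f p.1 p.2) {p | 0 ≤ p.1}) (hη : r.IsRoot η) {t₀ : ℝ}
    (ht₀ : 0 ≤ t₀) {w₀ : C.Y1} (hw₀ : w₀ ∈ S.M1t)
    (hglobal : ∀ w, w t₀ = w₀ → ¬ SolvesOn (r.field η) S.M1t (Ici t₀) w) :
    ∃ (T : ℝ) (x : ℝ → E.D), E.IsUniqueMaximalSolution C f S.M t₀ T (r.R w₀) x ∧
      (C.BoundedInside f S → C.StaysAwayFromBoundary S t₀ T x → C.BlowsUp T x) := by
  obtain ⟨J, w, hJ, hwt₀, hw, hmax⟩ :=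
    (r.locallyLipschitzField hS hf hη).exists_maximal_solution ht₀ hw₀
  obtain rfl | ⟨T, hT, rfl, hno⟩ := hJ
  · exact absurd hw (hglobal w hwt₀)
  have hJ0 : ∀ t ∈ Ico t₀ T, 0 ≤ t := fun t ht => ht₀.trans ht.1
  have hfor : OperatorPair.IsForwardInterval t₀ (Ico t₀ T) :=
    ⟨⟨le_rfl, hT⟩, Ico_subset_Ici_self, ordConnected_Ico,
      ⟨t₀, ⟨le_rfl, hT⟩, (t₀ + T) / 2, ⟨by linarith, by linarith⟩, by linarith⟩⟩
  -- every solution with the given initial value is a restriction of the one obtained from `w`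
  have huniq : ∀ (J : Set ℝ) (y : ℝ → E.D), OperatorPair.IsForwardInterval t₀ J →
      E.IsSolutionOn f S.M J y → C.P1 (y t₀) = r.R w₀ → J ⊆ Ico t₀ T ∧
        EqOn y (fun t => r.point t (w t) (η t (w t))) J := fun J y hJ hy hy0 => by
    obtain ⟨h1, h2⟩ := r.solvesOn_of_isSolutionOn hfs hS hη ht₀ hJ hy
    obtain ⟨h3, h4⟩ := hmax J _ hJ.1 hJ.2.1 hJ.2.2.1 h1 (r.R_injective (by
      rw [h2 t₀ hJ.1, r.P1_point] at hy0; exact hy0))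
    refine ⟨h3, fun t ht => ?_⟩
    have h5 := h4 ht
    simp only at h5
    rw [h2 t ht, h5]
  have hP1 : ∀ t, C.P1 (r.point t (w t) (η t (w t))) = r.R (w t) := fun t => r.P1_point _ _ _
  refine ⟨T, fun t => r.point t (w t) (η t (w t)), ⟨⟨hfor,
    r.isSolutionOn_of_solvesOn hfs hS hf hη hJ0 hw, fun J' y hJ' hsub hy heq => ?_⟩, ?_, huniq⟩,
    fun hB haway => ?_⟩
  · refine ((huniq J' y hJ' hy ?_).1).antisymm hsub
    rw [heq ⟨le_rfl, hT⟩, r.P1_point, hwt₀]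
  · rw [r.P1_point, hwt₀]
  · have haway' : ∀ ρ : ℝ, ∃ δ > 0, ∀ t ∈ Ico t₀ T, ‖w t‖ ≤ ρ →
        Metric.ball (w t) δ ⊆ S.M1t := fun ρ => by
      obtain ⟨δ, hδ, h⟩ := haway ρ
      exact ⟨δ, hδ, fun t ht htρ => h t ht (w t) (by rw [hP1, r.Atilde_R]) htρ⟩
    have hlim := tendsto_norm_atTop_of_no_limit hT hw hno
      (r.exists_bound_field hB hη ht₀ hT hw haway') haway'
    refine ⟨?_, fun hA => ?_⟩
    · simp only [hP1, r.opA_R]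
      exact hlim
    · obtain ⟨K, hK⟩ := hA.exists_bound
      have hpos : 0 < ‖C.Q1‖ * |K| + 1 := by positivity
      refine tendsto_atTop_mono (fun t => ?_) (hlim.atTop_div_const hpos)
      rw [div_le_iff₀ hpos]
      have h1 : w t = C.toY1 (E.opA (r.point t (w t) (η t (w t)))) :=
        (r.Q1_opA_point _ _ _).symm
      set x := r.point t (w t) (η t (w t)) with hx
      have h2 : ‖w t‖ ≤ ‖C.Q1‖ * ‖E.opA x‖ := by
        rw [h1]; exact C.Q1.le_opNorm _
      have h3 : ‖E.opA x‖ ≤ |K| * ‖x‖ :=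
        (hK x).trans (mul_le_mul_of_nonneg_right (le_abs_self K) (norm_nonneg _))
      calc ‖w t‖ ≤ ‖C.Q1‖ * (|K| * ‖x‖) :=
            h2.trans (mul_le_mul_of_nonneg_left h3 (norm_nonneg _))
        _ ≤ ‖(x : X)‖ * (‖C.Q1‖ * |K| + 1) := by
            rw [← Submodule.coe_norm]
            nlinarith [norm_nonneg x]

/-- A global solution of the reduced equation provides a maximal solution on `[t₀, ∞)`. -/
lemma isMaximalSolution_of_solvesOn_Ici [CompleteSpace Y] (hfs : C.HasStructure f)
    (hS : C.SolvabilityConditions f S)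
    (hf : ContinuousOn (fun p : ℝ × E.D => f p.1 p.2) {p | 0 ≤ p.1}) (hη : r.IsRoot η) {t₀ : ℝ}
    (ht₀ : 0 ≤ t₀) {w : ℝ → C.Y1} (hw : SolvesOn (r.field η) S.M1t (Ici t₀) w) :
    E.IsMaximalSolution f S.M t₀ (Ici t₀) (fun t => r.point t (w t) (η t (w t))) :=
  ⟨⟨self_mem_Ici, subset_rfl, ordConnected_Ici,
      ⟨t₀, self_mem_Ici, t₀ + 1, by simp, by simp⟩⟩,
    r.isSolutionOn_of_solvesOn hfs hS hf hη (fun t ht => ht₀.trans ht) hw,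
    fun _ _ hJ' hsub _ _ => hJ'.2.1.antisymm hsub⟩

end Reduction

end CanonicalSystem

end

end

end ADAE

theorem mainTheorem10 {𝕜 X Y : Type*} [RCLike 𝕜]
    [NormedAddCommGroup X] [NormedSpace 𝕜 X] [NormedSpace ℝ X] [IsScalarTower ℝ 𝕜 X]
    [CompleteSpace X]
    [NormedAddCommGroup Y] [NormedSpace 𝕜 Y] [NormedSpace ℝ Y] [IsScalarTower ℝ 𝕜 Y]
    [CompleteSpace Y]
    (E : ADAE.OperatorPair 𝕜 X Y) (ν : ℕ) (hν : E.IsRegularPencilOfIndex ν)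
    (C : ADAE.CanonicalSystem E ν)
    (f : ℝ → E.D → Y)
    (hf : ContinuousOn (fun p : ℝ × E.D => f p.1 p.2) {p | 0 ≤ p.1})
    (hfs : C.HasStructure f)
    (S : C.Sets) (hS : C.SolvabilityConditions f S) :
    (S.M1t = Set.univ → C.BoundedOnBounded f S →
      ∀ Ω : Set C.Y1, IsOpen Ω → C.IsInvariant f S Ω → C.HasBlowUpFunctional f S Ω →
      ∀ t₀ : ℝ, 0 ≤ t₀ → ∀ x₁₀ ∈ C.preimageD1 Ω, ∃ T : ℝ, ∃ x : ℝ → E.D,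
        E.IsUniqueMaximalSolution C f S.M t₀ T x₁₀ x ∧ C.BlowsUp T x) ∧
    (C.BoundedInside f S → C.HasBlowUpFunctional f S S.M1t →
      ∀ t₀ : ℝ, 0 ≤ t₀ → ∀ x₁₀ ∈ S.M1, ∃ T : ℝ, ∃ x : ℝ → E.D,
        E.IsUniqueMaximalSolution C f S.M t₀ T x₁₀ x ∧
        (C.StaysAwayFromBoundary S t₀ T x → C.BlowsUp T x)) := by
  obtain ⟨R, hR1, hR2⟩ := C.exists_Atilde_inverse hν
  obtain ⟨σ, τ, hστ⟩ := ADAE.CanonicalSystem.exists_isAdjointPart hS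
  let r : C.Reduction f S := ⟨R, hR1, hR2, σ, τ, hστ⟩
  obtain ⟨η, hη⟩ := r.exists_isRoot hS hf
  refine ⟨fun hM hB Ω hΩ hinv hV t₀ ht₀ x₁₀ hx₁₀ => ?_, fun hB hV t₀ ht₀ x₁₀ hx₁₀ => ?_⟩
  · obtain ⟨w₀, hw₀, rfl⟩ := r.mem_preimageD1_iff.1 hx₁₀
    obtain ⟨T, x, hx, hblow⟩ := r.exists_isUniqueMaximalSolution hfs hS hf hη ht₀
      (w₀ := w₀) (by rw [hM]; trivial) fun w hwt₀ hw => by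
        refine r.not_solvesOn_Ici hΩ hV hη ht₀ hw fun t ht => ?_
        have h := hinv t₀ ht₀ _ _ (r.isMaximalSolution_of_solvesOn_Ici hfs hS hf hη ht₀ hw)
          (by rw [r.P1_point, hwt₀]; exact hx₁₀) t ht
        rw [r.P1_point] at h
        obtain ⟨w', hw', h'⟩ := r.mem_preimageD1_iff.1 h
        rwa [← r.R_injective h']
    refine ⟨T, x, hx, hblow (r.boundedInside_of_boundedOnBounded hM hB) fun ρ =>
      ⟨1, one_pos, fun t _ w _ _ => ?_⟩⟩
    rw [hM]
    exact Set.subset_univ _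
  · obtain ⟨w₀, hw₀, rfl⟩ := r.mem_preimageD1_iff.1 hx₁₀
    obtain ⟨T, x, hx, hblow⟩ := r.exists_isUniqueMaximalSolution hfs hS hf hη ht₀ hw₀
      fun w _ hw => r.not_solvesOn_Ici hS.isOpen.1 hV hη ht₀ hw fun t ht => (hw t ht).1
    exact ⟨T, x, hx, hblow hB⟩
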